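/- **Setting.** Let $x_{k+1}=Ax_k+Bu_k+w_k$, $y_k=Cx_k+v_k$ ($k\ge 0$) with $x_k\in\mathbb R^n$, $u_k\in\mathbb R^m$, $y_k\in\mathbb R^p$, $(A,B)$ controllable and $(A,C)$ observable. The variables $x_0\sim\mathcal N(\bar x_0,R_0)$, $w_k\sim\mathcal N(0,W)$, $v_k\sim\mathcal N(0,V)$ are all independent, with $R_0,W,V$ positive semidefinite. Let $Q=(Q^{1/2})^\top Q^{1/2}$ with $(A,Q^{1/2})$ detectable, $R$ positive definite, and $\theta\ge 0$ (the transmission price). Let $S\succeq 0$ solve $$S=Q+A^\top\big(S-SB(R+B^\top SB)^{-1}B^\top S\big)A,$$ and put $L=(R+B^\top SB)^{-1}B^\top SA$ and $\Sigma=A^\top SB(R+B^\top SB)^{-1}B^\top SA$. *Sensor.* The sensor runs the Kalman filter. Its prediction covariances $M_k$ and filtering covariances $P^s_k$ are given by $M_0=R_0$, $K_k=M_kC^\top(CM_kC^\top+V)^{-1}$, $P^s_k=M_k-K_kCM_k$, $M_{k+1}=AP^s_kA^\top+W$, and its estimates by $$\hat x^s_0=\bar x_0+K_0(y_0-C\bar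 x_0),\qquad \hat x^s_{k+1}=A\hat x^s_k+Bu_k+K_{k+1}\big(y_{k+1}-C(A\hat x^s_k+Bu_k)\big).$$ All matrices $CM_kC^\top+V$ are assumed invertible, and the filter is assumed to have a steady state: $P^s_k\to P^s$, where, with $M=AP^sA^\top+W$, the matrix $CMC^\top+V$ is invertible. Put $K=MC^\top(CMC^\top+V)^{-1}$ and $\Xi=K(CMC^\top+V)K^\top$; assume that $\Xi$ is positive definite. *Scheduling and control.* At time $k$ the scheduler chooses $\delta_k\in\{0,1\}$. A scheduling law is admissible if, for every $k$, $\delta_k$ is a (possibly time-dependent) measurable function of $\{y_0,\dots,y_k,u_0,\dots,u_{k-1},\delta_0,\dots,\delta_{k-1}\}$. If $\delta_k=1$, the remote side receives $\hat x^s_k$ at time $k+1$. It uses the linear estimator $\hat x^c_0=\bar x_0$, $\hat x^c_{k+1}=A\hat x^s_k+Bu_k$ if $\delta_k=1$ and $\hat x^c_{k+1}=A\hat x^c_k+Bu_k$ if $\delta_k=0$, and the certainty-equivalence control $u_k=-L\hat x^c_k$. The mismatch is $e_k=\hat x^c_k-\hat x^s_k$. The average cost of a scheduling law $\gamma$ is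 $$\Psi(\gamma)=\lim_{T\to\infty}\Psi_T(\gamma),\qquad \Psi_T(\gamma)=\frac1T\,\mathbf E\Big[\sum_{k=0}^{T}x_k^\top Qx_k+u_k^\top Ru_k+\theta\delta_k\Big].$$ *Differential cost.* Let $\xi\sim\mathcal N(0,\Xi)$. A differential cost is a bounded continuous function $h:\mathbb R^n\to\mathbb R$ with $h(0)=0$ for which there is a constant $j$ such that, for all $e\in\mathbb R^n$, $$j+h(e)=\min\big\{e^\top A^\top\Sigma Ae+\mathbf E[h(Ae+\xi)],\ \theta+\mathbf E[h(\xi)]\big\}.$$ **Theorem.** A differential cost exists, and under every admissible law the expected running cost at each time is finite. For every differential cost $h$, put $$\mathrm{VoI}(e)=e^\top A^\top\Sigma Ae+\mathbf E[h(Ae+\xi)]-\theta-\mathbf E[h(\xi)].$$ Then the deterministic stationary law $\gamma^*$ given by $\delta_k=1$ if $\mathrm{VoI}(e_k)\ge 0$ and $\delta_k=0$ otherwise is admissible, and: 1. Under $\gamma^*$, each $x_k$ is integrable and $\hat x^c_k=\mathbf E[x_k\mid\mathcal I^c_k]$ almost surely for every $k$, where $\mathcal I^c_k$ is the information of the remote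 side (the messages received up to time $k$, $u_0,\dots,u_{k-1}$ and $\delta_0,\dots,\delta_{k-1}$). Thus $u_k=-L\,\mathbf E[x_k\mid\mathcal I_k^c]$. 2. The limit $\Psi(\gamma^*)$ exists and equals $$\Psi_\infty=\operatorname{tr}\big(SW+A^\top\Sigma AP^s+\Sigma W\big)+\mathbf E[h(\xi)].$$ 3. $\gamma^*$ is optimal: $\liminf_{T\to\infty}\Psi_T(\gamma)\ge\Psi_\infty$ for every admissible scheduling law $\gamma$. -/

import Mathlib

open MeasureTheory ProbabilityTheory Filter Topology Matrix

noncomputable section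

/-- The data of the networked control problem: the plant
`x (k+1) = A x k + B u k + w k`, `y k = C x k + v k`, with noise covariances `W`, `V`, initial law
`N(xbar, R0)`, quadratic weights `Q`, `R` and transmission price `θ`. -/
structure NCS (n m p : ℕ) where
  A : Matrix (Fin n) (Fin n) ℝ
  B : Matrix (Fin n) (Fin m) ℝ
  C : Matrix (Fin p) (Fin n) ℝ
  W : Matrix (Fin n) (Fin n) ℝ
  V : Matrix (Fin p) (Fin p) ℝ
  xbar : EuclideanSpace ℝ (Fin n)
  R0 : Matrix (Fin n) (Fin n) ℝ
  Q : Matrix (Fin n) (Fin n) ℝ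
  R : Matrix (Fin m) (Fin m) ℝ
  θ : ℝ

/-- `(A, B)` is controllable: the matrix `[B, A B, …, A ^ (n-1) B]` has rank `n`. -/
def IsControllablePair {n m : ℕ} (A : Matrix (Fin n) (Fin n) ℝ) (B : Matrix (Fin n) (Fin m) ℝ) :
    Prop :=
  (Matrix.of fun (i : Fin n) (q : Fin n × Fin m) => (A ^ (q.1 : ℕ) * B) i q.2).rank = n

/-- `(A, C)` is observable: the matrix with blocks `C, C A, …, C A ^ (n-1)` has rank `n`. -/
def IsObservablePair {n p : ℕ} (A : Matrix (Fin n) (Fin n) ℝ) (C : Matrix (Fin p) (Fin n) ℝ) :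
    Prop :=
  (Matrix.of fun (q : Fin n × Fin p) (j : Fin n) => (C * A ^ (q.1 : ℕ)) q.2 j).rank = n

/-- `(A, H)` is detectable: some output injection `A - G H` has all its complex eigenvalues in the
open unit disc. -/
def IsDetectablePair {n q : ℕ} (A : Matrix (Fin n) (Fin n) ℝ) (H : Matrix (Fin q) (Fin n) ℝ) :
    Prop :=
  ∃ G : Matrix (Fin n) (Fin q) ℝ,
    ∀ z ∈ spectrum ℂ ((A - G * H).map (algebraMap ℝ ℂ)), ‖z‖ < 1

/-- The quadratic form `xᵀ M x`. -/
def quadForm {n : ℕ} (M : Matrix (Fin n) (Fin n) ℝ) (x : EuclideanSpace ℝ (Fin n)) : ℝ :=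
  x.ofLp ⬝ᵥ (M *ᵥ x.ofLp)

/-- The numerical value of a transmission decision. -/
def decisionValue (d : Bool) : ℝ := if d then 1 else 0

/-- The triple `(x k, x̂ˢ k, x̂ᶜ k)`: plant state, local (Kalman) estimate, remote estimate. -/
structure LoopState (n : ℕ) where
  x : EuclideanSpace ℝ (Fin n)
  xs : EuclideanSpace ℝ (Fin n)
  xc : EuclideanSpace ℝ (Fin n)

namespace NCS

variable {n m p : ℕ} (sys : NCS n m p)

/-! ### Kalman filter and Riccati equations -/

/-- Kalman gain for a prediction error covariance `M`. -/
def gain (M : Matrix (Fin n) (Fin n) ℝ) : Matrix (Fin n) (Fin p) ℝ :=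
  M * sys.Cᵀ * (sys.C * M * sys.Cᵀ + sys.V)⁻¹

/-- Covariance after the measurement update of a prediction error covariance `M`. -/
def measUpdate (M : Matrix (Fin n) (Fin n) ℝ) : Matrix (Fin n) (Fin n) ℝ :=
  M - sys.gain M * sys.C * M

/-- Covariance of the one-step prediction from a filtering error covariance `P`. -/
def timeUpdate (P : Matrix (Fin n) (Fin n) ℝ) : Matrix (Fin n) (Fin n) ℝ :=
  sys.A * P * sys.Aᵀ + sys.W

/-- Prediction error covariances of the Kalman filter. -/
def predCov : ℕ → Matrix (Fin n) (Fin n) ℝ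
  | 0 => sys.R0
  | k + 1 => sys.timeUpdate (sys.measUpdate (predCov k))

/-- Filtering error covariances `Pˢ k = cov (x k - x̂ˢ k)`. -/
def filtCov (k : ℕ) : Matrix (Fin n) (Fin n) ℝ := sys.measUpdate (sys.predCov k)

/-- `S` is a positive semidefinite solution of the control algebraic Riccati equation. -/
def IsControlRiccati (S : Matrix (Fin n) (Fin n) ℝ) : Prop :=
  S.PosSemidef ∧
    S = sys.Q + sys.Aᵀ *
      (S - S * sys.B * (sys.R + sys.Bᵀ * S * sys.B)⁻¹ * sys.Bᵀ * S) * sys.A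

/-- The certainty-equivalence gain `L = (R + Bᵀ S B)⁻¹ Bᵀ S A`; the control is `u = -L x̂ᶜ`. -/
def controlGain (S : Matrix (Fin n) (Fin n) ℝ) : Matrix (Fin m) (Fin n) ℝ :=
  (sys.R + sys.Bᵀ * S * sys.B)⁻¹ * sys.Bᵀ * S * sys.A

/-- `Σ = Aᵀ S B (R + Bᵀ S B)⁻¹ Bᵀ S A`. -/
def errWeight (S : Matrix (Fin n) (Fin n) ℝ) : Matrix (Fin n) (Fin n) ℝ :=
  sys.Aᵀ * S * sys.B * (sys.R + sys.Bᵀ * S * sys.B)⁻¹ * sys.Bᵀ * S * sys.A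

/-- `Ξ = K (C (A Pˢ Aᵀ + W) Cᵀ + V) Kᵀ`, with `K` the stationary Kalman gain. -/
def mismatchCov (Ps : Matrix (Fin n) (Fin n) ℝ) : Matrix (Fin n) (Fin n) ℝ :=
  sys.gain (sys.timeUpdate Ps) * (sys.C * sys.timeUpdate Ps * sys.Cᵀ + sys.V) *
    (sys.gain (sys.timeUpdate Ps))ᵀ

/-! ### The average-cost Markov decision process of the mismatch -/

/-- The law `N(0, Ξ)` of `ξ`. -/
def mismatchNoise (Ps : Matrix (Fin n) (Fin n) ℝ) : Measure (EuclideanSpace ℝ (Fin n)) :=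
  multivariateGaussian 0 (sys.mismatchCov Ps)

/-- The transition kernel: the law of `(1 - δ) A e + ξ` with `ξ ~ N(0, Ξ)`. -/
def transition (Ps : Matrix (Fin n) (Fin n) ℝ) (e : EuclideanSpace ℝ (Fin n)) (d : Bool) :
    Measure (EuclideanSpace ℝ (Fin n)) :=
  (sys.mismatchNoise Ps).map
    fun ξ => (1 - decisionValue d) • Matrix.toEuclideanLin sys.A e + ξ

/-- The stage cost `g(e, δ) = θ δ + (1 - δ) eᵀ Aᵀ Σ A e`. -/
def mdpCost (S : Matrix (Fin n) (Fin n) ℝ) (e : EuclideanSpace ℝ (Fin n)) (d : Bool) : ℝ :=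
  sys.θ * decisionValue d +
    (1 - decisionValue d) * quadForm (sys.Aᵀ * sys.errWeight S * sys.A) e

/-- `h` is a differential cost: a bounded continuous function, normalized by `h 0 = 0`, that solves
the average-cost optimality (Bellman) equation with the constant `j`. -/
structure IsDifferentialCost (S Ps : Matrix (Fin n) (Fin n) ℝ)
    (h : EuclideanSpace ℝ (Fin n) → ℝ) (j : ℝ) : Prop where
  continuous : Continuous h
  bounded : ∃ M : ℝ, ∀ e, |h e| ≤ M
  normalized : h 0 = 0
  bellman : ∀ e, j + h e =
    min (sys.mdpCost S e false + ∫ y, h y ∂(sys.transition Ps e false))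
      (sys.mdpCost S e true + ∫ y, h y ∂(sys.transition Ps e true))

/-- The value of information
`VoI(e) = eᵀ Aᵀ Σ A e + E[h(A e + ξ)] - θ - E[h(ξ)]`, with `ξ ~ N(0, Ξ)`. -/
def VoI (S Ps : Matrix (Fin n) (Fin n) ℝ) (h : EuclideanSpace ℝ (Fin n) → ℝ)
    (e : EuclideanSpace ℝ (Fin n)) : ℝ :=
  quadForm (sys.Aᵀ * sys.errWeight S * sys.A) e
    + (∫ ξ, h (Matrix.toEuclideanLin sys.A e + ξ) ∂(sys.mismatchNoise Ps))
    - sys.θ - ∫ ξ, h ξ ∂(sys.mismatchNoise Ps)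

/-! ### The closed loop -/

section Loop

variable {Ω : Type*} (S : Matrix (Fin n) (Fin n) ℝ) (x0 : Ω → EuclideanSpace ℝ (Fin n))
  (w : ℕ → Ω → EuclideanSpace ℝ (Fin n)) (v : ℕ → Ω → EuclideanSpace ℝ (Fin p))
  (δ : ℕ → Ω → Bool)

/-- The Kalman measurement update at time `k` of a prediction `xp`, given the measurement `y`. -/
def kalmanUpdate (k : ℕ) (xp : EuclideanSpace ℝ (Fin n)) (y : EuclideanSpace ℝ (Fin p)) :
    EuclideanSpace ℝ (Fin n) :=
  xp + Matrix.toEuclideanLin (sys.gain (sys.predCov k)) (y - Matrix.toEuclideanLin sys.C xp)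

/-- Closed loop under the control `u k = -L x̂ᶜ k` and the decisions `δ`. The local estimate is
sent with a delay of one step: if `δ k = 1` the receiver predicts `x (k+1)` from `x̂ˢ k`, otherwise
from its own estimate `x̂ᶜ k`. -/
def loop (ω : Ω) : ℕ → LoopState n
  | 0 =>
    { x := x0 ω
      xs := sys.kalmanUpdate 0 sys.xbar (Matrix.toEuclideanLin sys.C (x0 ω) + v 0 ω)
      xc := sys.xbar }
  | k + 1 =>
    let s := loop ω k
    let Bu := Matrix.toEuclideanLin sys.B (-Matrix.toEuclideanLin (sys.controlGain S) s.xc)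
    let x' := Matrix.toEuclideanLin sys.A s.x + Bu + w k ω
    { x := x'
      xs := sys.kalmanUpdate (k + 1) (Matrix.toEuclideanLin sys.A s.xs + Bu)
        (Matrix.toEuclideanLin sys.C x' + v (k + 1) ω)
      xc := if δ k ω then Matrix.toEuclideanLin sys.A s.xs + Bu
        else Matrix.toEuclideanLin sys.A s.xc + Bu }

/-- Plant state `x k`. -/
def plantState (k : ℕ) (ω : Ω) : EuclideanSpace ℝ (Fin n) := (sys.loop S x0 w v δ ω k).x

/-- Local Kalman estimate `x̂ˢ k`. -/
def localEst (k : ℕ) (ω : Ω) : EuclideanSpace ℝ (Fin n) := (sys.loop S x0 w v δ ω k).xs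

/-- Remote estimate `x̂ᶜ k`. -/
def remoteEst (k : ℕ) (ω : Ω) : EuclideanSpace ℝ (Fin n) := (sys.loop S x0 w v δ ω k).xc

/-- Measurement `y k = C x k + v k`. -/
def output (k : ℕ) (ω : Ω) : EuclideanSpace ℝ (Fin p) :=
  Matrix.toEuclideanLin sys.C (sys.plantState S x0 w v δ k ω) + v k ω

/-- Certainty-equivalence control `u k = -L x̂ᶜ k`. -/
def control (k : ℕ) (ω : Ω) : EuclideanSpace ℝ (Fin m) :=
  -Matrix.toEuclideanLin (sys.controlGain S) (sys.remoteEst S x0 w v δ k ω)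

/-- Estimate mismatch `e k = x̂ᶜ k - x̂ˢ k`. -/
def mismatch (k : ℕ) (ω : Ω) : EuclideanSpace ℝ (Fin n) :=
  sys.remoteEst S x0 w v δ k ω - sys.localEst S x0 w v δ k ω

/-- The message received at time `k + 1`: `x̂ˢ k` if `δ k = 1`, and nothing (coded by `0`; the
receiver also knows `δ k`) otherwise. -/
def received (k : ℕ) (ω : Ω) : EuclideanSpace ℝ (Fin n) :=
  if δ k ω then sys.localEst S x0 w v δ k ω else 0

/-- The σ-algebra of the scheduler's information `{y 0, …, y k, u 0, …, u (k-1), δ 0, …, δ (k-1)}`.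
-/
abbrev schedulerInfo (k : ℕ) : MeasurableSpace Ω :=
  (⨆ i, ⨆ _ : i ≤ k, MeasurableSpace.comap (sys.output S x0 w v δ i) inferInstance) ⊔
  (⨆ i, ⨆ _ : i < k, MeasurableSpace.comap (sys.control S x0 w v δ i) inferInstance) ⊔
  (⨆ i, ⨆ _ : i < k, MeasurableSpace.comap (δ i) inferInstance)

/-- The σ-algebra of the controller's information
`{z 0, …, z k, u 0, …, u (k-1), δ 0, …, δ (k-1)}`; nothing is received at time `0`. -/
abbrev controllerInfo (k : ℕ) : MeasurableSpace Ω :=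
  (⨆ i, ⨆ _ : i < k, MeasurableSpace.comap (sys.received S x0 w v δ i) inferInstance) ⊔
  (⨆ i, ⨆ _ : i < k, MeasurableSpace.comap (sys.control S x0 w v δ i) inferInstance) ⊔
  (⨆ i, ⨆ _ : i < k, MeasurableSpace.comap (δ i) inferInstance)

/-- Admissible scheduling: every decision `δ k` is a measurable function of the scheduler's
information at time `k`. The function may vary with `k`. -/
def IsAdmissible : Prop :=
  ∀ k, Measurable[sys.schedulerInfo S x0 w v δ k] (δ k)

/-- The running cost `xᵀ Q x + uᵀ R u + θ δ` at time `k`. -/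
def runningCost (k : ℕ) (ω : Ω) : ℝ :=
  quadForm sys.Q (sys.plantState S x0 w v δ k ω) + quadForm sys.R (sys.control S x0 w v δ k ω)
    + sys.θ * decisionValue (δ k ω)

/-- The average cost over the horizon `T`: `T⁻¹ E[∑_{k=0}^{T} (xᵀ Q x + uᵀ R u + θ δ)]`. -/
def avgCost [MeasurableSpace Ω] (μ : Measure Ω) (T : ℕ) : ℝ :=
  (1 / (T : ℝ)) * ∫ ω, ∑ k ∈ Finset.range (T + 1), sys.runningCost S x0 w v δ k ω ∂μ

end Loop

end NCS

end

/-! The loop separates. The errors of the Kalman filter do not see the control, its innovations are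
independent Gaussian vectors, and under any admissible law all that the scheduler knows at time k is
a function of the innovations up to k (`IsAdmissible.measurable_innovInfo`). Hence the mismatch is a
controlled chain e⁺ = (1 - δ) A e - n, where the correction n is centred Gaussian, independent of
the past, with covariance tending to Ξ. Completing squares with the Riccati equation turns the
expected total cost into known traces, boundary terms and the stage costs of this chain
(`IsAdmissible.sum_integral_runningCost`). What remains is an average-cost problem for e.

Its Bellman equation is solved by vanishing discount. Subtracting the value of transmitting turns
the discounted value into a nonpositive f. The difficulty is to bound f independently of the
discount, since the quadratic cost ‖H e‖² may be degenerate. `stopping_maximum_principle` does this.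
After enough steps the accumulated cost of the free evolution is coercive modulo the unobservable
subspace, along which f is constant, so the supremum of -f is governed by a fixed ball. On that ball
the Cameron-Martin density compares the law of A e + ξ with that of ξ, where the mean of f is known.
Shifted Gaussian averages are continuous with an explicit modulus, so Arzelà-Ascoli provides a
limit, which is a differential cost (`exists_average_cost_solution`).

The conditional-mean claim needs every differential cost h to be even. The difference D(e) = h(e) -
h(-e) is odd and satisfies |D(e)| ≤ |E D(A e + ξ)|. On a ball the laws shifted by a and by -a share
a fixed mass, which makes averaging an odd function a strict contraction. The maximum principle
carries this from the ball to the whole space, and D = 0 (`SolvesAverageCost.even`). Then VoI is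
even, and silence reveals only a symmetric event about e. By induction the mismatch is symmetric
given the information of the remote side (`NoiseModel.setLIntegral_neg_mismatch`), so the linear
estimator is the conditional mean.

For the cost, the Bellman inequality is summed along the loop, with equality for the law that
follows the sign of VoI. Replacing the time-varying noise by its limit costs an error tending to
zero uniformly over all laws (`NoiseModel.exists_verification_rate`); this uses that h is uniformly
continuous. Evaluating the equation at 0 gives j = E h(ξ). The terminal term E[xᵀ S x] is dropped in
the upper bound, but it has the wrong sign in the lower bound. There, detectability bounds the sum
of the second moments of the state by the cost. A cost that is too small would force many
consecutive second moments to be of order T, which exceeds that bound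
(`eventually_mul_le_of_moment_bound`). -/

open scoped RealInnerProductSpace

noncomputable section

/-! ### Shifts of a nondegenerate Gaussian measure -/

section GaussianShift

variable {n : ℕ}

local notation "𝔼" => EuclideanSpace ℝ (Fin n)
local notation "γ" => stdGaussian (EuclideanSpace ℝ (Fin n))

/-- The Cameron-Martin density of the standard Gaussian measure shifted by `a`. -/
def shiftDensity (a z : EuclideanSpace ℝ (Fin n)) : ℝ := Real.exp (⟪a, z⟫ - ‖a‖ ^ 2 / 2)

lemma continuous_shiftDensity (a : 𝔼) : Continuous (shiftDensity a) := by
  unfold shiftDensity; fun_prop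

lemma shiftDensity_pos (a z : 𝔼) : 0 < shiftDensity a z := Real.exp_pos _

lemma map_inner_stdGaussian (a : 𝔼) :
    (γ).map (fun z => ⟪a, z⟫) = gaussianReal 0 (‖a‖ ^ 2).toNNReal := by
  have h := IsGaussian.map_eq_gaussianReal (μ := γ) (innerSL ℝ a)
  have h1 : (fun z => ⟪a, z⟫) = ⇑(innerSL ℝ a) := by ext z; simp
  rw [h1, h, variance_dual_stdGaussian, integral_strongDual_stdGaussian]
  simp

lemma integrable_exp_inner_stdGaussian (a : 𝔼) :
    Integrable (fun z => Real.exp ⟪a, z⟫) γ := by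
  have h := integrable_exp_mul_gaussianReal (μ := 0) (v := (‖a‖ ^ 2).toNNReal) 1
  rw [← map_inner_stdGaussian] at h
  simpa [Function.comp_def] using (integrable_map_measure (by fun_prop) (by fun_prop)).1 h

lemma integral_exp_inner_stdGaussian (a : 𝔼) :
    ∫ z, Real.exp ⟪a, z⟫ ∂γ = Real.exp (‖a‖ ^ 2 / 2) := by
  have h := mgf_gaussianReal (map_inner_stdGaussian a) 1
  simpa [mgf] using h

lemma integrable_shiftDensity (a : 𝔼) : Integrable (shiftDensity a) γ := by
  have : shiftDensity a = fun z => Real.exp ⟪a, z⟫ * Real.exp (-(‖a‖ ^ 2 / 2)) := by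
    ext z; rw [shiftDensity, sub_eq_add_neg, Real.exp_add]
  rw [this]
  exact (integrable_exp_inner_stdGaussian a).mul_const _

lemma integral_shiftDensity (a : 𝔼) : ∫ z, shiftDensity a z ∂γ = 1 := by
  have : shiftDensity a = fun z => Real.exp ⟪a, z⟫ * Real.exp (-(‖a‖ ^ 2 / 2)) := by
    ext z; rw [shiftDensity, sub_eq_add_neg, Real.exp_add]
  rw [this, integral_mul_const, integral_exp_inner_stdGaussian, ← Real.exp_add]
  simp

lemma shiftDensity_sq (a : 𝔼) :
    (fun z => shiftDensity a z ^ 2) =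
      fun z => Real.exp ⟪(2 : ℝ) • a, z⟫ * Real.exp (-‖a‖ ^ 2) := by
  ext z
  rw [shiftDensity, ← Real.exp_add, ← Real.exp_nat_mul, inner_smul_left]
  congr 1
  push_cast
  simp
  ring

lemma integrable_shiftDensity_sq (a : 𝔼) : Integrable (fun z => shiftDensity a z ^ 2) γ := by
  rw [shiftDensity_sq]
  exact (integrable_exp_inner_stdGaussian _).mul_const _

lemma integral_shiftDensity_sq (a : 𝔼) :
    ∫ z, shiftDensity a z ^ 2 ∂γ = Real.exp (‖a‖ ^ 2) := by
  rw [shiftDensity_sq, integral_mul_const, integral_exp_inner_stdGaussian, ← Real.exp_add,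
    norm_smul]
  congr 1
  simp
  ring

/-- Coordinates are independent, so the integral is a product of one-dimensional complex moment
generating functions at the points a i + i t i. The real tilt a is what a Cameron-Martin density
produces inside a characteristic function. -/
lemma integral_cexp_inner_stdGaussian (a t : 𝔼) :
    ∫ z, Complex.exp (⟪z, a⟫ + ⟪z, t⟫ * Complex.I) ∂γ =
      Complex.exp (∑ i, ((a i : ℂ) + t i * Complex.I) ^ 2 / 2) := by
  rw [← map_pi_eq_stdGaussian, integral_map (by fun_prop) (by fun_prop), Complex.exp_sum]
  have h : ∀ i, Complex.exp (((a i : ℂ) + t i * Complex.I) ^ 2 / 2) =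
      ∫ x : ℝ, Complex.exp (((a i : ℂ) + t i * Complex.I) * x) ∂gaussianReal 0 1 := by
    intro i
    have := complexMGF_id_gaussianReal (μ := 0) (v := 1) ((a i : ℂ) + t i * Complex.I)
    simp only [complexMGF, id] at this
    rw [this]
    simp
  simp_rw [h]
  rw [← integral_fintype_prod_eq_prod]
  congr 1
  ext x
  rw [← Complex.exp_sum]
  congr 1
  simp only [PiLp.inner_apply, RCLike.inner_apply, conj_trivial, Complex.ofReal_sum,
    Complex.ofReal_mul, Finset.sum_mul, ← Finset.sum_add_distrib]
  exact Finset.sum_congr rfl fun i _ => by ring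

/-- The Cameron-Martin formula, by equality of characteristic functions: the tilted one is a complex
Gaussian integral, and expanding (a + i t)² yields the factor e^{i⟨a, t⟩} of the shift. -/
lemma map_add_stdGaussian (a : 𝔼) :
    (γ).map (fun z => a + z) =
      (γ).withDensity fun z => ENNReal.ofReal (shiftDensity a z) := by
  have hfin : IsFiniteMeasure ((γ).withDensity fun z => ENNReal.ofReal (shiftDensity a z)) :=
    isFiniteMeasure_withDensity_ofReal (integrable_shiftDensity a).2
  have : IsProbabilityMeasure ((γ).map (fun z => a + z)) :=
    Measure.isProbabilityMeasure_map (by fun_prop)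
  apply Measure.ext_of_charFun
  ext t
  rw [charFun_apply, charFun_apply, integral_map (by fun_prop) (by fun_prop),
    integral_withDensity_eq_integral_toReal_smul
      (continuous_shiftDensity a).measurable.ennreal_ofReal (by simp)]
  have h1 : ∀ z : 𝔼, Complex.exp (⟪a + z, t⟫ * Complex.I) =
      Complex.exp (⟪a, t⟫ * Complex.I) * Complex.exp (⟪z, t⟫ * Complex.I) := by
    intro z
    rw [← Complex.exp_add, inner_add_left]
    push_cast
    ring_nf
  have h2 : ∀ z : 𝔼, (ENNReal.ofReal (shiftDensity a z)).toReal •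
      Complex.exp (⟪z, t⟫ * Complex.I) =
      Complex.exp (-(‖a‖ : ℂ) ^ 2 / 2) * Complex.exp (⟪z, a⟫ + ⟪z, t⟫ * Complex.I) := by
    intro z
    rw [ENNReal.toReal_ofReal (shiftDensity_pos a z).le, shiftDensity, Complex.real_smul,
      Complex.ofReal_exp, ← Complex.exp_add, ← Complex.exp_add, real_inner_comm]
    push_cast
    ring_nf
  simp_rw [h1, h2]
  rw [integral_const_mul, integral_const_mul, integral_cexp_inner_stdGaussian, ← Complex.exp_add]
  have h3 := charFun_stdGaussian t
  rw [charFun_apply] at h3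
  rw [h3, ← Complex.exp_add]
  congr 1
  rw [← Complex.ofReal_pow, ← Complex.ofReal_pow, EuclideanSpace.real_norm_sq_eq,
    EuclideanSpace.real_norm_sq_eq, PiLp.inner_apply]
  simp only [RCLike.inner_apply, conj_trivial]
  push_cast
  rw [Finset.sum_mul, ← Finset.sum_neg_distrib, ← Finset.sum_neg_distrib, Finset.sum_div,
    Finset.sum_div, ← Finset.sum_add_distrib, ← Finset.sum_add_distrib]
  refine Finset.sum_congr rfl fun i _ => ?_
  ring_nf
  rw [Complex.I_sq]
  ring

lemma integral_add_stdGaussian (a : 𝔼) (g : 𝔼 → ℝ) :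
    ∫ z, g (a + z) ∂γ = ∫ z, g z * shiftDensity a z ∂γ := by
  have h := integral_map_equiv (μ := γ) (MeasurableEquiv.addLeft a) g
  simp only [MeasurableEquiv.coe_addLeft] at h
  rw [← h, map_add_stdGaussian, integral_withDensity_eq_integral_toReal_smul
      (continuous_shiftDensity a).measurable.ennreal_ofReal (by simp)]
  refine integral_congr_ae (.of_forall fun z => ?_)
  simp only [ENNReal.toReal_ofReal (shiftDensity_pos a z).le, smul_eq_mul]
  ring

lemma integrable_of_bounded {α : Type*} [TopologicalSpace α] [MeasurableSpace α]
    [OpensMeasurableSpace α] [SecondCountableTopologyEither α ℝ] (ν : Measure α)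
    [IsFiniteMeasure ν] {g : α → ℝ} (hg : Continuous g)
    {b : ℝ} (hb : ∀ e, |g e| ≤ b) : Integrable g ν :=
  Integrable.of_bound hg.aestronglyMeasurable b (.of_forall hb)

/-- The L¹ distance is at most the L² distance, which is explicit because the second moment of the
density is e^{‖a‖²}. Cauchy-Schwarz enters as nonnegativity of a variance. -/
lemma integral_abs_shiftDensity_sub_one_le (a : 𝔼) :
    ∫ z, |shiftDensity a z - 1| ∂γ ≤ Real.sqrt (Real.exp (‖a‖ ^ 2) - 1) := by
  have hm : MemLp (fun z => |shiftDensity a z - 1|) 2 γ := by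
    have h1 : MemLp (shiftDensity a) 2 γ :=
      (memLp_two_iff_integrable_sq (continuous_shiftDensity a).aestronglyMeasurable).2
        (integrable_shiftDensity_sq a)
    exact (h1.sub (memLp_const 1)).abs
  have hv := variance_eq_sub hm
  have h0 := variance_nonneg (fun z => |shiftDensity a z - 1|) γ
  rw [hv] at h0
  apply Real.le_sqrt_of_sq_le
  have h2 : ∫ z, (shiftDensity a z - 1) ^ 2 ∂γ = Real.exp (‖a‖ ^ 2) - 1 := by
    have : (fun z => (shiftDensity a z - 1) ^ 2) =
        fun z => shiftDensity a z ^ 2 - 2 * shiftDensity a z + 1 := by ext z; ring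
    rw [this, integral_add, integral_sub, integral_const_mul, integral_shiftDensity,
      integral_shiftDensity_sq]
    · simp; ring
    · exact integrable_shiftDensity_sq a
    · exact (integrable_shiftDensity a).const_mul _
    · exact (integrable_shiftDensity_sq a).sub ((integrable_shiftDensity a).const_mul _)
    · exact integrable_const _
  have h3 : ∫ z, ((fun z => |shiftDensity a z - 1|) ^ 2) z ∂γ =
      ∫ z, (shiftDensity a z - 1) ^ 2 ∂γ := by simp
  rw [h3, h2] at h0
  linarith

lemma integrable_mul_shiftDensity {g : 𝔼 → ℝ} (hg : Continuous g) {b : ℝ}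
    (hb : ∀ e, |g e| ≤ b) (a : 𝔼) : Integrable (fun z => g z * shiftDensity a z) γ :=
  (integrable_shiftDensity a).bdd_mul hg.aestronglyMeasurable (.of_forall hb)

/-- Where the density is at most l, it is replaced by l; where it exceeds l, it is at most its
square over l. Taking l large makes the coefficient of the bound b as small as desired, at the price
of a large multiple of the unshifted mean. -/
lemma integral_add_le_stdGaussian {g : 𝔼 → ℝ} (hg : Continuous g) {b : ℝ} (h0 : ∀ e, 0 ≤ g e)
    (hb : ∀ e, g e ≤ b) (a : 𝔼) {l : ℝ} (hl : 0 < l) :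
    ∫ z, g (a + z) ∂γ ≤ l * ∫ z, g z ∂γ + b * Real.exp (‖a‖ ^ 2) / l := by
  have hb' : ∀ e, |g e| ≤ b := fun e => by rw [abs_of_nonneg (h0 e)]; exact hb e
  rw [integral_add_stdGaussian]
  calc ∫ z, g z * shiftDensity a z ∂γ
      ≤ ∫ z, l * g z + (b / l) * shiftDensity a z ^ 2 ∂γ := by
        refine integral_mono (integrable_mul_shiftDensity hg hb' a)
          (((integrable_of_bounded γ hg hb').const_mul _).add
            ((integrable_shiftDensity_sq a).const_mul _)) fun z => ?_
        have hp := shiftDensity_pos a z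
        have hbz := hb z
        have h0z := h0 z
        have hb0 : 0 ≤ b := h0z.trans hbz
        rcases le_total (shiftDensity a z) l with h | h
        · have : 0 ≤ b / l * shiftDensity a z ^ 2 := by positivity
          have : g z * shiftDensity a z ≤ g z * l := by gcongr
          dsimp only
          linarith
        · have h1 : g z * shiftDensity a z ≤ b * shiftDensity a z := by gcongr
          have h2 : b * shiftDensity a z ≤ b / l * shiftDensity a z ^ 2 := by
            have : b / l * shiftDensity a z ^ 2 = b * shiftDensity a z * (shiftDensity a z / l) := by
              field_simp
            rw [this]
            exact le_mul_of_one_le_right (by positivity) ((one_le_div hl).2 h)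
          have : 0 ≤ l * g z := by positivity
          dsimp only
          linarith
    _ = _ := by
        rw [integral_add ((integrable_of_bounded γ hg hb').const_mul _)
            ((integrable_shiftDensity_sq a).const_mul _), integral_const_mul, integral_const_mul,
          integral_shiftDensity_sq]
        ring

/-- Total variation between two shifted Gaussian measures: after recentring at a', only the density
of the shift a - a' remains. The estimate uses no modulus of continuity of g, so it yields
equicontinuity from boundedness alone. -/
lemma abs_integral_add_sub_le_stdGaussian {g : 𝔼 → ℝ} (hg : Continuous g) {b : ℝ}
    (hb : ∀ e, |g e| ≤ b) (a a' : 𝔼) :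
    |∫ z, g (a + z) ∂γ - ∫ z, g (a' + z) ∂γ| ≤
      b * Real.sqrt (Real.exp (‖a - a'‖ ^ 2) - 1) := by
  have hc : Continuous fun z => g (a' + z) := by fun_prop
  have hb' : ∀ z, |g (a' + z)| ≤ b := fun z => hb _
  have h1 : ∫ z, g (a + z) ∂γ = ∫ z, g (a' + z) * shiftDensity (a - a') z ∂γ := by
    rw [← integral_add_stdGaussian (a - a') fun z => g (a' + z)]
    congr 1 with z
    congr 1
    abel
  have hb0 : 0 ≤ b := (abs_nonneg _).trans (hb 0)
  rw [h1, ← integral_sub (integrable_mul_shiftDensity hc hb' _) (integrable_of_bounded γ hc hb')]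
  calc |∫ z, g (a' + z) * shiftDensity (a - a') z - g (a' + z) ∂γ|
      ≤ ∫ z, |g (a' + z) * shiftDensity (a - a') z - g (a' + z)| ∂γ := abs_integral_le_integral_abs
    _ ≤ ∫ z, b * |shiftDensity (a - a') z - 1| ∂γ := by
        refine integral_mono_of_nonneg (.of_forall fun z => abs_nonneg _)
          ((((integrable_shiftDensity _).sub (integrable_const 1)).abs).const_mul _)
          (.of_forall fun z => ?_)
        dsimp only
        rw [← mul_sub_one, abs_mul]
        gcongr
        exact hb' z
    _ ≤ _ := by
        rw [integral_const_mul]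
        gcongr
        exact integral_abs_shiftDensity_sub_one_le _

lemma map_neg_stdGaussian : (γ).map (fun z => -z) = γ :=
  stdGaussian_map (E := 𝔼) (LinearIsometryEquiv.neg ℝ)

lemma integral_neg_stdGaussian (g : 𝔼 → ℝ) : ∫ z, g (-z) ∂γ = ∫ z, g z ∂γ := by
  have h := integral_map_equiv (μ := γ) (MeasurableEquiv.neg 𝔼) g
  refine h.symm.trans ?_
  change ∫ y, g y ∂(γ).map (fun z => -z) = _
  rw [map_neg_stdGaussian]

/-- The mass that the standard Gaussian measures shifted by `a` and `-a`, `‖a‖ ≤ r`, share. -/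
def overlap (n : ℕ) (r : ℝ) : ℝ :=
  ∫ z, Real.exp (-(r * ‖z‖) - r ^ 2 / 2) ∂(stdGaussian (EuclideanSpace ℝ (Fin n)))

lemma overlap_integrand_integrable {r : ℝ} (hr : 0 ≤ r) :
    Integrable (fun z => Real.exp (-(r * ‖z‖) - r ^ 2 / 2)) γ := by
  refine integrable_of_bounded _ (b := 1) (by fun_prop) fun z => ?_
  rw [abs_of_pos (Real.exp_pos _), Real.exp_le_one_iff]
  have : 0 ≤ r * ‖z‖ := by positivity
  have : 0 ≤ r ^ 2 / 2 := by positivity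
  linarith

lemma overlap_pos {r : ℝ} (hr : 0 ≤ r) : 0 < overlap n r := by
  rw [overlap, integral_pos_iff_support_of_nonneg (fun z => (Real.exp_pos _).le)
    (overlap_integrand_integrable hr)]
  have : (Function.support fun z : 𝔼 => Real.exp (-(r * ‖z‖) - r ^ 2 / 2)) = Set.univ := by
    ext z; simp [(Real.exp_pos _).ne']
  rw [this]
  simp

/-- For odd g, twice the average is the integral of g against the difference of the densities for a
and -a. Both densities lie above the integrand of `overlap`, so the absolute difference is at most
their sum minus twice that integrand, whose integral is 2 (1 - overlap). -/
lemma abs_integral_add_le_of_odd_stdGaussian {g : 𝔼 → ℝ} (hg : Continuous g) {b : ℝ}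
    (hb : ∀ e, |g e| ≤ b) (hodd : ∀ e, g (-e) = -g e) {r : ℝ} (hr : 0 ≤ r) {a : 𝔼} (ha : ‖a‖ ≤ r) :
    |∫ z, g (a + z) ∂γ| ≤ (1 - overlap n r) * b := by
  have hb0 : 0 ≤ b := (abs_nonneg _).trans (hb 0)
  have hi := fun a => integrable_mul_shiftDensity hg hb a
  have h1 : ∫ z, g (a + z) ∂γ = -∫ z, g (-a + z) ∂γ := by
    rw [← integral_neg_stdGaussian, ← integral_neg]
    congr 1 with z
    rw [← hodd]
    congr 1
    abel
  have h2 : 2 * ∫ z, g (a + z) ∂γ =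
      ∫ z, g z * shiftDensity a z - g z * shiftDensity (-a) z ∂γ := by
    rw [integral_sub (hi _) (hi _), ← integral_add_stdGaussian, ← integral_add_stdGaussian]
    linarith
  have hid := integrable_shiftDensity a
  have hid' := integrable_shiftDensity (-a)
  have hio := (overlap_integrand_integrable (n := n) hr).const_mul 2
  have h3 : |2 * ∫ z, g (a + z) ∂γ| ≤ ∫ z, b * (shiftDensity a z + shiftDensity (-a) z
      - 2 * Real.exp (-(r * ‖z‖) - r ^ 2 / 2)) ∂γ := by
    rw [h2]
    refine abs_integral_le_integral_abs.trans (integral_mono ((hi _).sub (hi _)).abs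
      (((hid.add hid').sub hio).const_mul _) fun z => ?_)
    have hlow : ∀ a : 𝔼, ‖a‖ ≤ r → Real.exp (-(r * ‖z‖) - r ^ 2 / 2) ≤ shiftDensity a z := by
      intro a ha
      refine Real.exp_le_exp.2 ?_
      have h4 := (abs_le.1 (abs_real_inner_le_norm a z)).1
      have h5 : ‖a‖ * ‖z‖ ≤ r * ‖z‖ := by gcongr
      have h6 : ‖a‖ ^ 2 ≤ r ^ 2 := by gcongr
      linarith
    have h4 := hlow a ha
    have h5 := hlow (-a) (by rwa [norm_neg])
    dsimp only
    rw [← mul_sub, abs_mul]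
    gcongr
    · exact hb z
    · rw [abs_le]; constructor <;> linarith
  have h6 : ∫ z, (shiftDensity a z + shiftDensity (-a) z
      - 2 * Real.exp (-(r * ‖z‖) - r ^ 2 / 2)) ∂γ = 2 * (1 - overlap n r) := by
    have h7 := integral_sub (hid.add hid') hio
    simp only [Pi.add_apply] at h7
    rw [h7, integral_add hid hid', integral_shiftDensity, integral_shiftDensity,
      integral_const_mul, overlap]
    ring
  rw [integral_const_mul, h6, abs_mul, abs_two] at h3
  linarith

end GaussianShift

/-! ### Averages over a Gaussian measure with an invertible factor -/

section GaussianAverage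

variable {n : ℕ}

local notation "𝔼" => EuclideanSpace ℝ (Fin n)
local notation "γ" => stdGaussian (EuclideanSpace ℝ (Fin n))

/-- The mean of `g` under the law of `a + T z`, with `z` standard Gaussian. -/
def gaussAvg (T : EuclideanSpace ℝ (Fin n) ≃L[ℝ] EuclideanSpace ℝ (Fin n))
    (g : EuclideanSpace ℝ (Fin n) → ℝ) (a : EuclideanSpace ℝ (Fin n)) : ℝ :=
  ∫ z, g (a + T z) ∂(stdGaussian (EuclideanSpace ℝ (Fin n)))

variable (T : EuclideanSpace ℝ (Fin n) ≃L[ℝ] EuclideanSpace ℝ (Fin n))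

lemma gaussAvg_eq_comp (g : 𝔼 → ℝ) (a : 𝔼) :
    gaussAvg T g a = ∫ z, g (T (T.symm a + z)) ∂γ := by
  simp [gaussAvg]

lemma integrable_gaussAvg {g : 𝔼 → ℝ} (hg : Continuous g) {b : ℝ} (hb : ∀ e, |g e| ≤ b) (a : 𝔼) :
    Integrable (fun z => g (a + T z)) γ :=
  integrable_of_bounded _ (by fun_prop) fun _ => hb _

lemma abs_gaussAvg_le {g : 𝔼 → ℝ} {b : ℝ} (hb : ∀ e, |g e| ≤ b) (a : 𝔼) :
    |gaussAvg T g a| ≤ b := by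
  have := norm_integral_le_of_norm_le_const (μ := γ) (f := fun z => g (a + T z)) (C := b)
    (.of_forall fun z => hb _)
  simpa [gaussAvg] using this

lemma gaussAvg_mono {g g' : 𝔼 → ℝ} (hg : Continuous g) (hg' : Continuous g') {b b' : ℝ}
    (hb : ∀ e, |g e| ≤ b) (hb' : ∀ e, |g' e| ≤ b') (h : ∀ e, g e ≤ g' e) (a : 𝔼) :
    gaussAvg T g a ≤ gaussAvg T g' a :=
  integral_mono (integrable_gaussAvg T hg hb a) (integrable_gaussAvg T hg' hb' a) fun _ => h _

lemma gaussAvg_sub {g g' : 𝔼 → ℝ} (hg : Continuous g) (hg' : Continuous g') {b b' : ℝ}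
    (hb : ∀ e, |g e| ≤ b) (hb' : ∀ e, |g' e| ≤ b') (a : 𝔼) :
    gaussAvg T (fun e => g e - g' e) a = gaussAvg T g a - gaussAvg T g' a :=
  integral_sub (integrable_gaussAvg T hg hb a) (integrable_gaussAvg T hg' hb' a)

lemma gaussAvg_const_mul (c : ℝ) (g : 𝔼 → ℝ) (a : 𝔼) :
    gaussAvg T (fun e => c * g e) a = c * gaussAvg T g a :=
  integral_const_mul _ _

lemma gaussAvg_sub_const {g : 𝔼 → ℝ} (hg : Continuous g) {b : ℝ} (hb : ∀ e, |g e| ≤ b)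
    (c : ℝ) (a : 𝔼) : gaussAvg T (fun e => g e - c) a = gaussAvg T g a - c := by
  rw [gaussAvg_sub T hg continuous_const hb (fun _ => le_rfl) a]
  simp [gaussAvg]

lemma gaussAvg_neg (g : 𝔼 → ℝ) (a : 𝔼) :
    gaussAvg T (fun e => -g e) a = -gaussAvg T g a :=
  integral_neg _

lemma gaussAvg_comp_neg (g : 𝔼 → ℝ) (a : 𝔼) :
    gaussAvg T (fun e => g (-e)) a = gaussAvg T g (-a) := by
  rw [gaussAvg, gaussAvg, ← integral_neg_stdGaussian]
  congr 1 with z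
  simp [add_comm]

lemma gaussAvg_le {g : 𝔼 → ℝ} (hg : Continuous g) {b : ℝ} (h0 : ∀ e, 0 ≤ g e)
    (hb : ∀ e, g e ≤ b) (a : 𝔼) {l : ℝ} (hl : 0 < l) :
    gaussAvg T g a ≤ l * gaussAvg T g 0 + b * Real.exp (‖T.symm a‖ ^ 2) / l := by
  have h := integral_add_le_stdGaussian (g := fun z => g (T z)) (by fun_prop) (fun _ => h0 _)
    (fun _ => hb _) (T.symm a) hl
  rw [gaussAvg_eq_comp T g a]
  simpa [gaussAvg] using h

lemma abs_gaussAvg_sub_le {g : 𝔼 → ℝ} (hg : Continuous g) {b : ℝ}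
    (hb : ∀ e, |g e| ≤ b) (a a' : 𝔼) :
    |gaussAvg T g a - gaussAvg T g a'| ≤
      b * Real.sqrt (Real.exp (‖T.symm (a - a')‖ ^ 2) - 1) := by
  rw [gaussAvg_eq_comp, gaussAvg_eq_comp, map_sub]
  exact abs_integral_add_sub_le_stdGaussian (g := fun z => g (T z)) (by fun_prop) (fun _ => hb _) _ _

lemma continuous_gaussAvg {g : 𝔼 → ℝ} (hg : Continuous g) {b : ℝ} (hb : ∀ e, |g e| ≤ b) :
    Continuous (gaussAvg T g) :=
  continuous_of_dominated (fun _ => by fun_prop) (fun a => .of_forall fun z => hb _)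
    (integrable_const b) (.of_forall fun z => by fun_prop)

/-- The contraction factor depends on r and T only, not on the odd function; this uniformity is what
`SolvesAverageCost.even` needs. -/
lemma abs_gaussAvg_le_of_odd {r : ℝ} (hr : 0 ≤ r) :
    ∃ ρ < 1, ∀ (g : 𝔼 → ℝ), Continuous g → ∀ b : ℝ, (∀ e, |g e| ≤ b) →
      (∀ e, g (-e) = -g e) → ∀ a : 𝔼, ‖a‖ ≤ r → |gaussAvg T g a| ≤ ρ * b := by
  set r' := ‖(T.symm : 𝔼 →L[ℝ] 𝔼)‖ * r
  refine ⟨1 - overlap n r', by linarith [overlap_pos (n := n) (r := r') (by positivity)], ?_⟩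
  intro g hg b hb hodd a ha
  rw [gaussAvg_eq_comp]
  refine abs_integral_add_le_of_odd_stdGaussian (g := fun z => g (T z)) (by fun_prop)
    (fun _ => hb _) (fun e => by rw [map_neg, hodd]) (by positivity) ?_
  exact ((T.symm : 𝔼 →L[ℝ] 𝔼).le_opNorm a).trans
    (mul_le_mul_of_nonneg_left ha (norm_nonneg _))

end GaussianAverage

/-! ### A maximum principle for stopping problems with a quadratic cost -/

section MaximumPrinciple

variable {n : ℕ}

local notation "𝔼" => EuclideanSpace ℝ (Fin n)
local notation "γ" => stdGaussian (EuclideanSpace ℝ (Fin n))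

/-- The unobservable subspace of the pair `(A, H)`. -/
def unobservable (A H : EuclideanSpace ℝ (Fin n) →L[ℝ] EuclideanSpace ℝ (Fin n)) :
    Submodule ℝ (EuclideanSpace ℝ (Fin n)) :=
  ⨅ i : ℕ, (H ∘L A ^ i).ker

variable (A H : EuclideanSpace ℝ (Fin n) →L[ℝ] EuclideanSpace ℝ (Fin n))
  (T : EuclideanSpace ℝ (Fin n) ≃L[ℝ] EuclideanSpace ℝ (Fin n))

lemma mem_unobservable {e : 𝔼} : e ∈ unobservable A H ↔ ∀ i, H ((A ^ i) e) = 0 := by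
  simp only [unobservable, Submodule.mem_iInf]
  rfl

lemma map_mem_unobservable {e : 𝔼} (he : e ∈ unobservable A H) : A e ∈ unobservable A H := by
  rw [mem_unobservable] at he ⊢
  intro i
  have := he (i + 1)
  rwa [pow_succ] at this

/-- The cost `∑_{i<N} ‖H A^i e‖²` of the free evolution from `e`. -/
def freeCost (N : ℕ) (e : EuclideanSpace ℝ (Fin n)) : ℝ :=
  ∑ i ∈ Finset.range N, ‖H ((A ^ i) e)‖ ^ 2

lemma freeCost_nonneg (N : ℕ) (e : 𝔼) : 0 ≤ freeCost A H N e :=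
  Finset.sum_nonneg fun _ _ => by positivity

lemma freeCost_succ (N : ℕ) (e : 𝔼) : freeCost A H (N + 1) e = ‖H e‖ ^ 2 + freeCost A H N (A e) := by
  rw [freeCost, Finset.sum_range_succ', freeCost, add_comm]
  congr 1

lemma freeCost_add_le (N : ℕ) (x y : 𝔼) :
    freeCost A H N x ≤ 2 * freeCost A H N (x + y) + 2 * freeCost A H N y := by
  simp only [freeCost, Finset.mul_sum, ← Finset.sum_add_distrib]
  refine Finset.sum_le_sum fun i _ => ?_
  have h : H ((A ^ i) x) = H ((A ^ i) (x + y)) - H ((A ^ i) y) := by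
    rw [map_add, map_add, add_sub_cancel_right]
  rw [h]
  have h1 := norm_sub_le (H ((A ^ i) (x + y))) (H ((A ^ i) y))
  nlinarith [norm_nonneg (H ((A ^ i) (x + y)) - H ((A ^ i) y)),
    sq_nonneg (‖H ((A ^ i) (x + y))‖ - ‖H ((A ^ i) y)‖)]

lemma integrable_norm_map_sq (L : 𝔼 →L[ℝ] 𝔼) : Integrable (fun z => ‖L z‖ ^ 2) γ := by
  have h : MemLp (fun z : 𝔼 => L z) 2 γ := L.comp_memLp' IsGaussian.memLp_two_id
  exact (memLp_two_iff_integrable_sq_norm h.1).1 h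

lemma integrable_freeCost (N : ℕ) : Integrable (fun z => freeCost A H N (T z)) γ :=
  integrable_finsetSum _ fun i _ =>
    integrable_norm_map_sq (H ∘L (A ^ i) ∘L (T : 𝔼 →L[ℝ] 𝔼))

/-- The subspaces on which the first N penalties vanish decrease with N and stabilize by finite
dimension, at the unobservable subspace. On its orthogonal complement the stacked map of the first N
outputs is injective, hence bounded below. -/
lemma exists_freeCost_coercive :
    ∃ N : ℕ, ∃ c > 0, ∀ e, ∃ k ∈ unobservable A H, c * ‖e - k‖ ^ 2 ≤ freeCost A H N e := by
  -- The chain is decreasing, hence the order dual.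
  let K : ℕ →o (Submodule ℝ 𝔼)ᵒᵈ :=
    { toFun := fun N => OrderDual.toDual (⨅ i : Fin N, (H ∘L A ^ (i : ℕ)).ker)
      monotone' := fun N M h => OrderDual.toDual_le_toDual.2
        (le_iInf fun i => iInf_le_of_le ⟨i, i.2.trans_le h⟩ le_rfl) }
  obtain ⟨N, hN⟩ := IsArtinian.monotone_stabilizes K
  let Φ : 𝔼 →ₗ[ℝ] (Fin N → 𝔼) := LinearMap.pi fun i => (H ∘L A ^ (i : ℕ) : 𝔼 →L[ℝ] 𝔼)
  have hker : ∀ e, Φ e = 0 → e ∈ unobservable A H := by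
    intro e he
    rw [mem_unobservable]
    intro i
    have hmem : ∀ N, e ∈ OrderDual.ofDual (K N) ↔ ∀ i : Fin N, H ((A ^ (i : ℕ)) e) = 0 := by
      intro N
      change e ∈ (⨅ i : Fin N, (H ∘L A ^ (i : ℕ)).ker : Submodule ℝ _) ↔ _
      rw [Submodule.mem_iInf]
      rfl
    have h1 : e ∈ OrderDual.ofDual (K N) := (hmem N).2 fun j => congrFun he j
    have h2 : K N = K (N + (i + 1)) := hN _ (by omega)
    rw [h2, hmem] at h1
    exact h1 ⟨i, by omega⟩
  let Ψ := Φ.comp (unobservable A H)ᗮ.subtype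
  have hΨ : Ψ.ker = ⊥ := by
    rw [LinearMap.ker_eq_bot']
    intro m hm
    have h1 : (m : 𝔼) ∈ unobservable A H := hker _ hm
    have h2 := Submodule.inner_right_of_mem_orthogonal h1 m.2
    exact Subtype.ext (inner_self_eq_zero.1 h2)
  obtain ⟨C, hC0, hC⟩ := Ψ.exists_antilipschitzWith hΨ
  refine ⟨N, 1 / (C : ℝ) ^ 2, by positivity, fun e => ?_⟩
  obtain ⟨k, hk, p, hp, rfl⟩ := Submodule.exists_add_mem_mem_orthogonal (K := unobservable A H) e
  refine ⟨k, hk, ?_⟩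
  have h1 := hC.le_mul_dist ⟨p, hp⟩ 0
  simp only [dist_zero_right, map_zero] at h1
  have h2 : ∀ i, H ((A ^ i) (k + p)) = H ((A ^ i) p) := fun i => by
    rw [map_add, map_add, (mem_unobservable A H).1 hk i, zero_add]
  have h3 : ‖Ψ ⟨p, hp⟩‖ ^ 2 ≤ freeCost A H N (k + p) := by
    have h0 := freeCost_nonneg A H N (k + p)
    refine (Real.le_sqrt (norm_nonneg _) h0).1 ((pi_norm_le_iff_of_nonneg (Real.sqrt_nonneg _)).2
      fun i => Real.le_sqrt_of_sq_le ?_)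
    change ‖H ((A ^ (i : ℕ)) p)‖ ^ 2 ≤ _
    rw [← h2, freeCost]
    exact Finset.single_le_sum (f := fun i => ‖H ((A ^ i) (k + p))‖ ^ 2)
      (fun i _ => by positivity) (Finset.mem_range.2 i.2)
  have h4 : ‖k + p - k‖ = ‖(⟨p, hp⟩ : (unobservable A H)ᗮ)‖ := by simp
  rw [h4, one_div, inv_mul_le_iff₀ (by positivity)]
  calc ‖(⟨p, hp⟩ : (unobservable A H)ᗮ)‖ ^ 2 ≤ (C * ‖Ψ ⟨p, hp⟩‖) ^ 2 := by gcongr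
    _ = (C : ℝ) ^ 2 * ‖Ψ ⟨p, hp⟩‖ ^ 2 := by ring
    _ ≤ _ := by gcongr

/-- One averaging step preserves a bound of the form D + (b - c · free cost)⁺: the parallelogram
inequality moves the noise out of the quadratic form, halving c and adding a constant that does not
depend on b. -/
lemma gaussAvg_le_of_le_max {g : 𝔼 → ℝ} (hg : Continuous g) {b' : ℝ} (hb' : ∀ e, |g e| ≤ b')
    {N : ℕ} {D b c : ℝ} (hc0 : 0 ≤ c) (h : ∀ e, g e ≤ D + max 0 (b - c * freeCost A H N e)) (a : 𝔼) :
    gaussAvg T g a ≤ D + max 0 (b - c / 2 * freeCost A H N a)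
      + c * ∫ z, freeCost A H N (T z) ∂γ := by
  have hint := (integrable_freeCost A H T N).const_mul c
  calc gaussAvg T g a
      ≤ ∫ z, (D + max 0 (b - c / 2 * freeCost A H N a)) + c * freeCost A H N (T z) ∂γ := by
        refine integral_mono (integrable_gaussAvg T hg hb' _)
          ((integrable_const _).add hint) fun z => ?_
        have h2 := h (a + T z)
        have h3 := mul_le_mul_of_nonneg_left (freeCost_add_le A H N a (T z)) hc0
        have h4 := mul_nonneg hc0 (freeCost_nonneg A H N (T z))
        have h5 : max 0 (b - c * freeCost A H N (a + T z)) ≤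
            max 0 (b - c / 2 * freeCost A H N a) + c * freeCost A H N (T z) := by
          refine max_le (add_nonneg (le_max_left _ _) h4) ?_
          have h6 := le_max_right 0 (b - c / 2 * freeCost A H N a)
          linarith
        dsimp only
        linarith
    _ = _ := by rw [integral_add (integrable_const _) hint, integral_const_mul]; simp

/-- N applications of the subsolution inequality accumulate N steps of running cost, each halving
the coefficient. The constant D is chosen before g and b, which is the whole point. -/
lemma exists_stopping_bound (J : ℝ) (N : ℕ) :
    ∃ D, 0 ≤ D ∧ ∀ (g : 𝔼 → ℝ) (b : ℝ), Continuous g → (∀ e, 0 ≤ g e) → (∀ e, g e ≤ b) →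
      (∀ e, g e ≤ max (J - ‖H e‖ ^ 2 + gaussAvg T g (A e)) 0) →
      ∀ e, g e ≤ D + max 0 (b - (1 / 2) ^ N * freeCost A H N e) := by
  induction N with
  | zero =>
    refine ⟨0, le_rfl, fun g b _ h0 hb _ e => ?_⟩
    simp only [freeCost, Finset.range_zero, Finset.sum_empty, mul_zero, sub_zero, zero_add]
    exact (hb e).trans (le_max_right _ _)
  | succ N ih =>
    obtain ⟨D, hD, ih⟩ := ih
    obtain ⟨c, hc⟩ : ∃ c : ℝ, c = (1 / 2) ^ N := ⟨_, rfl⟩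
    have hc0 : 0 ≤ c := by rw [hc]; positivity
    have hc1 : c ≤ 1 := by rw [hc]; exact pow_le_one₀ (by norm_num) (by norm_num)
    obtain ⟨w, hw'⟩ : ∃ w, w = ∫ z, freeCost A H N (T z) ∂γ := ⟨_, rfl⟩
    have hw : 0 ≤ w := by rw [hw']; exact integral_nonneg fun z => freeCost_nonneg A H N _
    have hz : 0 ≤ |J| + D + c * w := by positivity
    refine ⟨|J| + D + c * w, hz, fun g b hg h0 hb hJ e => ?_⟩
    rw [← hc] at ih
    have h1 := gaussAvg_le_of_le_max A H T hg
      (fun e => (abs_of_nonneg (h0 e)).le.trans (hb e)) hc0 (ih g b hg h0 hb hJ) (A e)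
    rw [← hw'] at h1
    have hq : 0 ≤ ‖H e‖ ^ 2 := by positivity
    rw [freeCost_succ, pow_succ, ← hc]
    refine (hJ e).trans (max_le ?_ (add_nonneg hz (le_max_left _ _)))
    have h3 : -‖H e‖ ^ 2 + max 0 (b - c / 2 * freeCost A H N (A e)) ≤
        max 0 (b - c * (1 / 2) * (‖H e‖ ^ 2 + freeCost A H N (A e))) := by
      have : c / 2 * ‖H e‖ ^ 2 ≤ ‖H e‖ ^ 2 := mul_le_of_le_one_left hq (by linarith)
      rcases max_cases 0 (b - c / 2 * freeCost A H N (A e)) with ⟨h, _⟩ | ⟨h, _⟩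
      · rw [h]
        exact le_max_of_le_left (by linarith)
      · rw [h]
        exact le_max_of_le_right (by linarith)
    linarith [le_abs_self J]

/-- Far from the unobservable subspace the accumulated cost pushes g below its supremum M by a fixed
amount, unless g ≤ D there. Points near it are moved into the ball by invariance. So M is at most
the claimed bound or at most M - s with s > 0, and the latter is absurd. -/
theorem stopping_maximum_principle (J : ℝ) :
    ∃ R D, 0 ≤ R ∧ 0 ≤ D ∧ ∀ (g : 𝔼 → ℝ) (b : ℝ), Continuous g → (∀ e, 0 ≤ g e) → (∀ e, g e ≤ b) →
      (∀ e, ∀ k ∈ unobservable A H, g (e + k) = g e) →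
      (∀ e, g e ≤ max (J - ‖H e‖ ^ 2 + gaussAvg T g (A e)) 0) →
      ∀ a, (∀ e, ‖e‖ ≤ R → g e ≤ a) → ∀ e, g e ≤ max D a := by
  obtain ⟨N, c, hc, hcoer⟩ := exists_freeCost_coercive A H
  obtain ⟨D, hD, hbound⟩ := exists_stopping_bound A H T J N
  set s : ℝ := (1 / 2) ^ N
  have hs : 0 < s := by positivity
  -- The radius is the one at which coercivity gives free cost at least 2 D / s + 1; then D + M - s
  -- · (free cost) ≤ M - D - s ≤ M - s.
  refine ⟨Real.sqrt ((2 * D / s + 1) / c), D, Real.sqrt_nonneg _, hD, ?_⟩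
  intro g b hg h0 hb hinv hJ a ha
  have hbdd : BddAbove (Set.range g) := ⟨b, by rintro _ ⟨e, rfl⟩; exact hb e⟩
  set M := ⨆ e, g e
  have hM : ∀ e, g e ≤ M := le_ciSup hbdd
  have key : ∀ e, g e ≤ max (max D a) (M - s) := by
    intro e
    obtain ⟨k, hk, hke⟩ := hcoer e
    rcases le_total (freeCost A H N e) (2 * D / s + 1) with h | h
    · have h1 : ‖e - k‖ ≤ Real.sqrt ((2 * D / s + 1) / c) := by
        apply Real.le_sqrt_of_sq_le
        rw [le_div_iff₀ hc]
        linarith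
      have h2 := hinv (e - k) k hk
      rw [sub_add_cancel] at h2
      rw [h2]
      exact (ha _ h1).trans ((le_max_right _ _).trans (le_max_left _ _))
    · have h1 := hbound g M hg h0 hM hJ e
      have h2 : 2 * D + s ≤ s * freeCost A H N e := by
        have : s * (2 * D / s + 1) = 2 * D + s := by field_simp
        rw [← this]
        gcongr
      refine h1.trans ?_
      rcases max_cases 0 (M - s * freeCost A H N e) with ⟨h, _⟩ | ⟨h, _⟩
      · rw [h]
        exact le_max_of_le_left (le_max_of_le_left (by linarith))
      · rw [h]
        exact le_max_of_le_right (by linarith)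
  have hM' : M ≤ max (max D a) (M - s) := ciSup_le key
  intro e
  rcases le_max_iff.1 hM' with h | h
  · exact (hM e).trans h
  · linarith

end MaximumPrinciple

/-! ### The average-cost optimality equation -/

section AverageCost

variable {n : ℕ}

local notation "𝔼" => EuclideanSpace ℝ (Fin n)

variable (A H : EuclideanSpace ℝ (Fin n) →L[ℝ] EuclideanSpace ℝ (Fin n))
  (T : EuclideanSpace ℝ (Fin n) ≃L[ℝ] EuclideanSpace ℝ (Fin n))

lemma le_gaussAvg {g : 𝔼 → ℝ} (hg : Continuous g) {b c : ℝ} (hb : ∀ e, |g e| ≤ b)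
    (hc : ∀ e, c ≤ g e) (a : 𝔼) : c ≤ gaussAvg T g a := by
  have := gaussAvg_mono T continuous_const hg (fun _ => le_rfl) hb hc a
  simpa [gaussAvg] using this

lemma gaussAvg_le_const {g : 𝔼 → ℝ} (hg : Continuous g) {b c : ℝ} (hb : ∀ e, |g e| ≤ b)
    (hc : ∀ e, g e ≤ c) (a : 𝔼) : gaussAvg T g a ≤ c := by
  have := gaussAvg_mono T hg continuous_const hb (fun _ => le_rfl) hc a
  simpa [gaussAvg] using this

lemma gaussAvg_add (g : 𝔼 → ℝ) (a k : 𝔼) :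
    gaussAvg T g (a + k) = gaussAvg T (fun e => g (e + k)) a := by
  simp only [gaussAvg]
  congr 1 with z
  congr 1
  abel

lemma abs_gaussAvg_add_sub_le {g : 𝔼 → ℝ} (hg : Continuous g) {b β : ℝ} (hb : ∀ e, |g e| ≤ b)
    {k : 𝔼} (hk : ∀ e, |g (e + k) - g e| ≤ β) (a : 𝔼) :
    |gaussAvg T g (a + k) - gaussAvg T g a| ≤ β := by
  rw [gaussAvg_add, ← gaussAvg_sub T (by fun_prop) hg (fun _ => hb _) hb]
  exact abs_gaussAvg_le T hk a

/-- Banach's fixed point theorem on bounded continuous functions. The unbounded quadratic cost is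
harmless because the transmission branch caps the minimum. -/
lemma exists_discounted_value {θ α : ℝ} (hθ : 0 ≤ θ) (h0 : 0 ≤ α) (h1 : α < 1) :
    ∃ (v : 𝔼 → ℝ) (b : ℝ), Continuous v ∧ (∀ e, |v e| ≤ b) ∧
      ∀ e, v e = min (‖H e‖ ^ 2 + α * gaussAvg T v (A e)) (θ + α * gaussAvg T v 0) := by
  let F : BoundedContinuousFunction 𝔼 ℝ → BoundedContinuousFunction 𝔼 ℝ := fun v =>
    BoundedContinuousFunction.ofNormedAddCommGroup
      (fun e => min (‖H e‖ ^ 2 + α * gaussAvg T v (A e)) (θ + α * gaussAvg T v 0))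
      (by
        have := continuous_gaussAvg T v.continuous v.norm_coe_le_norm
        fun_prop)
      (θ + ‖v‖) (by
        intro e
        have h2 : ∀ a, |α * gaussAvg T v a| ≤ ‖v‖ := fun a => by
          rw [abs_mul, abs_of_nonneg h0]
          exact (mul_le_of_le_one_left (abs_nonneg _) h1.le).trans
            (abs_gaussAvg_le T v.norm_coe_le_norm a)
        have h3 := abs_le.1 (h2 (A e))
        have h4 := abs_le.1 (h2 0)
        have h5 : 0 ≤ ‖H e‖ ^ 2 := by positivity
        rw [Real.norm_eq_abs, abs_le]
        exact ⟨le_min (by linarith) (by linarith), (min_le_right _ _).trans (by linarith)⟩)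
  have hF : ContractingWith ⟨α, h0⟩ F := by
    refine ⟨by exact_mod_cast h1, LipschitzWith.of_dist_le_mul fun v v' => ?_⟩
    refine (BoundedContinuousFunction.dist_le (by positivity)).2 fun e => ?_
    have h2 : ∀ a, |α * gaussAvg T v a - α * gaussAvg T v' a| ≤ α * dist v v' := fun a => by
      rw [← mul_sub, abs_mul, abs_of_nonneg h0, ← gaussAvg_sub T v.continuous v'.continuous
        v.norm_coe_le_norm v'.norm_coe_le_norm]
      gcongr
      exact abs_gaussAvg_le T (fun e => by rw [← Real.dist_eq]; exact v.dist_coe_le_dist e) a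
    rw [Real.dist_eq]
    change _ ≤ α * dist v v'
    refine (abs_min_sub_min_le_max _ _ _ _).trans (max_le ?_ ?_)
    · rw [add_sub_add_left_eq_sub]
      exact h2 (A e)
    · rw [add_sub_add_left_eq_sub]
      exact h2 0
  obtain ⟨v, hv⟩ : ∃ v, F v = v := ⟨_, hF.fixedPoint_isFixedPt⟩
  exact ⟨v, ‖v‖, v.continuous, v.norm_coe_le_norm, fun e => (DFunLike.congr_fun hv e).symm⟩

lemma le_of_forall_pow_mul_le {α x y b : ℝ} (h0 : 0 ≤ α) (h1 : α < 1)
    (h : ∀ k : ℕ, x ≤ y + α ^ k * b) : x ≤ y := by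
  have := ((tendsto_pow_atTop_nhds_zero_of_lt_one h0 h1).mul_const b).const_add y
  simp only [zero_mul, add_zero] at this
  exact ge_of_tendsto' this h

/-! ### Sign and invariance of the discounted value. -/

section Discounted

variable {A H T} {θ α b : ℝ} {v : EuclideanSpace ℝ (Fin n) → ℝ}

/-- Each use of the fixed-point equation improves the lower bound -b by a factor α. -/
lemma discounted_value_nonneg (hθ : 0 ≤ θ) (h0 : 0 ≤ α) (h1 : α < 1) (hv : Continuous v)
    (hb : ∀ e, |v e| ≤ b)
    (h : ∀ e, v e = min (‖H e‖ ^ 2 + α * gaussAvg T v (A e)) (θ + α * gaussAvg T v 0)) (e : 𝔼) :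
    0 ≤ v e := by
  have hb0 : 0 ≤ b := (abs_nonneg _).trans (hb 0)
  have key : ∀ k : ℕ, ∀ e, -(α ^ k * b) ≤ v e := by
    intro k
    induction k with
    | zero => intro e; simpa using (abs_le.1 (hb e)).1
    | succ k ih =>
      intro e
      have h2 : ∀ a, -(α ^ (k + 1) * b) ≤ α * gaussAvg T v a := fun a => by
        have := mul_le_mul_of_nonneg_left (le_gaussAvg T hv hb ih a) h0
        rw [pow_succ]
        linarith
      rw [h e]
      have h5 : 0 ≤ ‖H e‖ ^ 2 := by positivity
      exact le_min (by linarith [h2 (A e)]) (by linarith [h2 0])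
  exact le_of_forall_pow_mul_le (b := b) h0 h1 fun k => by linarith [key k e]

/-- An unobservable shift k changes no stage cost and becomes A k, again unobservable. The
discrepancy is therefore multiplied by α at every step. -/
lemma discounted_value_add (h0 : 0 ≤ α) (h1 : α < 1) (hv : Continuous v)
    (hb : ∀ e, |v e| ≤ b)
    (h : ∀ e, v e = min (‖H e‖ ^ 2 + α * gaussAvg T v (A e)) (θ + α * gaussAvg T v 0)) (e : 𝔼)
    {k : 𝔼} (hk : k ∈ unobservable A H) : v (e + k) = v e := by
  have key : ∀ i : ℕ, ∀ e, ∀ k ∈ unobservable A H, |v (e + k) - v e| ≤ α ^ i * (2 * b) := by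
    intro i
    induction i with
    | zero =>
      intro e k _
      have h2 := abs_sub (v (e + k)) (v e)
      rw [pow_zero, one_mul]
      linarith [hb e, hb (e + k)]
    | succ i ih =>
      intro e k hk
      have hHk : H k = 0 := (mem_unobservable A H).1 hk 0
      rw [h (e + k), h e, map_add, map_add, hHk, add_zero]
      refine (abs_min_sub_min_le_max _ _ _ _).trans (max_le ?_ ?_)
      · rw [add_sub_add_left_eq_sub, ← mul_sub, abs_mul, abs_of_nonneg h0, pow_succ]
        have := abs_gaussAvg_add_sub_le T hv hb
          (fun e => ih e (A k) (map_mem_unobservable A H hk)) (A e)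
        calc _ ≤ α * (α ^ i * (2 * b)) := by gcongr
          _ = _ := by ring
      · have : 0 ≤ b := (abs_nonneg _).trans (hb 0)
        rw [sub_self, abs_zero]
        positivity
  have h3 : |v (e + k) - v e| ≤ 0 := le_of_forall_pow_mul_le h0 h1 fun i => by
    rw [zero_add]
    exact key i e k hk
  exact sub_eq_zero.1 (abs_nonpos_iff.1 h3)

end Discounted

/-- With m = E v(ξ), the function f = v - (θ + α m) measures the value against transmitting now.
Transmission becomes stopping at reward 0, and s = (1 - α) m is the discounted approximation of the
average cost. It lies between 0 and θ because v ≥ 0 and f ≤ 0. -/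
lemma exists_discounted_stopping_value {θ α : ℝ} (hθ : 0 ≤ θ) (h0 : 0 ≤ α) (h1 : α < 1) :
    ∃ (f : 𝔼 → ℝ) (b s : ℝ), Continuous f ∧ (∀ e, |f e| ≤ b) ∧ (∀ e, f e ≤ 0) ∧
      (∀ e, ∀ k ∈ unobservable A H, f (e + k) = f e) ∧ s ∈ Set.Icc 0 θ ∧
      gaussAvg T f 0 = s - θ ∧
      ∀ e, f e = min (‖H e‖ ^ 2 - ((1 - α) * θ + α * s) + α * gaussAvg T f (A e)) 0 := by
  obtain ⟨v, b, hv, hb, h⟩ := exists_discounted_value A H T hθ h0 h1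
  obtain ⟨m, hm⟩ : ∃ m, m = gaussAvg T v 0 := ⟨_, rfl⟩
  rw [← hm] at h
  have hf : Continuous fun e => v e - (θ + α * m) := by fun_prop
  have hfb : ∀ e, |v e - (θ + α * m)| ≤ b + |θ + α * m| := fun e => by
    refine (abs_sub _ _).trans ?_
    gcongr
    exact hb e
  have hf0 : ∀ e, v e - (θ + α * m) ≤ 0 := fun e => by
    rw [sub_nonpos, h e]
    exact min_le_right _ _
  have hE : gaussAvg T (fun e => v e - (θ + α * m)) 0 = (1 - α) * m - θ := by
    rw [gaussAvg_sub_const T hv hb, ← hm]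
    ring
  refine ⟨fun e => v e - (θ + α * m), b + |θ + α * m|, (1 - α) * m, hf, hfb, hf0, ?_,
    ⟨?_, ?_⟩, hE, ?_⟩
  · intro e k hk
    simp only
    rw [hm] at h
    rw [discounted_value_add h0 h1 hv hb h e hk]
  · have : 0 ≤ m := by
      rw [hm] at h ⊢
      exact le_gaussAvg T hv hb (discounted_value_nonneg hθ h0 h1 hv hb h) 0
    exact mul_nonneg (by linarith) this
  · have := gaussAvg_le_const T hf hfb hf0 0
    linarith
  · intro e
    simp only
    rw [gaussAvg_sub_const T hv hb, h e, ← min_sub_sub_right]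
    congr 1
    · ring
    · ring

/-- With M the supremum of -f, the maximum principle reduces M to the values of -f on a ball. There
the shift estimate bounds -f by a constant plus M / 2, since the mean of -f at the origin is θ - s ≤
θ. The resulting inequality for M closes uniformly in α. -/
lemma exists_uniform_stopping_bound {θ : ℝ} (hθ : 0 ≤ θ) :
    ∃ C, 0 ≤ C ∧ ∀ (f : 𝔼 → ℝ) (b α s : ℝ), 0 ≤ α → α < 1 → Continuous f → (∀ e, |f e| ≤ b) →
      (∀ e, f e ≤ 0) → (∀ e, ∀ k ∈ unobservable A H, f (e + k) = f e) → s ∈ Set.Icc 0 θ →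
      gaussAvg T f 0 = s - θ →
      (∀ e, f e = min (‖H e‖ ^ 2 - ((1 - α) * θ + α * s) + α * gaussAvg T f (A e)) 0) →
      ∀ e, |f e| ≤ C := by
  obtain ⟨R, D, hR, hD, hMP⟩ := stopping_maximum_principle A H T θ
  -- E bounds the second moment of the Cameron-Martin density for every base point A e with ‖e‖ ≤ R.
  -- The cut-off l = 2 E below turns the remainder into M / 2.
  obtain ⟨E, hE⟩ : ∃ E, E = Real.exp ((‖(T.symm : 𝔼 →L[ℝ] 𝔼)‖ * (‖A‖ * R)) ^ 2) := ⟨_, rfl⟩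
  have hE0 : 0 < E := by rw [hE]; exact Real.exp_pos _
  refine ⟨D + 2 * (θ + 2 * E * θ), by positivity, ?_⟩
  intro f b α s h0 h1 hf hb hf0 hinv hs hfs h
  have hbdd : BddAbove (Set.range fun e => -f e) := ⟨b, by
    rintro _ ⟨e, rfl⟩
    exact (neg_le_abs _).trans (hb e)⟩
  obtain ⟨M, hM'⟩ : ∃ M, M = ⨆ e, -f e := ⟨_, rfl⟩
  have hM : ∀ e, -f e ≤ M := fun e => by rw [hM']; exact le_ciSup hbdd e
  have hng : Continuous fun e => -f e := hf.neg
  have hg0 : ∀ e, 0 ≤ -f e := fun e => neg_nonneg.2 (hf0 e)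
  have hbg : ∀ e, |(-f e)| ≤ b := fun e => by rw [abs_neg]; exact hb e
  have hineq : ∀ e, -f e ≤ max (θ - ‖H e‖ ^ 2 + gaussAvg T (fun e => -f e) (A e)) 0 := by
    intro e
    have h2 := le_gaussAvg T hng hbg hg0 (A e)
    rw [h e, ← max_neg_neg, neg_zero]
    refine max_le_max ?_ le_rfl
    have h3 : (1 - α) * θ + α * s ≤ θ := by nlinarith [hs.2]
    have h4 : α * gaussAvg T (fun e => -f e) (A e) ≤ gaussAvg T (fun e => -f e) (A e) :=
      mul_le_of_le_one_left h2 h1.le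
    rw [gaussAvg_neg] at h4 ⊢
    linarith
  have hball : ∀ e, ‖e‖ ≤ R → -f e ≤ θ + 2 * E * θ + M / 2 := by
    intro e he
    have hM0 : 0 ≤ M := (hg0 0).trans (hM 0)
    have h2 := gaussAvg_le T hng hg0 hM (A e) (l := 2 * E) (by positivity)
    have h3 : Real.exp (‖T.symm (A e)‖ ^ 2) ≤ E := by
      rw [hE]
      refine Real.exp_le_exp.2 ?_
      have h4 : ‖T.symm (A e)‖ ≤ ‖(T.symm : 𝔼 →L[ℝ] 𝔼)‖ * (‖A‖ * R) :=
        ((T.symm : 𝔼 →L[ℝ] 𝔼).le_opNorm _).trans (mul_le_mul_of_nonneg_left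
          ((A.le_opNorm e).trans (mul_le_mul_of_nonneg_left he (norm_nonneg _))) (norm_nonneg _))
      gcongr
    have h5 : M * Real.exp (‖T.symm (A e)‖ ^ 2) / (2 * E) ≤ M / 2 := by
      rw [div_le_div_iff₀ (by positivity) (by norm_num)]
      calc M * Real.exp (‖T.symm (A e)‖ ^ 2) * 2 ≤ M * E * 2 := by gcongr
        _ = _ := by ring
    have h6 : gaussAvg T (fun e => -f e) 0 ≤ θ := by
      rw [gaussAvg_neg, hfs]
      linarith [hs.1]
    have h7 : 2 * E * gaussAvg T (fun e => -f e) 0 ≤ 2 * E * θ := by gcongr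
    have h8 : 0 ≤ ‖H e‖ ^ 2 := by positivity
    refine (hineq e).trans (max_le ?_ (by positivity))
    linarith
  have hfin := hMP (fun e => -f e) M hng hg0 hM
    (fun e k hk => by rw [hinv e k hk]) hineq _ hball
  have hM2 : M ≤ max D (θ + 2 * E * θ + M / 2) := by rw [hM']; rw [hM'] at hfin; exact ciSup_le hfin
  intro e
  have h9 : 0 ≤ 2 * (θ + 2 * E * θ) := by positivity
  rw [abs_of_nonpos (hf0 e)]
  refine (hM e).trans ?_
  rcases le_max_iff.1 hM2 with h | h <;> linarith

/-- A modulus of continuity for the solutions of the optimality equations bounded by `C`. -/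
def costModulus (C : ℝ) (x y : EuclideanSpace ℝ (Fin n)) : ℝ :=
  |‖H x‖ ^ 2 - ‖H y‖ ^ 2| + C * Real.sqrt (Real.exp (‖T.symm (A (x - y))‖ ^ 2) - 1)

lemma tendsto_costModulus (C : ℝ) (x : 𝔼) :
    Tendsto (costModulus A H T C x) (𝓝 x) (𝓝 0) := by
  have h : Continuous (costModulus A H T C x) := by
    unfold costModulus
    fun_prop
  simpa [costModulus] using h.tendsto x

/-- The minimum is nonexpansive and the constant c cancels, so the modulus is common to all discount
factors. -/
lemma abs_sub_le_costModulus {f : 𝔼 → ℝ} {C α c : ℝ} (h0 : 0 ≤ α) (h1 : α < 1) (hf : Continuous f)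
    (hC : ∀ e, |f e| ≤ C)
    (h : ∀ e, f e = min (‖H e‖ ^ 2 - c + α * gaussAvg T f (A e)) 0) (x y : 𝔼) :
    |f x - f y| ≤ costModulus A H T C x y := by
  have h2 := abs_gaussAvg_sub_le T hf hC (A x) (A y)
  rw [h x, h y]
  refine (abs_min_sub_min_le_max _ _ _ _).trans (max_le ?_ ?_)
  · have h3 : ‖H x‖ ^ 2 - c + α * gaussAvg T f (A x) - (‖H y‖ ^ 2 - c + α * gaussAvg T f (A y)) =
        (‖H x‖ ^ 2 - ‖H y‖ ^ 2) + α * (gaussAvg T f (A x) - gaussAvg T f (A y)) := by ring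
    rw [h3, costModulus, map_sub]
    refine (abs_add_le _ _).trans (add_le_add le_rfl ?_)
    rw [abs_mul, abs_of_nonneg h0]
    exact (mul_le_of_le_one_left (abs_nonneg _) h1.le).trans h2
  · have : 0 ≤ C := (abs_nonneg _).trans (hC 0)
    rw [sub_self, abs_zero, costModulus]
    positivity

/-- In the pointwise topology the set is closed in a product of compact intervals, the modulus
itself forcing continuity of its members. Equicontinuity then transfers compactness to the
compact-open topology. -/
lemma isCompact_of_modulus (ω : 𝔼 → 𝔼 → ℝ) (hω : ∀ x, Tendsto (ω x) (𝓝 x) (𝓝 0)) (C : ℝ) :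
    IsCompact {F : C(𝔼, ℝ) | (∀ x, F x ∈ Set.Icc (-C) C) ∧ ∀ x y, |F x - F y| ≤ ω x y} := by
  apply ArzelaAscoli.isCompact_of_equicontinuous
  · have h1 : ContinuousMap.toFun '' {F : C(𝔼, ℝ) | (∀ x, F x ∈ Set.Icc (-C) C) ∧
        ∀ x y, |F x - F y| ≤ ω x y} =
        Set.pi Set.univ (fun _ : 𝔼 => Set.Icc (-C) C) ∩ {f | ∀ x y, |f x - f y| ≤ ω x y} := by
      ext f
      constructor
      · rintro ⟨F, hF, rfl⟩
        exact ⟨fun x _ => hF.1 x, hF.2⟩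
      · rintro ⟨hf1, hf2⟩
        have hcont : Continuous f := by
          refine continuous_iff_continuousAt.2 fun x => ?_
          rw [ContinuousAt, tendsto_iff_dist_tendsto_zero]
          refine squeeze_zero (fun _ => dist_nonneg) (fun y => ?_) (hω x)
          rw [dist_comm]
          exact hf2 x y
        exact ⟨⟨f, hcont⟩, ⟨fun x => hf1 x trivial, hf2⟩, rfl⟩
    rw [h1]
    refine (isCompact_univ_pi fun _ => isCompact_Icc).inter_right ?_
    simp only [Set.ofPred_forall]
    exact isClosed_iInter fun x => isClosed_iInter fun y =>
      isClosed_le (by fun_prop) continuous_const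
  · refine fun x => Metric.equicontinuousAt_iff_right.2 fun ε hε => ?_
    filter_upwards [(hω x).eventually (gt_mem_nhds hε)] with y hy F
    exact (F.2.2 x y).trans_lt hy

/-- Vanishing discount: along a subsequence with α → 1 the stopping values and the levels s
converge, and dominated convergence passes to the limit under the Gaussian averages. -/
theorem exists_average_cost_solution {θ : ℝ} (hθ : 0 ≤ θ) :
    ∃ (h : 𝔼 → ℝ) (j b : ℝ), Continuous h ∧ (∀ e, |h e| ≤ b) ∧ h 0 = 0 ∧
      ∀ e, j + h e = min (‖H e‖ ^ 2 + gaussAvg T h (A e)) (θ + gaussAvg T h 0) := by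
  obtain ⟨C, hC0, hC⟩ := exists_uniform_stopping_bound A H T hθ
  let α : ℕ → ℝ := fun k => 1 - 1 / ((k : ℝ) + 1)
  have hα : ∀ k, 0 ≤ α k ∧ α k < 1 := by
    intro k
    have h1 : 1 / ((k : ℝ) + 1) ≤ 1 := by
      rw [div_le_one (by positivity)]
      linarith [Nat.cast_nonneg (α := ℝ) k]
    have h2 : 0 < 1 / ((k : ℝ) + 1) := by positivity
    exact ⟨by simp only [α]; linarith, by simp only [α]; linarith⟩
  have hαlim : Tendsto α atTop (𝓝 1) := by
    simpa [α] using (tendsto_one_div_add_atTop_nhds_zero_nat (𝕜 := ℝ)).const_sub 1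
  choose f b s hf hb hf0 hinv hs hfs h using
    fun k => exists_discounted_stopping_value A H T hθ (hα k).1 (hα k).2
  have hfC : ∀ k e, |f k e| ≤ C := fun k => hC (f k) (b k) (α k) (s k) (hα k).1 (hα k).2 (hf k)
    (hb k) (hf0 k) (hinv k) (hs k) (hfs k) (h k)
  obtain ⟨⟨F, σ⟩, hFσ, φ, hφ, hlim⟩ :=
    ((isCompact_of_modulus (costModulus A H T C) (tendsto_costModulus A H T C) C).prod
      (isCompact_Icc (a := 0) (b := θ))).tendsto_subseq
      (x := fun k => ((⟨f k, hf k⟩ : C(𝔼, ℝ)), s k)) fun k =>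
        ⟨⟨fun x => abs_le.1 (hfC k x), abs_sub_le_costModulus A H T (hα k).1 (hα k).2 (hf k)
          (hfC k) (h k)⟩, hs k⟩
  have hF : Tendsto (fun k => (⟨f (φ k), hf (φ k)⟩ : C(𝔼, ℝ))) atTop (𝓝 F) :=
    (continuous_fst.tendsto _).comp hlim
  have hσ : Tendsto (fun k => s (φ k)) atTop (𝓝 σ) := (continuous_snd.tendsto _).comp hlim
  have hFe : ∀ e, Tendsto (fun k => f (φ k) e) atTop (𝓝 (F e)) := fun e =>
    ((continuous_eval_const e).tendsto F).comp hF
  have hFC : ∀ e, |F e| ≤ C := fun e => abs_le.2 (hFσ.1.1 e)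
  have hFavg : ∀ a, Tendsto (fun k => gaussAvg T (f (φ k)) a) atTop (𝓝 (gaussAvg T F a)) :=
    fun a => tendsto_integral_of_dominated_convergence (fun _ => C)
      (fun k => (integrable_gaussAvg T (hf (φ k)) (hfC (φ k)) a).1) (integrable_const _)
      (fun k => .of_forall fun z => hfC _ _) (.of_forall fun z => hFe _)
  have hαφ : Tendsto (fun k => α (φ k)) atTop (𝓝 1) := hαlim.comp hφ.tendsto_atTop
  have hF0 : gaussAvg T F 0 = σ - θ := by
    refine tendsto_nhds_unique (hFavg 0) ?_
    simp_rw [hfs]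
    exact hσ.sub_const θ
  have hFeq : ∀ e, F e = min (‖H e‖ ^ 2 - σ + gaussAvg T F (A e)) 0 := by
    intro e
    refine tendsto_nhds_unique (hFe e) ?_
    simp_rw [h]
    refine Tendsto.min ?_ tendsto_const_nhds
    have h1 := (((hαφ.const_sub 1).mul_const θ).add (hαφ.mul hσ)).const_sub (‖H e‖ ^ 2)
    have h2 := h1.add (hαφ.mul (hFavg (A e)))
    simpa using h2
  -- The limit satisfies F = min(‖H e‖² - σ + E F(A e + ξ), 0) with E F(ξ) = σ - θ. Adding σ - F 0
  -- gives the Bellman equation at level j = σ.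
  refine ⟨fun e => F e - F 0, σ, C + |F 0|, by fun_prop, fun e => ?_, by simp, fun e => ?_⟩
  · refine (abs_sub _ _).trans ?_
    gcongr
    exact hFC e
  · simp only
    rw [gaussAvg_sub_const T F.continuous hFC, gaussAvg_sub_const T F.continuous hFC, hF0,
      hFeq e, ← add_sub_assoc, ← min_add_add_left, ← min_sub_sub_right]
    congr 1 <;> ring

end AverageCost

/-! ### Regularity and symmetry of the solutions of the optimality equation -/

section AverageCostRegularity

variable {n : ℕ}

local notation "𝔼" => EuclideanSpace ℝ (Fin n)

/-- `h` is a bounded continuous solution of the average-cost optimality equation. -/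
structure SolvesAverageCost (A H : EuclideanSpace ℝ (Fin n) →L[ℝ] EuclideanSpace ℝ (Fin n))
    (T : EuclideanSpace ℝ (Fin n) ≃L[ℝ] EuclideanSpace ℝ (Fin n)) (θ j b : ℝ)
    (h : EuclideanSpace ℝ (Fin n) → ℝ) : Prop where
  continuous : Continuous h
  bounded : ∀ e, |h e| ≤ b
  eqn : ∀ e, j + h e = min (‖H e‖ ^ 2 + gaussAvg T h (A e)) (θ + gaussAvg T h 0)

variable {A H : EuclideanSpace ℝ (Fin n) →L[ℝ] EuclideanSpace ℝ (Fin n)}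
  {T : EuclideanSpace ℝ (Fin n) ≃L[ℝ] EuclideanSpace ℝ (Fin n)} {θ j b : ℝ}
  {h : EuclideanSpace ℝ (Fin n) → ℝ}

lemma uniformContinuous_of_modulus {f : 𝔼 → ℝ} {ω : 𝔼 → ℝ} (hω : Tendsto ω (𝓝 0) (𝓝 0))
    (hf : ∀ x y, |f x - f y| ≤ ω (x - y)) : UniformContinuous f := by
  rw [Metric.uniformContinuous_iff]
  intro ε hε
  obtain ⟨δ, hδ, hd⟩ := Metric.eventually_nhds_iff.1 (hω.eventually (gt_mem_nhds hε))
  refine ⟨δ, hδ, fun x y hxy => (hf x y).trans_lt (hd ?_)⟩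
  rwa [dist_zero_right, ← dist_eq_norm]

/-- A square is not uniformly continuous, but a square truncated at r² is Lipschitz. -/
lemma abs_min_sq_sub_min_sq_le {x y r : ℝ} (hx : 0 ≤ x) (hy : 0 ≤ y) (hr : 0 ≤ r) :
    |min (x ^ 2) (r ^ 2) - min (y ^ 2) (r ^ 2)| ≤ 2 * r * |x - y| := by
  have key : ∀ x : ℝ, 0 ≤ x → min (x ^ 2) (r ^ 2) = min x r ^ 2 := by
    intro x hx
    rcases le_total x r with h | h
    · rw [min_eq_left h, min_eq_left (by gcongr)]
    · rw [min_eq_right h, min_eq_right (by gcongr)]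
  rw [key x hx, key y hy, sq_sub_sq, abs_mul]
  have h1 : |min x r - min y r| ≤ |x - y| := by
    simpa using abs_min_sub_min_le_max x r y r
  have h2 : |min x r + min y r| ≤ 2 * r := by
    rw [abs_of_nonneg (add_nonneg (le_min hx hr) (le_min hy hr))]
    linarith [min_le_right x r, min_le_right y r]
  gcongr

namespace SolvesAverageCost

/-- A translation-invariant modulus of continuity of a solution. -/
def modulus (A H : EuclideanSpace ℝ (Fin n) →L[ℝ] EuclideanSpace ℝ (Fin n))
    (T : EuclideanSpace ℝ (Fin n) ≃L[ℝ] EuclideanSpace ℝ (Fin n)) (θ b : ℝ)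
    (h : EuclideanSpace ℝ (Fin n) → ℝ) (x : EuclideanSpace ℝ (Fin n)) : ℝ :=
  2 * Real.sqrt (θ + gaussAvg T h 0 + b) * ‖H x‖
    + b * Real.sqrt (Real.exp (‖T.symm (A x)‖ ^ 2) - 1)

lemma tendsto_modulus : Tendsto (modulus A H T θ b h) (𝓝 0) (𝓝 0) := by
  have h : Continuous (modulus A H T θ b h) := by
    unfold modulus
    fun_prop
  simpa [modulus] using h.tendsto 0

variable (hs : SolvesAverageCost A H T θ j b h)

include hs

lemma level_nonneg (hθ : 0 ≤ θ) : 0 ≤ θ + gaussAvg T h 0 + b := by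
  linarith [(abs_le.1 (abs_gaussAvg_le T hs.bounded 0)).1]

lemma eq_of_level_le {e : 𝔼} (he : θ + gaussAvg T h 0 + b ≤ ‖H e‖ ^ 2) :
    j + h e = θ + gaussAvg T h 0 := by
  rw [hs.eqn, min_eq_right]
  linarith [(abs_le.1 (abs_gaussAvg_le T hs.bounded (A e))).1]

/-- Once ‖H e‖² exceeds a fixed level, transmission attains the minimum, so the quadratic cost can
be truncated there without changing the equation. This makes the modulus a function of x - y only.
-/
lemma abs_sub_le_modulus (hθ : 0 ≤ θ) (x y : 𝔼) :
    |h x - h y| ≤ modulus A H T θ b h (x - y) := by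
  obtain ⟨c, hc⟩ : ∃ c, c = θ + gaussAvg T h 0 := ⟨_, rfl⟩
  have hc0 : 0 ≤ c + b := by rw [hc]; exact hs.level_nonneg hθ
  -- Truncating at c + b is harmless because c + b + E h(A e + ξ) ≥ c, the value of the other
  -- branch.
  have h1 : ∀ e, j + h e =
      min (min (‖H e‖ ^ 2) (Real.sqrt (c + b) ^ 2) + gaussAvg T h (A e)) c := by
    intro e
    have h2 := (abs_le.1 (abs_gaussAvg_le T hs.bounded (A e))).1
    rw [hs.eqn, ← hc, Real.sq_sqrt hc0, ← min_add_add_right, min_assoc,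
      min_eq_right (by linarith : c ≤ c + b + gaussAvg T h (A e))]
  have h3 : h x - h y = (j + h x) - (j + h y) := by ring
  have h4 := abs_min_sq_sub_min_sq_le (norm_nonneg (H x)) (norm_nonneg (H y))
    (Real.sqrt_nonneg (c + b))
  have h5 := abs_gaussAvg_sub_le T hs.continuous hs.bounded (A x) (A y)
  have h6 : |‖H x‖ - ‖H y‖| ≤ ‖H (x - y)‖ := by
    rw [map_sub]
    exact abs_norm_sub_norm_le _ _
  have h7 : 2 * Real.sqrt (c + b) * |‖H x‖ - ‖H y‖| ≤ 2 * Real.sqrt (c + b) * ‖H (x - y)‖ := by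
    gcongr
  rw [h3, h1, h1, modulus, ← hc, map_sub A]
  refine (abs_min_sub_min_le_max _ _ _ _).trans (max_le ?_ ?_)
  · rw [add_sub_add_comm]
    exact (abs_add_le _ _).trans (add_le_add (h4.trans h7) h5)
  · have : 0 ≤ b := (abs_nonneg _).trans (hs.bounded 0)
    rw [sub_self, abs_zero]
    positivity

lemma uniformContinuous (hθ : 0 ≤ θ) : UniformContinuous h :=
  uniformContinuous_of_modulus tendsto_modulus (hs.abs_sub_le_modulus hθ)

/-- Without a discount factor, iteration only says that the effect of a shift k is at most the
modulus at A^i k. Decay of unobservable trajectories replaces the factor α^i. -/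
lemma add_unobservable (hθ : 0 ≤ θ)
    (hK : ∀ k ∈ unobservable A H, Tendsto (fun i => (A ^ i) k) atTop (𝓝 0)) (e : 𝔼) {k : 𝔼}
    (hk : k ∈ unobservable A H) : h (e + k) = h e := by
  have key : ∀ i : ℕ, ∀ e, ∀ k ∈ unobservable A H,
      |h (e + k) - h e| ≤ modulus A H T θ b h ((A ^ i) k) := by
    intro i
    induction i with
    | zero =>
      intro e k _
      simpa using hs.abs_sub_le_modulus hθ (e + k) e
    | succ i ih =>
      intro e k hk
      have hHk : H k = 0 := (mem_unobservable A H).1 hk 0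
      have h1 := abs_gaussAvg_add_sub_le T hs.continuous hs.bounded
          (fun e => ih e (A k) (map_mem_unobservable A H hk)) (A e)
      have h2 : h (e + k) - h e = (j + h (e + k)) - (j + h e) := by ring
      rw [h2, hs.eqn, hs.eqn, map_add, map_add, hHk, add_zero]
      refine (abs_min_sub_min_le_max _ _ _ _).trans (max_le ?_ ?_)
      · rw [add_sub_add_left_eq_sub, pow_succ]
        exact h1
      · rw [sub_self, abs_zero]
        exact (abs_nonneg _).trans h1
  have h3 : Tendsto (fun i => modulus A H T θ b h ((A ^ i) k)) atTop (𝓝 0) :=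
    tendsto_modulus.comp (hK k hk)
  have h4 := ge_of_tendsto' h3 fun i => key i e k hk
  exact sub_eq_zero.1 (abs_nonpos_iff.1 h4)

/-- At e and -e the quadratic costs agree and the transmission branches coincide, so only the
difference of the averages survives. -/
lemma abs_sub_neg_le (e : 𝔼) :
    |h e - h (-e)| ≤ |gaussAvg T (fun e => h e - h (-e)) (A e)| := by
  have h2 : h e - h (-e) = (j + h e) - (j + h (-e)) := by ring
  have hc : Continuous fun e => h (-e) := hs.continuous.comp continuous_neg
  rw [h2, hs.eqn, hs.eqn, map_neg, map_neg, norm_neg,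
    gaussAvg_sub T hs.continuous hc hs.bounded (fun _ => hs.bounded _), gaussAvg_comp_neg]
  refine (abs_min_sub_min_le_max _ _ _ _).trans (max_le ?_ ?_)
  · rw [add_sub_add_left_eq_sub]
  · rw [sub_self, abs_zero]
    exact abs_nonneg _

/-- The function |D| is a subsolution to which the maximum principle applies at every scale s > 0,
because D vanishes where ‖H e‖² ≥ J. On the ball, oddness gives |D| ≤ ρ sup |D| with ρ < 1. The
additive constant D₀ becomes D₀ / s, negligible for large s. -/
theorem even (hθ : 0 ≤ θ)
    (hK : ∀ k ∈ unobservable A H, Tendsto (fun i => (A ^ i) k) atTop (𝓝 0)) (e : 𝔼) :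
    h (-e) = h e := by
  obtain ⟨D, hD⟩ : ∃ D : 𝔼 → ℝ, D = fun e => h e - h (-e) := ⟨_, rfl⟩
  have hDc : Continuous D := by
    rw [hD]
    exact hs.continuous.sub (hs.continuous.comp continuous_neg)
  have hDb : ∀ e, |D e| ≤ 2 * b := fun e => by
    rw [hD]
    have := abs_sub (h e) (h (-e))
    linarith [hs.bounded e, hs.bounded (-e)]
  have hDodd : ∀ e, D (-e) = -D e := fun e => by simp [hD]
  have hDavg : ∀ e, |D e| ≤ |gaussAvg T D (A e)| := by
    rw [hD]
    exact hs.abs_sub_neg_le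
  obtain ⟨J, hJ⟩ : ∃ J, J = θ + gaussAvg T h 0 + b := ⟨_, rfl⟩
  have hD0 : ∀ e, J ≤ ‖H e‖ ^ 2 → D e = 0 := by
    intro e he
    have h1 := hs.eq_of_level_le (hJ ▸ he)
    have h2 := hs.eq_of_level_le (e := -e) (by rw [map_neg, norm_neg]; exact hJ ▸ he)
    rw [hD]
    simp only
    linarith
  obtain ⟨R, D₀, hR, hD₀, hMP⟩ := stopping_maximum_principle A H T J
  obtain ⟨ρ, hρ, hodd⟩ := abs_gaussAvg_le_of_odd T (r := ‖A‖ * R) (by positivity)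
  have hbdd : BddAbove (Set.range fun e => |D e|) := ⟨2 * b, by rintro _ ⟨e, rfl⟩; exact hDb e⟩
  obtain ⟨d, hd'⟩ : ∃ d, d = ⨆ e, |D e| := ⟨_, rfl⟩
  have hd : ∀ e, |D e| ≤ d := fun e => by rw [hd']; exact le_ciSup hbdd e
  have hle : ∀ s : ℝ, 0 < s → ∀ e, s * |D e| ≤ max D₀ (s * (ρ * d)) := by
    intro s hs0
    refine hMP (fun e => s * |D e|) (s * d) (by fun_prop) (fun e => by positivity)
      (fun e => by gcongr; exact hd e) ?_ ?_ _ ?_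
    · intro e k hk
      have h1 : D (e + k) = D e := by
        simp only [hD]
        rw [neg_add, hs.add_unobservable hθ hK e hk,
          hs.add_unobservable hθ hK (-e) (neg_mem hk)]
      rw [h1]
    · intro e
      rcases le_total J (‖H e‖ ^ 2) with h | h
      · rw [hD0 e h]
        simp
      · refine le_max_of_le_left ?_
        have h1 : |gaussAvg T D (A e)| ≤ gaussAvg T (fun e => |D e|) (A e) :=
          abs_integral_le_integral_abs
        rw [gaussAvg_const_mul]
        have h2 : s * |D e| ≤ s * gaussAvg T (fun e => |D e|) (A e) :=
          mul_le_mul_of_nonneg_left ((hDavg e).trans h1) hs0.le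
        linarith
    · intro e he
      refine mul_le_mul_of_nonneg_left ((hDavg e).trans ?_) hs0.le
      exact hodd D hDc d hd hDodd _
        ((A.le_opNorm e).trans (mul_le_mul_of_nonneg_left he (norm_nonneg _)))
  have hd0 : d ≤ 0 := by
    by_contra! hpos
    -- This scale makes D₀ / s at most d / 2, so that d ≤ max(d / 2, ρ d), impossible for d > 0.
    have hs0 : 0 < 2 * D₀ / d + 1 := by positivity
    have h1 : ∀ e, |D e| ≤ max (d / 2) (ρ * d) := by
      intro e
      rcases le_max_iff.1 (hle _ hs0 e) with h | h
      · refine le_max_of_le_left ?_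
        have h2 : D₀ ≤ (2 * D₀ / d + 1) * (d / 2) := by
          have : (2 * D₀ / d + 1) * (d / 2) = D₀ + d / 2 := by field_simp
          linarith
        exact le_of_mul_le_mul_left (h.trans h2) hs0
      · exact le_max_of_le_right (le_of_mul_le_mul_left h hs0)
    have h2 : d ≤ max (d / 2) (ρ * d) := by
      rw [hd'] at h1 ⊢
      exact ciSup_le h1
    rcases le_max_iff.1 h2 with h | h
    · linarith
    · nlinarith
  have h1 := (hd e).trans hd0
  have h2 := abs_nonpos_iff.1 h1
  rw [hD] at h2
  simp only at h2
  linarith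

/-- At zero mismatch silence costs nothing and leads to the same law as transmission, so it attains
the minimum. -/
lemma level_eq (hθ : 0 ≤ θ) (h0 : h 0 = 0) : j = gaussAvg T h 0 := by
  have := hs.eqn 0
  rw [h0, map_zero, map_zero, norm_zero] at this
  rw [min_eq_left (by linarith)] at this
  linarith

end SolvesAverageCost

end AverageCostRegularity

/-! ### Linear maps of Euclidean spaces given by matrices -/

section EuclideanLin

variable {n m q : ℕ}

lemma continuous_toEuclideanLin (M : Matrix (Fin m) (Fin n) ℝ) :
    Continuous (Matrix.toEuclideanLin M) :=
  LinearMap.continuous_of_finiteDimensional _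

lemma measurable_toEuclideanLin (M : Matrix (Fin m) (Fin n) ℝ) :
    Measurable (Matrix.toEuclideanLin M) :=
  (continuous_toEuclideanLin M).measurable

lemma toEuclideanLin_mul (M : Matrix (Fin m) (Fin n) ℝ) (N : Matrix (Fin n) (Fin q) ℝ)
    (x : EuclideanSpace ℝ (Fin q)) :
    Matrix.toEuclideanLin (M * N) x = Matrix.toEuclideanLin M (Matrix.toEuclideanLin N x) := by
  simp [Matrix.toLpLin_apply, Matrix.mulVec_mulVec]

lemma toEuclideanLin_add (M N : Matrix (Fin m) (Fin n) ℝ) (x : EuclideanSpace ℝ (Fin n)) :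
    Matrix.toEuclideanLin (M + N) x = Matrix.toEuclideanLin M x + Matrix.toEuclideanLin N x := by
  rw [map_add, LinearMap.add_apply]

lemma toEuclideanLin_sub (M N : Matrix (Fin m) (Fin n) ℝ) (x : EuclideanSpace ℝ (Fin n)) :
    Matrix.toEuclideanLin (M - N) x = Matrix.toEuclideanLin M x - Matrix.toEuclideanLin N x := by
  rw [map_sub, LinearMap.sub_apply]

lemma toEuclideanLin_neg (M : Matrix (Fin m) (Fin n) ℝ) (x : EuclideanSpace ℝ (Fin n)) :
    Matrix.toEuclideanLin (-M) x = -Matrix.toEuclideanLin M x := by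
  rw [map_neg, LinearMap.neg_apply]

lemma toEuclideanLin_one (x : EuclideanSpace ℝ (Fin n)) :
    Matrix.toEuclideanLin (1 : Matrix (Fin n) (Fin n) ℝ) x = x := by
  simp

lemma inner_toEuclideanLin_left (M : Matrix (Fin m) (Fin n) ℝ) (x : EuclideanSpace ℝ (Fin n))
    (y : EuclideanSpace ℝ (Fin m)) :
    ⟪Matrix.toEuclideanLin M x, y⟫ = ⟪x, Matrix.toEuclideanLin Mᵀ y⟫ := by
  simp only [EuclideanSpace.inner_eq_star_dotProduct, Matrix.toLpLin_apply,
    star_trivial]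
  rw [Matrix.mulVec_transpose, Matrix.dotProduct_mulVec]

lemma inner_toEuclideanLin_right (M : Matrix (Fin m) (Fin n) ℝ) (x : EuclideanSpace ℝ (Fin n))
    (y : EuclideanSpace ℝ (Fin m)) :
    ⟪y, Matrix.toEuclideanLin M x⟫ = ⟪Matrix.toEuclideanLin Mᵀ y, x⟫ := by
  rw [real_inner_comm, inner_toEuclideanLin_left, real_inner_comm]

lemma quadForm_eq_inner (M : Matrix (Fin n) (Fin n) ℝ) (x : EuclideanSpace ℝ (Fin n)) :
    quadForm M x = ⟪x, Matrix.toEuclideanLin M x⟫ := by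
  rw [quadForm, EuclideanSpace.inner_eq_star_dotProduct, Matrix.toLpLin_apply,
    star_trivial, dotProduct_comm]

lemma quadForm_toEuclideanLin (M : Matrix (Fin m) (Fin m) ℝ) (F : Matrix (Fin m) (Fin n) ℝ)
    (x : EuclideanSpace ℝ (Fin n)) :
    quadForm M (Matrix.toEuclideanLin F x) = quadForm (Fᵀ * M * F) x := by
  rw [quadForm_eq_inner, quadForm_eq_inner, inner_toEuclideanLin_left, ← toEuclideanLin_mul,
    ← toEuclideanLin_mul, Matrix.mul_assoc]

lemma continuous_quadForm (M : Matrix (Fin n) (Fin n) ℝ) : Continuous (quadForm M) := by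
  have h : quadForm M = fun x => ⟪x, Matrix.toEuclideanLin M x⟫ := funext (quadForm_eq_inner M)
  rw [h]
  exact continuous_id.inner (continuous_toEuclideanLin M)

lemma abs_quadForm_le (M : Matrix (Fin n) (Fin n) ℝ) :
    ∃ c, 0 ≤ c ∧ ∀ x, |quadForm M x| ≤ c * ‖x‖ ^ 2 := by
  refine ⟨‖(Matrix.toEuclideanLin M).toContinuousLinearMap‖, norm_nonneg _, fun x => ?_⟩
  rw [quadForm_eq_inner]
  refine (abs_real_inner_le_norm _ _).trans ?_
  have := (Matrix.toEuclideanLin M).toContinuousLinearMap.le_opNorm x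
  calc _ ≤ ‖x‖ * (‖(Matrix.toEuclideanLin M).toContinuousLinearMap‖ * ‖x‖) := by
        gcongr; exact this
    _ = _ := by ring

lemma quadForm_nonneg {M : Matrix (Fin n) (Fin n) ℝ} (hM : M.PosSemidef)
    (x : EuclideanSpace ℝ (Fin n)) : 0 ≤ quadForm M x := by
  simpa [quadForm] using hM.dotProduct_mulVec_nonneg x.ofLp

lemma quadForm_neg (M : Matrix (Fin n) (Fin n) ℝ) (x : EuclideanSpace ℝ (Fin n)) :
    quadForm M (-x) = quadForm M x := by
  rw [quadForm_eq_inner, quadForm_eq_inner, map_neg, inner_neg_neg]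

end EuclideanLin

/-! ### Linear images of independent Gaussian vectors -/

section GaussianLinear

variable {Ω : Type*} [MeasurableSpace Ω] {μ : Measure Ω}
variable {n q r l : ℕ} {X : Ω → EuclideanSpace ℝ (Fin n)} {Y : Ω → EuclideanSpace ℝ (Fin q)}
  {P : Matrix (Fin n) (Fin n) ℝ} {V : Matrix (Fin q) (Fin q) ℝ}

lemma charFun_multivariateGaussian_zero (hP : P.PosSemidef) (x : EuclideanSpace ℝ (Fin n)) :
    charFun (multivariateGaussian 0 P) x = Complex.exp (-(quadForm P x : ℂ) / 2) := by
  rw [charFun_multivariateGaussian hP, quadForm]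
  simp [neg_div]

lemma integral_cexp_of_gaussian (hX : Measurable X) (hY : Measurable Y) (hP : P.PosSemidef)
    (hV : V.PosSemidef) (hXl : μ.map X = multivariateGaussian 0 P)
    (hYl : μ.map Y = multivariateGaussian 0 V) (hXY : IndepFun X Y μ)
    (s : EuclideanSpace ℝ (Fin n)) (t : EuclideanSpace ℝ (Fin q)) :
    ∫ ω, Complex.exp ((⟪X ω, s⟫ + ⟪Y ω, t⟫ : ℝ) * Complex.I) ∂μ =
      Complex.exp (-(quadForm P s + quadForm V t : ℝ) / 2) := by
  have h1 : ∀ ω, Complex.exp ((⟪X ω, s⟫ + ⟪Y ω, t⟫ : ℝ) * Complex.I) =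
      Complex.exp (⟪X ω, s⟫ * Complex.I) * Complex.exp (⟪Y ω, t⟫ * Complex.I) := fun ω => by
    rw [← Complex.exp_add]
    push_cast
    ring_nf
  have hcX : Measurable fun x : EuclideanSpace ℝ (Fin n) => Complex.exp (⟪x, s⟫ * Complex.I) := by
    fun_prop
  have hcY : Measurable fun x : EuclideanSpace ℝ (Fin q) => Complex.exp (⟪x, t⟫ * Complex.I) := by
    fun_prop
  simp_rw [h1]
  have h2 := (hXY.comp hcX hcY).integral_fun_mul_eq_mul_integral
    (hcX.comp hX).aestronglyMeasurable (hcY.comp hY).aestronglyMeasurable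
  simp only [Function.comp_def] at h2
  have hsX := charFun_multivariateGaussian_zero hP s
  have hsY := charFun_multivariateGaussian_zero hV t
  rw [← hXl, charFun_apply, integral_map hX.aemeasurable hcX.aestronglyMeasurable] at hsX
  rw [← hYl, charFun_apply, integral_map hY.aemeasurable hcY.aestronglyMeasurable] at hsY
  rw [h2, hsX, hsY, ← Complex.exp_add]
  congr 1
  push_cast
  ring

lemma map_add_of_gaussian [IsProbabilityMeasure μ] (hX : Measurable X) (hY : Measurable Y) (hP : P.PosSemidef)
    (hV : V.PosSemidef) (hXl : μ.map X = multivariateGaussian 0 P)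
    (hYl : μ.map Y = multivariateGaussian 0 V) (hXY : IndepFun X Y μ)
    (F : Matrix (Fin r) (Fin n) ℝ) (G : Matrix (Fin r) (Fin q) ℝ)
    {N : Matrix (Fin r) (Fin r) ℝ} (hN : N = F * P * Fᵀ + G * V * Gᵀ) :
    N.PosSemidef ∧ μ.map (fun ω => Matrix.toEuclideanLin F (X ω) + Matrix.toEuclideanLin G (Y ω)) =
      multivariateGaussian 0 N := by
  have hNp : N.PosSemidef := by
    rw [hN]
    exact (by simpa using hP.mul_mul_conjTranspose_same F : (F * P * Fᵀ).PosSemidef).add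
      (by simpa using hV.mul_mul_conjTranspose_same G)
  refine ⟨hNp, ?_⟩
  have hm : Measurable fun ω => Matrix.toEuclideanLin F (X ω) + Matrix.toEuclideanLin G (Y ω) :=
    ((measurable_toEuclideanLin F).comp hX).add ((measurable_toEuclideanLin G).comp hY)
  have := Measure.isProbabilityMeasure_map (μ := μ) hm.aemeasurable
  apply Measure.ext_of_charFun
  ext t
  rw [charFun_multivariateGaussian_zero hNp, charFun_apply,
    integral_map hm.aemeasurable (by fun_prop)]
  simp_rw [inner_add_left, inner_toEuclideanLin_left]
  rw [integral_cexp_of_gaussian hX hY hP hV hXl hYl hXY, quadForm_toEuclideanLin,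
    quadForm_toEuclideanLin, hN]
  congr 3
  simp only [quadForm_eq_inner, toEuclideanLin_add, inner_add_right, Matrix.transpose_transpose]

/-- The joint characteristic function is the exponential of a quadratic form whose mixed term is
given by the cross-covariance. If that vanishes, the function factorizes. No invertibility is
needed. -/
lemma indepFun_of_gaussian [IsProbabilityMeasure μ] (hX : Measurable X) (hY : Measurable Y) (hP : P.PosSemidef)
    (hV : V.PosSemidef) (hXl : μ.map X = multivariateGaussian 0 P)
    (hYl : μ.map Y = multivariateGaussian 0 V) (hXY : IndepFun X Y μ)
    (F₁ : Matrix (Fin r) (Fin n) ℝ) (G₁ : Matrix (Fin r) (Fin q) ℝ)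
    (F₂ : Matrix (Fin l) (Fin n) ℝ) (G₂ : Matrix (Fin l) (Fin q) ℝ)
    (h0 : F₁ * P * F₂ᵀ + G₁ * V * G₂ᵀ = 0) :
    IndepFun (fun ω => Matrix.toEuclideanLin F₁ (X ω) + Matrix.toEuclideanLin G₁ (Y ω))
      (fun ω => Matrix.toEuclideanLin F₂ (X ω) + Matrix.toEuclideanLin G₂ (Y ω)) μ := by
  have hm : ∀ {k : ℕ} (F : Matrix (Fin k) (Fin n) ℝ) (G : Matrix (Fin k) (Fin q) ℝ),
      Measurable fun ω => Matrix.toEuclideanLin F (X ω) + Matrix.toEuclideanLin G (Y ω) :=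
    fun F G => ((measurable_toEuclideanLin F).comp hX).add ((measurable_toEuclideanLin G).comp hY)
  rw [indepFun_iff_charFun_prod (hm _ _).aemeasurable (hm _ _).aemeasurable]
  intro t
  obtain ⟨hp₁, hl₁⟩ := map_add_of_gaussian hX hY hP hV hXl hYl hXY F₁ G₁ rfl
  obtain ⟨hp₂, hl₂⟩ := map_add_of_gaussian hX hY hP hV hXl hYl hXY F₂ G₂ rfl
  have hpair : Measurable fun ω => WithLp.toLp 2 (Matrix.toEuclideanLin F₁ (X ω) +
      Matrix.toEuclideanLin G₁ (Y ω), Matrix.toEuclideanLin F₂ (X ω) +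
      Matrix.toEuclideanLin G₂ (Y ω)) :=
    (WithLp.measurable_toLp 2 _).comp ((hm F₁ G₁).prodMk (hm F₂ G₂))
  rw [hl₁, hl₂, charFun_multivariateGaussian_zero hp₁, charFun_multivariateGaussian_zero hp₂,
    charFun_apply, integral_map hpair.aemeasurable (by fun_prop), ← Complex.exp_add]
  have h1 : ∀ ω, ⟪WithLp.toLp 2 (Matrix.toEuclideanLin F₁ (X ω) + Matrix.toEuclideanLin G₁ (Y ω),
      Matrix.toEuclideanLin F₂ (X ω) + Matrix.toEuclideanLin G₂ (Y ω)), t⟫ =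
      ⟪X ω, Matrix.toEuclideanLin F₁ᵀ t.ofLp.1 + Matrix.toEuclideanLin F₂ᵀ t.ofLp.2⟫ +
      ⟪Y ω, Matrix.toEuclideanLin G₁ᵀ t.ofLp.1 + Matrix.toEuclideanLin G₂ᵀ t.ofLp.2⟫ := by
    intro ω
    rw [WithLp.prod_inner_apply]
    simp only [inner_add_left, inner_add_right, inner_toEuclideanLin_left]
    ring
  simp_rw [h1]
  rw [integral_cexp_of_gaussian hX hY hP hV hXl hYl hXY]
  have hPt : Pᵀ = P := by simpa using hP.isHermitian.eq
  have hVt : Vᵀ = V := by simpa using hV.isHermitian.eq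
  have key : ∀ (a : EuclideanSpace ℝ (Fin r)) (b : EuclideanSpace ℝ (Fin l)),
      ⟪a, Matrix.toEuclideanLin (F₁ * P * F₂ᵀ) b⟫ +
      ⟪a, Matrix.toEuclideanLin (G₁ * V * G₂ᵀ) b⟫ = 0 := by
    intro a b
    rw [← inner_add_right, ← toEuclideanLin_add, h0]
    simp
  have key2 : ∀ {a : ℕ} {M : Matrix (Fin a) (Fin a) ℝ} (hM : Mᵀ = M)
      (F : Matrix (Fin r) (Fin a) ℝ) (F' : Matrix (Fin l) (Fin a) ℝ),
      quadForm M (Matrix.toEuclideanLin Fᵀ t.ofLp.1 + Matrix.toEuclideanLin F'ᵀ t.ofLp.2) =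
      quadForm (F * M * Fᵀ) t.ofLp.1 + quadForm (F' * M * F'ᵀ) t.ofLp.2
        + 2 * ⟪t.ofLp.1, Matrix.toEuclideanLin (F * M * F'ᵀ) t.ofLp.2⟫ := by
    intro a M hM F F'
    simp only [quadForm_eq_inner, map_add, inner_add_left, inner_add_right,
      inner_toEuclideanLin_left, Matrix.transpose_transpose, toEuclideanLin_mul]
    have : ⟪t.ofLp.2, Matrix.toEuclideanLin F' (Matrix.toEuclideanLin M
        (Matrix.toEuclideanLin Fᵀ t.ofLp.1))⟫ = ⟪t.ofLp.1, Matrix.toEuclideanLin F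
        (Matrix.toEuclideanLin M (Matrix.toEuclideanLin F'ᵀ t.ofLp.2))⟫ := by
      rw [inner_toEuclideanLin_right, inner_toEuclideanLin_right, hM, real_inner_comm,
        inner_toEuclideanLin_left, Matrix.transpose_transpose]
    rw [this]
    ring
  rw [key2 hPt, key2 hVt]
  congr 1
  have := key t.ofLp.1 t.ofLp.2
  rw [← add_div]
  congr 1
  simp only [quadForm_eq_inner, toEuclideanLin_add, inner_add_right]
  rw [eq_neg_of_add_eq_zero_left this]
  push_cast
  ring

/-- If `X` has law `N(0, P)`, then `E[Xᵀ M X] = tr (M P)`. -/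
lemma integral_quadForm_of_gaussian (hX : Measurable X) (hP : P.PosSemidef)
    (hXl : μ.map X = multivariateGaussian 0 P) (M : Matrix (Fin n) (Fin n) ℝ) :
    ∫ ω, quadForm M (X ω) ∂μ = (M * P).trace := by
  have h1 := integral_map (μ := μ) hX.aemeasurable
    (continuous_quadForm M).aestronglyMeasurable (f := quadForm M)
  rw [← h1, hXl]
  have hL2 : ∀ i, MemLp (fun x : EuclideanSpace ℝ (Fin n) => x i) 2 (multivariateGaussian 0 P) :=
    fun i => (EuclideanSpace.proj (𝕜 := ℝ) i).comp_memLp' IsGaussian.memLp_two_id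
  have hmean : ∀ i, ∫ x : EuclideanSpace ℝ (Fin n), x i ∂multivariateGaussian 0 P = 0 := by
    intro i
    have := (EuclideanSpace.proj (𝕜 := ℝ) i).integral_comp_comm
      (IsGaussian.integrable_id (μ := multivariateGaussian (0 : EuclideanSpace ℝ (Fin n)) P))
    simpa using this
  have hcov : ∀ i j, ∫ x : EuclideanSpace ℝ (Fin n), x i * x j ∂multivariateGaussian 0 P = P i j := by
    intro i j
    have := covariance_eval_multivariateGaussian (μ := 0) hP i j
    rw [covariance_eq_sub (hL2 i) (hL2 j), hmean, zero_mul, sub_zero] at this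
    exact this
  have hint : ∀ i j, Integrable (fun x : EuclideanSpace ℝ (Fin n) => x i * x j)
      (multivariateGaussian 0 P) := fun i j => (hL2 i).integrable_mul (hL2 j)
  have hq : quadForm M = fun x => ∑ i, ∑ j, M i j * (x i * x j) := by
    ext x
    simp only [quadForm, dotProduct, Matrix.mulVec, Finset.mul_sum]
    exact Finset.sum_congr rfl fun i _ => Finset.sum_congr rfl fun j _ => by ring
  have hPt : ∀ i j, P i j = P j i := fun i j => by
    have := congrFun (congrFun hP.isHermitian.eq j) i
    simpa using this
  simp only [hq]
  refine (integral_finsetSum _ fun i _ =>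
    integrable_finsetSum _ fun j _ => (hint i j).const_mul _).trans ?_
  rw [Matrix.trace]
  refine Finset.sum_congr rfl fun i _ => ?_
  refine (integral_finsetSum _ fun j _ => (hint i j).const_mul _).trans ?_
  rw [Matrix.diag_apply, Matrix.mul_apply]
  refine Finset.sum_congr rfl fun j _ => ?_
  rw [integral_const_mul, hcov, hPt]

lemma memLp_two_of_gaussian {a : EuclideanSpace ℝ (Fin n)} (hX : Measurable X)
    (hXl : μ.map X = multivariateGaussian a P) : MemLp X 2 μ := by
  have h : MemLp id 2 (μ.map X) := by
    rw [hXl]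
    exact IsGaussian.memLp_two_id
  exact (memLp_map_measure_iff aestronglyMeasurable_id hX.aemeasurable).1 h

lemma integral_eq_of_gaussian {a : EuclideanSpace ℝ (Fin n)} (hX : Measurable X)
    (hXl : μ.map X = multivariateGaussian a P) : ∫ ω, X ω ∂μ = a := by
  have h := integral_map (μ := μ) hX.aemeasurable (f := fun x => x) aestronglyMeasurable_id
  rw [← h, hXl]
  exact integral_id_multivariateGaussian

end GaussianLinear

/-! ### Independence of σ-algebras -/

section Independence

variable {Ω : Type*} {mΩ : MeasurableSpace Ω} {μ : Measure Ω} [IsProbabilityMeasure μ]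

/-- Intersections of events of m₂ and m₃ form a π-system generating the join, and on it the product
formula follows from the two hypotheses. This moves one block of noise at a time across an
independence relation. -/
lemma indep_sup_right_of_indep_sup_left {m₁ m₂ m₃ : MeasurableSpace Ω} (h₁ : m₁ ≤ mΩ)
    (h₂ : m₂ ≤ mΩ) (h₃ : m₃ ≤ mΩ) (h₁₂ : Indep m₁ m₂ μ) (h₁₂₃ : Indep (m₁ ⊔ m₂) m₃ μ) :
    Indep m₁ (m₂ ⊔ m₃) μ := by
  let p : Set (Set Ω) := Set.image2 (· ∩ ·) {s | MeasurableSet[m₂] s} {t | MeasurableSet[m₃] t}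
  have hp : IsPiSystem p := by
    rintro _ ⟨s, hs, t, ht, rfl⟩ _ ⟨s', hs', t', ht', rfl⟩ _
    exact ⟨s ∩ s', hs.inter hs', t ∩ t', ht.inter ht', Set.inter_inter_inter_comm _ _ _ _⟩
  have hgen : m₂ ⊔ m₃ = MeasurableSpace.generateFrom p := by
    apply le_antisymm
    · refine sup_le (fun s hs => ?_) fun t ht => ?_
      · exact MeasurableSpace.measurableSet_generateFrom ⟨s, hs, Set.univ, MeasurableSet.univ, by simp⟩
      · exact MeasurableSpace.measurableSet_generateFrom ⟨Set.univ, MeasurableSet.univ, t, ht, by simp⟩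
    · refine MeasurableSpace.generateFrom_le ?_
      rintro _ ⟨s, hs, t, ht, rfl⟩
      exact MeasurableSet.inter ((le_sup_left : m₂ ≤ m₂ ⊔ m₃) s hs)
        ((le_sup_right : m₃ ≤ m₂ ⊔ m₃) t ht)
  refine IndepSets.indep h₁ (sup_le h₂ h₃) (@MeasurableSpace.isPiSystem_measurableSet Ω m₁) hp
    (@MeasurableSpace.generateFrom_measurableSet Ω m₁).symm hgen ?_
  rw [IndepSets_iff]
  rw [Indep_iff] at h₁₂ h₁₂₃
  rintro s _ hs ⟨t, ht, u, hu, rfl⟩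
  have hs' : MeasurableSet[m₁ ⊔ m₂] s := (le_sup_left : m₁ ≤ m₁ ⊔ m₂) s hs
  have ht' : MeasurableSet[m₁ ⊔ m₂] t := (le_sup_right : m₂ ≤ m₁ ⊔ m₂) t ht
  rw [← Set.inter_assoc, h₁₂₃ _ _ (hs'.inter ht') hu, h₁₂ _ _ hs ht, h₁₂₃ _ _ ht' hu, mul_assoc]

end Independence

/-! ### The Kalman filter: errors, innovations and their laws -/

namespace NCS

variable {n m p : ℕ}

/-- The standing assumptions on the noises: Gaussian laws, independence, and invertible innovation
covariances. -/
structure NoiseModel (sys : NCS n m p) {Ω : Type*} [MeasurableSpace Ω] (μ : Measure Ω)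
    (x0 : Ω → EuclideanSpace ℝ (Fin n)) (w : ℕ → Ω → EuclideanSpace ℝ (Fin n))
    (v : ℕ → Ω → EuclideanSpace ℝ (Fin p)) : Prop where
  posSemidef_W : sys.W.PosSemidef
  posSemidef_V : sys.V.PosSemidef
  posSemidef_R0 : sys.R0.PosSemidef
  posDef_innov : ∀ k, (sys.C * sys.predCov k * sys.Cᵀ + sys.V).PosDef
  measurable_x0 : Measurable x0
  measurable_w : ∀ k, Measurable (w k)
  measurable_v : ∀ k, Measurable (v k)
  map_x0 : μ.map x0 = multivariateGaussian sys.xbar sys.R0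
  map_w : ∀ k, μ.map (w k) = multivariateGaussian 0 sys.W
  map_v : ∀ k, μ.map (v k) = multivariateGaussian 0 sys.V
  iIndepFun_w : iIndepFun w μ
  iIndepFun_v : iIndepFun v μ
  indepFun_w_v : IndepFun (fun ω k => w k ω) (fun ω k => v k ω) μ
  indepFun_x0 : IndepFun x0 (fun ω => ((fun k => w k ω), (fun k => v k ω))) μ

/-! ### Control-free error recursions and their measurability. -/

section Errors

variable (sys : NCS n m p) {Ω : Type*} (x0 : Ω → EuclideanSpace ℝ (Fin n))
  (w : ℕ → Ω → EuclideanSpace ℝ (Fin n)) (v : ℕ → Ω → EuclideanSpace ℝ (Fin p))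

/-- The prediction error of the Kalman filter. It does not depend on the control. -/
def predErr : ℕ → Ω → EuclideanSpace ℝ (Fin n)
  | 0 => fun ω => x0 ω - sys.xbar
  | k + 1 => fun ω => Matrix.toEuclideanLin sys.A (predErr k ω -
      Matrix.toEuclideanLin (sys.gain (sys.predCov k))
        (Matrix.toEuclideanLin sys.C (predErr k ω) + v k ω)) + w k ω

/-- The innovation of the Kalman filter. -/
def innov (k : ℕ) (ω : Ω) : EuclideanSpace ℝ (Fin p) :=
  Matrix.toEuclideanLin sys.C (sys.predErr x0 w v k ω) + v k ω

/-- The correction of the Kalman filter, the innovation multiplied by the gain. -/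
def correction (k : ℕ) (ω : Ω) : EuclideanSpace ℝ (Fin n) :=
  Matrix.toEuclideanLin (sys.gain (sys.predCov k)) (sys.innov x0 w v k ω)

/-- The filtering error of the Kalman filter. -/
def filtErr (k : ℕ) (ω : Ω) : EuclideanSpace ℝ (Fin n) :=
  sys.predErr x0 w v k ω - sys.correction x0 w v k ω

/-- The covariance of the correction. -/
def correctionCov (k : ℕ) : Matrix (Fin n) (Fin n) ℝ :=
  sys.gain (sys.predCov k) * (sys.C * sys.predCov k * sys.Cᵀ + sys.V) *
    (sys.gain (sys.predCov k))ᵀ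

lemma predErr_succ (k : ℕ) (ω : Ω) : sys.predErr x0 w v (k + 1) ω =
    Matrix.toEuclideanLin sys.A (sys.filtErr x0 w v k ω) + w k ω := rfl

/-- The σ-algebra of the innovations before time `k`. -/
abbrev innovInfo (k : ℕ) : MeasurableSpace Ω :=
  ⨆ i, ⨆ _ : i < k, MeasurableSpace.comap (sys.innov x0 w v i) inferInstance

/-- The σ-algebra of `x 0`, of `w i` for `i < a` and of `v i` for `i < b`. -/
abbrev noiseInfo {n p : ℕ} {Ω : Type*} (x0 : Ω → EuclideanSpace ℝ (Fin n))
    (w : ℕ → Ω → EuclideanSpace ℝ (Fin n)) (v : ℕ → Ω → EuclideanSpace ℝ (Fin p))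
    (a b : ℕ) : MeasurableSpace Ω :=
  MeasurableSpace.comap x0 inferInstance ⊔
    (⨆ i, ⨆ _ : i < a, MeasurableSpace.comap (w i) inferInstance) ⊔
    ⨆ i, ⨆ _ : i < b, MeasurableSpace.comap (v i) inferInstance

lemma noiseInfo_mono {a a' b b' : ℕ} (ha : a ≤ a') (hb : b ≤ b') :
    noiseInfo x0 w v a b ≤ noiseInfo x0 w v a' b' := by
  refine sup_le_sup (sup_le_sup le_rfl ?_) ?_
  · exact iSup₂_le fun i hi => le_iSup₂_of_le i (hi.trans_le ha) le_rfl
  · exact iSup₂_le fun i hi => le_iSup₂_of_le i (hi.trans_le hb) le_rfl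

lemma measurable_x0_noiseInfo (a b : ℕ) : Measurable[noiseInfo x0 w v a b] x0 :=
  Measurable.of_comap_le (le_sup_of_le_left le_sup_left)

lemma measurable_w_noiseInfo {i a : ℕ} (h : i < a) (b : ℕ) :
    Measurable[noiseInfo x0 w v a b] (w i) :=
  Measurable.of_comap_le (le_sup_of_le_left (le_sup_of_le_right (le_iSup₂_of_le i h le_rfl)))

lemma measurable_v_noiseInfo {i b : ℕ} (a : ℕ) (h : i < b) :
    Measurable[noiseInfo x0 w v a b] (v i) :=
  Measurable.of_comap_le (le_sup_of_le_right (le_iSup₂_of_le i h le_rfl))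

lemma measurable_predErr_noiseInfo (k : ℕ) :
    Measurable[noiseInfo x0 w v k k] (sys.predErr x0 w v k) := by
  induction k with
  | zero => exact (measurable_x0_noiseInfo x0 w v 0 0).sub_const sys.xbar
  | succ k ih =>
    have h1 := ih.mono (noiseInfo_mono x0 w v k.le_succ k.le_succ) le_rfl
    have h2 := measurable_v_noiseInfo x0 w v (k + 1) k.lt_succ_self
    have h3 := measurable_w_noiseInfo x0 w v k.lt_succ_self (k + 1)
    exact ((measurable_toEuclideanLin _).comp (h1.sub ((measurable_toEuclideanLin _).comp
      (((measurable_toEuclideanLin _).comp h1).add h2)))).add h3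

lemma measurable_innov_noiseInfo (k : ℕ) :
    Measurable[noiseInfo x0 w v k (k + 1)] (sys.innov x0 w v k) :=
  ((measurable_toEuclideanLin _).comp ((sys.measurable_predErr_noiseInfo x0 w v k).mono
    (noiseInfo_mono x0 w v le_rfl k.le_succ) le_rfl)).add
    (measurable_v_noiseInfo x0 w v k k.lt_succ_self)

lemma measurable_correction_noiseInfo (k : ℕ) :
    Measurable[noiseInfo x0 w v k (k + 1)] (sys.correction x0 w v k) :=
  (measurable_toEuclideanLin _).comp (sys.measurable_innov_noiseInfo x0 w v k)

lemma measurable_filtErr_noiseInfo (k : ℕ) :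
    Measurable[noiseInfo x0 w v k (k + 1)] (sys.filtErr x0 w v k) :=
  ((sys.measurable_predErr_noiseInfo x0 w v k).mono
    (noiseInfo_mono x0 w v le_rfl k.le_succ) le_rfl).sub
    (sys.measurable_correction_noiseInfo x0 w v k)

lemma measurable_innov_innovInfo {i k : ℕ} (h : i < k) :
    Measurable[sys.innovInfo x0 w v k] (sys.innov x0 w v i) :=
  Measurable.of_comap_le (le_iSup₂_of_le i h le_rfl)

lemma innovInfo_mono {k l : ℕ} (h : k ≤ l) : sys.innovInfo x0 w v k ≤ sys.innovInfo x0 w v l :=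
  iSup₂_le fun i hi => le_iSup₂_of_le i (hi.trans_le h) le_rfl

lemma innovInfo_succ (k : ℕ) : sys.innovInfo x0 w v (k + 1) =
    MeasurableSpace.comap (sys.innov x0 w v k) inferInstance ⊔ sys.innovInfo x0 w v k := by
  refine le_antisymm (iSup₂_le fun i hi => ?_) (sup_le (le_iSup₂_of_le k k.lt_succ_self le_rfl)
    (sys.innovInfo_mono x0 w v k.le_succ))
  rcases Nat.lt_succ_iff_lt_or_eq.1 hi with h | rfl
  · exact le_sup_of_le_right (le_iSup₂_of_le i h le_rfl)
  · exact le_sup_left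

lemma innovInfo_succ_le_noiseInfo (k : ℕ) :
    sys.innovInfo x0 w v (k + 1) ≤ noiseInfo x0 w v k (k + 1) :=
  iSup₂_le fun i hi => ((sys.measurable_innov_noiseInfo x0 w v i).mono
    (noiseInfo_mono x0 w v (by omega) (by omega)) le_rfl).comap_le

lemma innovInfo_le_noiseInfo (k : ℕ) :
    sys.innovInfo x0 w v k ≤ noiseInfo x0 w v k k :=
  iSup₂_le fun i hi => ((sys.measurable_innov_noiseInfo x0 w v i).mono
    (noiseInfo_mono x0 w v (by omega) (by omega)) le_rfl).comap_le

/-- The prediction error covariance `M` splits into the covariances of filtering error and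
correction. -/
lemma filtCov_add_correctionCov {k : ℕ} (hP : (sys.predCov k).PosSemidef)
    (hN : (sys.C * sys.predCov k * sys.Cᵀ + sys.V).PosDef) :
    sys.filtCov k + sys.correctionCov k = sys.predCov k := by
  have hu : IsUnit (sys.C * sys.predCov k * sys.Cᵀ + sys.V).det :=
    (Matrix.isUnit_iff_isUnit_det _).1 hN.isUnit
  have hPt : (sys.predCov k)ᵀ = sys.predCov k := by simpa using hP.isHermitian.eq
  have hNt : (sys.C * sys.predCov k * sys.Cᵀ + sys.V)ᵀ =
      sys.C * sys.predCov k * sys.Cᵀ + sys.V := by simpa using hN.isHermitian.eq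
  have h1 : (sys.C * sys.predCov k * sys.Cᵀ + sys.V) * (sys.gain (sys.predCov k))ᵀ =
      sys.C * sys.predCov k := by
    rw [gain, Matrix.transpose_mul, Matrix.transpose_nonsing_inv, hNt, Matrix.transpose_mul,
      Matrix.transpose_transpose, hPt, ← Matrix.mul_assoc, Matrix.mul_nonsing_inv _ hu,
      Matrix.one_mul]
  rw [filtCov, measUpdate, correctionCov, Matrix.mul_assoc _ _ (sys.gain _)ᵀ, h1, Matrix.mul_assoc]
  abel

end Errors

namespace NoiseModel

variable {sys : NCS n m p} {Ω : Type*} [MeasurableSpace Ω] {μ : Measure Ω}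
  {x0 : Ω → EuclideanSpace ℝ (Fin n)} {w : ℕ → Ω → EuclideanSpace ℝ (Fin n)}
  {v : ℕ → Ω → EuclideanSpace ℝ (Fin p)} (hM : sys.NoiseModel μ x0 w v)

include hM

lemma noiseInfo_le (a b : ℕ) : noiseInfo x0 w v a b ≤ (inferInstance : MeasurableSpace Ω) :=
  sup_le (sup_le hM.measurable_x0.comap_le (iSup₂_le fun i _ => (hM.measurable_w i).comap_le))
    (iSup₂_le fun i _ => (hM.measurable_v i).comap_le)

lemma measurable_predErr (k : ℕ) : Measurable (sys.predErr x0 w v k) :=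
  (sys.measurable_predErr_noiseInfo x0 w v k).mono (hM.noiseInfo_le _ _) le_rfl

lemma measurable_innov (k : ℕ) : Measurable (sys.innov x0 w v k) :=
  (sys.measurable_innov_noiseInfo x0 w v k).mono (hM.noiseInfo_le _ _) le_rfl

lemma measurable_correction (k : ℕ) : Measurable (sys.correction x0 w v k) :=
  (sys.measurable_correction_noiseInfo x0 w v k).mono (hM.noiseInfo_le _ _) le_rfl

lemma measurable_filtErr (k : ℕ) : Measurable (sys.filtErr x0 w v k) :=
  (sys.measurable_filtErr_noiseInfo x0 w v k).mono (hM.noiseInfo_le _ _) le_rfl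

lemma innovInfo_le (k : ℕ) : sys.innovInfo x0 w v k ≤ (inferInstance : MeasurableSpace Ω) :=
  (sys.innovInfo_le_noiseInfo x0 w v k).trans (hM.noiseInfo_le _ _)

/-! ### Independence of innovations and Gaussian laws of the errors. -/

section Independent

omit hM in
lemma indep_comap_iSup_lt {E : Type*} [MeasurableSpace E] {f : ℕ → Ω → E} (h : iIndepFun f μ)
    (hf : ∀ k, Measurable (f k)) (k : ℕ) :
    Indep (MeasurableSpace.comap (f k) inferInstance)
      (⨆ i, ⨆ _ : i < k, MeasurableSpace.comap (f i) inferInstance) μ := by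
  have h1 := indep_iSup_of_disjoint (fun i => (hf i).comap_le) h.iIndep
    (S := {k}) (T := {i | i < k}) (by simp)
  simpa using h1

omit hM [MeasurableSpace Ω] in
lemma iSup_comap_le_comap_pi {E : Type*} [MeasurableSpace E] (f : ℕ → Ω → E) (k : ℕ) :
    (⨆ i, ⨆ _ : i < k, MeasurableSpace.comap (f i) inferInstance) ≤
      MeasurableSpace.comap (fun ω i => f i ω) (inferInstance : MeasurableSpace (ℕ → E)) := by
  refine iSup₂_le fun i _ => ?_
  have : f i = (fun g : ℕ → E => g i) ∘ fun ω i => f i ω := rfl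
  rw [this, ← MeasurableSpace.comap_comp]
  exact MeasurableSpace.comap_mono (measurable_pi_apply i).comap_le

lemma indep_pi : Indep (MeasurableSpace.comap (fun ω k => w k ω) inferInstance ⊔
    MeasurableSpace.comap (fun ω k => v k ω) inferInstance)
    (MeasurableSpace.comap x0 inferInstance) μ := by
  have h := ((IndepFun_iff_Indep _ _ _).1 hM.indepFun_x0).symm
  refine indep_of_indep_of_le_left h (sup_le ?_ ?_)
  · have : (fun ω k => w k ω) = Prod.fst ∘ fun ω => ((fun k => w k ω), (fun k => v k ω)) := rfl
    rw [this, ← MeasurableSpace.comap_comp]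
    exact MeasurableSpace.comap_mono measurable_fst.comap_le
  · have : (fun ω k => v k ω) = Prod.snd ∘ fun ω => ((fun k => w k ω), (fun k => v k ω)) := rfl
    rw [this, ← MeasurableSpace.comap_comp]
    exact MeasurableSpace.comap_mono measurable_snd.comap_le

variable [IsProbabilityMeasure μ]

/-- Earlier measurement noises, the whole path of `w` and finally `x0` are added one after another.
Whole paths are used because the hypotheses concern processes; the restriction to times below k
comes last. -/
lemma indep_v (k : ℕ) :
    Indep (MeasurableSpace.comap (v k) inferInstance) (noiseInfo x0 w v k k) μ := by
  have hv := hM.measurable_v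
  have hvle : MeasurableSpace.comap (v k) inferInstance ≤
      MeasurableSpace.comap (fun ω i => v i ω) inferInstance :=
    (le_iSup₂_of_le k k.lt_succ_self le_rfl).trans (iSup_comap_le_comap_pi v (k + 1))
  have hpv : Measurable fun ω i => v i ω := measurable_pi_iff.2 hv
  have hpw : Measurable fun ω i => w i ω := measurable_pi_iff.2 hM.measurable_w
  have hlt : (⨆ i, ⨆ _ : i < k, MeasurableSpace.comap (v i) inferInstance) ≤
      (inferInstance : MeasurableSpace Ω) := iSup₂_le fun i _ => (hv i).comap_le
  have hwv := ((IndepFun_iff_Indep _ _ _).1 hM.indepFun_w_v).symm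
  have h1 := indep_sup_right_of_indep_sup_left (hv k).comap_le hlt hpw.comap_le
    (indep_comap_iSup_lt hM.iIndepFun_v hv k)
    (indep_of_indep_of_le_left hwv (sup_le hvle (iSup_comap_le_comap_pi v k)))
  have h2 := indep_sup_right_of_indep_sup_left (hv k).comap_le (sup_le hlt hpw.comap_le)
    hM.measurable_x0.comap_le h1 (indep_of_indep_of_le_left hM.indep_pi
      (sup_le (le_sup_of_le_right hvle) (sup_le
        (le_sup_of_le_right (iSup_comap_le_comap_pi v k)) le_sup_left)))
  refine indep_of_indep_of_le_right h2 (sup_le (sup_le le_sup_right ?_) ?_)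
  · exact le_sup_of_le_left (le_sup_of_le_right (iSup_comap_le_comap_pi w k))
  · exact le_sup_of_le_left le_sup_left

/-- The measurement noise at time k is already part of the past here: it enters the filter before `w
k` drives the state. -/
lemma indep_w (k : ℕ) :
    Indep (MeasurableSpace.comap (w k) inferInstance) (noiseInfo x0 w v k (k + 1)) μ := by
  have hw := hM.measurable_w
  have hwle : MeasurableSpace.comap (w k) inferInstance ≤
      MeasurableSpace.comap (fun ω i => w i ω) inferInstance :=
    (le_iSup₂_of_le k k.lt_succ_self le_rfl).trans (iSup_comap_le_comap_pi w (k + 1))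
  have hpv : Measurable fun ω i => v i ω := measurable_pi_iff.2 hM.measurable_v
  have hlt : (⨆ i, ⨆ _ : i < k, MeasurableSpace.comap (w i) inferInstance) ≤
      (inferInstance : MeasurableSpace Ω) := iSup₂_le fun i _ => (hw i).comap_le
  have hwv := (IndepFun_iff_Indep _ _ _).1 hM.indepFun_w_v
  have h1 := indep_sup_right_of_indep_sup_left (hw k).comap_le hlt hpv.comap_le
    (indep_comap_iSup_lt hM.iIndepFun_w hw k)
    (indep_of_indep_of_le_left hwv (sup_le hwle (iSup_comap_le_comap_pi w k)))
  have h2 := indep_sup_right_of_indep_sup_left (hw k).comap_le (sup_le hlt hpv.comap_le)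
    hM.measurable_x0.comap_le h1 (indep_of_indep_of_le_left hM.indep_pi
      (sup_le (le_sup_of_le_left hwle) (sup_le
        (le_sup_of_le_left (iSup_comap_le_comap_pi w k)) le_sup_right)))
  refine indep_of_indep_of_le_right h2 (sup_le (sup_le le_sup_right ?_) ?_)
  · exact le_sup_of_le_left le_sup_left
  · exact le_sup_of_le_left (le_sup_of_le_right (iSup_comap_le_comap_pi v (k + 1)))

lemma indepFun_of_noiseInfo_w {E : Type*} [MeasurableSpace E] {k : ℕ} {X : Ω → E}
    (hX : Measurable[noiseInfo x0 w v k (k + 1)] X) : IndepFun X (w k) μ :=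
  (IndepFun_iff_Indep _ _ _).2 (indep_of_indep_of_le_left (hM.indep_w k).symm hX.comap_le)

/-- The law of the prediction error at time `k`, and its independence from the innovations. -/
structure PredFacts (sys : NCS n m p) (μ : Measure Ω) (x0 : Ω → EuclideanSpace ℝ (Fin n))
    (w : ℕ → Ω → EuclideanSpace ℝ (Fin n)) (v : ℕ → Ω → EuclideanSpace ℝ (Fin p)) (k : ℕ) :
    Prop where
  posSemidef : (sys.predCov k).PosSemidef
  map_eq : μ.map (sys.predErr x0 w v k) = multivariateGaussian 0 (sys.predCov k)
  indep : Indep (MeasurableSpace.comap (sys.predErr x0 w v k) inferInstance)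
    (sys.innovInfo x0 w v k) μ

/-- The laws of filtering error and innovation at time `k`, and their independence from earlier
innovations. -/
structure FiltFacts (sys : NCS n m p) (μ : Measure Ω) (x0 : Ω → EuclideanSpace ℝ (Fin n))
    (w : ℕ → Ω → EuclideanSpace ℝ (Fin n)) (v : ℕ → Ω → EuclideanSpace ℝ (Fin p)) (k : ℕ) :
    Prop where
  posSemidef : (sys.filtCov k).PosSemidef
  map_eq : μ.map (sys.filtErr x0 w v k) = multivariateGaussian 0 (sys.filtCov k)
  indep : Indep (MeasurableSpace.comap (sys.filtErr x0 w v k) inferInstance)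
    (sys.innovInfo x0 w v (k + 1)) μ
  posSemidef_correction : (sys.correctionCov k).PosSemidef
  map_correction : μ.map (sys.correction x0 w v k) = multivariateGaussian 0 (sys.correctionCov k)
  indep_innov : Indep (MeasurableSpace.comap (sys.innov x0 w v k) inferInstance)
    (sys.innovInfo x0 w v k) μ

/-- Filtering error, innovation and correction are linear images of the independent Gaussian pair
(prediction error, measurement noise). The Kalman gain is exactly what makes the cross-covariance of
filtering error and innovation vanish. -/
lemma filtFacts_of_predFacts {k : ℕ} (h : PredFacts sys μ x0 w v k) :
    FiltFacts sys μ x0 w v k := by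
  have hN := hM.posDef_innov k
  have hu : IsUnit (sys.C * sys.predCov k * sys.Cᵀ + sys.V).det :=
    (Matrix.isUnit_iff_isUnit_det _).1 hN.isUnit
  have hPt : (sys.predCov k)ᵀ = sys.predCov k := by simpa using h.posSemidef.isHermitian.eq
  have hNt : (sys.C * sys.predCov k * sys.Cᵀ + sys.V)ᵀ =
      sys.C * sys.predCov k * sys.Cᵀ + sys.V := by simpa using hN.isHermitian.eq
  obtain ⟨K, hK⟩ : ∃ K, K = sys.gain (sys.predCov k) := ⟨_, rfl⟩
  have hKN : (sys.C * sys.predCov k * sys.Cᵀ + sys.V) * Kᵀ = sys.C * sys.predCov k := by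
    rw [hK, gain, Matrix.transpose_mul, Matrix.transpose_nonsing_inv, hNt, Matrix.transpose_mul,
      Matrix.transpose_transpose, hPt, ← Matrix.mul_assoc, Matrix.mul_nonsing_inv _ hu,
      Matrix.one_mul]
  have hv := hM.measurable_v k
  have hp := hM.measurable_predErr k
  have hvpast := hM.indep_v k
  have hple := (sys.measurable_predErr_noiseInfo x0 w v k).comap_le
  have hindpv : IndepFun (sys.predErr x0 w v k) (v k) μ :=
    (IndepFun_iff_Indep _ _ _).2 (indep_of_indep_of_le_left hvpast.symm hple)
  -- filtering error, innovation and correction as linear images of prediction error and noise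
  have hfilt : sys.filtErr x0 w v k = fun ω =>
      Matrix.toEuclideanLin (1 - K * sys.C) (sys.predErr x0 w v k ω) +
        Matrix.toEuclideanLin (-K) (v k ω) := by
    ext1 ω
    rw [filtErr, correction, innov, ← hK, map_add, toEuclideanLin_sub, toEuclideanLin_mul,
      toEuclideanLin_one, toEuclideanLin_neg]
    abel
  have hinn : sys.innov x0 w v k = fun ω =>
      Matrix.toEuclideanLin sys.C (sys.predErr x0 w v k ω) +
        Matrix.toEuclideanLin 1 (v k ω) := by
    ext1 ω
    rw [innov, toEuclideanLin_one]
  have hcor : sys.correction x0 w v k = fun ω =>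
      Matrix.toEuclideanLin (K * sys.C) (sys.predErr x0 w v k ω) +
        Matrix.toEuclideanLin K (v k ω) := by
    ext1 ω
    rw [correction, innov, ← hK, map_add, toEuclideanLin_mul]
  have hcross : sys.C * sys.predCov k * (1 - K * sys.C)ᵀ + 1 * sys.V * (-K)ᵀ = 0 := by
    rw [Matrix.transpose_sub, Matrix.transpose_one, Matrix.transpose_mul, Matrix.transpose_neg,
      Matrix.mul_sub, Matrix.mul_one, Matrix.one_mul, Matrix.mul_neg]
    rw [Matrix.add_mul] at hKN
    rw [← Matrix.mul_assoc]
    nth_rewrite 1 [← hKN]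
    abel
  -- The linear image has covariance (1 - K C) M (1 - K C)ᵀ + K V Kᵀ, which collapses to M - K C M
  -- by the gain equation.
  obtain ⟨hfp, hfl⟩ := map_add_of_gaussian hp hv h.posSemidef hM.posSemidef_V h.map_eq (hM.map_v k)
    hindpv (1 - K * sys.C) (-K) (N := sys.filtCov k) (by
      have h1 : K * (sys.C * sys.predCov k * sys.Cᵀ + sys.V) = sys.predCov k * sys.Cᵀ := by
        have := congrArg Matrix.transpose hKN
        rwa [Matrix.transpose_mul, Matrix.transpose_transpose, hNt, Matrix.transpose_mul,
          hPt] at this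
      rw [filtCov, measUpdate, ← hK]
      simp only [Matrix.transpose_sub, Matrix.transpose_one, Matrix.transpose_mul,
        Matrix.transpose_neg, Matrix.sub_mul, Matrix.mul_sub, Matrix.one_mul, Matrix.mul_one,
        Matrix.neg_mul, Matrix.mul_neg, ← Matrix.mul_assoc]
      rw [← h1]
      simp only [Matrix.mul_add, Matrix.add_mul, ← Matrix.mul_assoc]
      abel)
  obtain ⟨hcp, hcl⟩ := map_add_of_gaussian hp hv h.posSemidef hM.posSemidef_V h.map_eq (hM.map_v k)
    hindpv (K * sys.C) K (N := sys.correctionCov k) (by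
      rw [correctionCov, ← hK]
      simp only [Matrix.transpose_mul, Matrix.mul_add, Matrix.add_mul, Matrix.mul_assoc])
  have hif : IndepFun (sys.innov x0 w v k) (sys.filtErr x0 w v k) μ := by
    rw [hinn, hfilt]
    exact indepFun_of_gaussian hp hv h.posSemidef hM.posSemidef_V h.map_eq (hM.map_v k) hindpv
      _ _ _ _ hcross
  have hinfo := hM.innovInfo_le k
  -- the pair (prediction error, measurement noise) is independent of the earlier innovations
  have h1 : Indep (sys.innovInfo x0 w v k)
      (MeasurableSpace.comap (sys.predErr x0 w v k) inferInstance ⊔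
        MeasurableSpace.comap (v k) inferInstance) μ :=
    indep_sup_right_of_indep_sup_left hinfo hp.comap_le hv.comap_le h.indep.symm
      (indep_of_indep_of_le_left hvpast.symm
        (sup_le (sys.innovInfo_le_noiseInfo x0 w v k) hple))
  have hpm : Measurable[MeasurableSpace.comap (sys.predErr x0 w v k) inferInstance ⊔
      MeasurableSpace.comap (v k) inferInstance] (sys.predErr x0 w v k) :=
    Measurable.of_comap_le le_sup_left
  have hvm : Measurable[MeasurableSpace.comap (sys.predErr x0 w v k) inferInstance ⊔
      MeasurableSpace.comap (v k) inferInstance] (v k) :=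
    Measurable.of_comap_le le_sup_right
  have hinnle : MeasurableSpace.comap (sys.innov x0 w v k) inferInstance ≤
      MeasurableSpace.comap (sys.predErr x0 w v k) inferInstance ⊔
        MeasurableSpace.comap (v k) inferInstance := by
    have h2 := ((measurable_toEuclideanLin sys.C).comp hpm).add hvm
    exact h2.comap_le
  have hfiltle : MeasurableSpace.comap (sys.filtErr x0 w v k) inferInstance ≤
      MeasurableSpace.comap (sys.predErr x0 w v k) inferInstance ⊔
        MeasurableSpace.comap (v k) inferInstance := by
    have h2 := ((measurable_toEuclideanLin (1 - K * sys.C)).comp hpm).add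
      ((measurable_toEuclideanLin (-K)).comp hvm)
    rw [hfilt]
    exact h2.comap_le
  refine ⟨hfp, by rw [hfilt]; exact hfl, ?_, hcp, by rw [hcor]; exact hcl,
    (indep_of_indep_of_le_right h1 hinnle).symm⟩
  -- The filtering error is independent of the current innovation, and the two together are
  -- independent of the earlier ones.
  rw [innovInfo_succ]
  exact indep_sup_right_of_indep_sup_left (hM.measurable_filtErr k).comap_le
    (hM.measurable_innov k).comap_le hinfo ((IndepFun_iff_Indep _ _ _).1 hif).symm
    (indep_of_indep_of_le_left h1.symm (sup_le hfiltle hinnle))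

lemma predFacts_succ {k : ℕ} (h : FiltFacts sys μ x0 w v k) :
    PredFacts sys μ x0 w v (k + 1) := by
  have hw := hM.measurable_w k
  have hf := hM.measurable_filtErr k
  have hfle := (sys.measurable_filtErr_noiseInfo x0 w v k).comap_le
  have hind : IndepFun (sys.filtErr x0 w v k) (w k) μ :=
    hM.indepFun_of_noiseInfo_w (sys.measurable_filtErr_noiseInfo x0 w v k)
  have hpred : sys.predErr x0 w v (k + 1) = fun ω =>
      Matrix.toEuclideanLin sys.A (sys.filtErr x0 w v k ω) + Matrix.toEuclideanLin 1 (w k ω) := by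
    ext1 ω
    rw [predErr_succ, toEuclideanLin_one]
  obtain ⟨hp, hl⟩ := map_add_of_gaussian hf hw h.posSemidef hM.posSemidef_W h.map_eq (hM.map_w k)
    hind sys.A 1 (N := sys.predCov (k + 1)) (by
      rw [Matrix.one_mul, Matrix.transpose_one, Matrix.mul_one]
      rfl)
  refine ⟨hp, by rw [hpred]; exact hl, ?_⟩
  have h1 := indep_sup_right_of_indep_sup_left (hM.innovInfo_le (k + 1)) hf.comap_le hw.comap_le
    h.indep.symm (indep_of_indep_of_le_left (hM.indep_w k).symm
      (sup_le (sys.innovInfo_succ_le_noiseInfo x0 w v k) hfle))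
  refine (indep_of_indep_of_le_right h1 ?_).symm
  have hfm : Measurable[MeasurableSpace.comap (sys.filtErr x0 w v k) inferInstance ⊔
      MeasurableSpace.comap (w k) inferInstance] (sys.filtErr x0 w v k) :=
    Measurable.of_comap_le le_sup_left
  have hwm : Measurable[MeasurableSpace.comap (sys.filtErr x0 w v k) inferInstance ⊔
      MeasurableSpace.comap (w k) inferInstance] (w k) :=
    Measurable.of_comap_le le_sup_right
  have h2 := ((measurable_toEuclideanLin sys.A).comp hfm).add hwm
  exact h2.comap_le

lemma predFacts (k : ℕ) : PredFacts sys μ x0 w v k := by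
  induction k with
  | zero =>
    refine ⟨hM.posSemidef_R0, ?_, ?_⟩
    · change μ.map (fun ω => x0 ω - sys.xbar) = multivariateGaussian 0 sys.R0
      have h1 : (fun ω => x0 ω - sys.xbar) = (fun x => x - sys.xbar) ∘ x0 := rfl
      rw [h1, ← Measure.map_map (by fun_prop) hM.measurable_x0, hM.map_x0, multivariateGaussian,
        multivariateGaussian, Measure.map_map (by fun_prop) (by fun_prop)]
      congr 1
      ext1 x
      simp
    · have : sys.innovInfo x0 w v 0 = ⊥ := by simp [innovInfo]
      rw [this]
      exact indep_bot_right _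
  | succ k ih => exact hM.predFacts_succ (hM.filtFacts_of_predFacts ih)

lemma filtFacts (k : ℕ) : FiltFacts sys μ x0 w v k := hM.filtFacts_of_predFacts (hM.predFacts k)

end Independent

end NoiseModel

end NCS

/-! ### The closed loop under an admissible scheduling law -/

namespace NCS

variable {n m p : ℕ}

/-! ### Separation: the control cancels from the errors. -/

section Recursion

variable (sys : NCS n m p) {Ω : Type*} (S : Matrix (Fin n) (Fin n) ℝ)
  (x0 : Ω → EuclideanSpace ℝ (Fin n))
  (w : ℕ → Ω → EuclideanSpace ℝ (Fin n)) (v : ℕ → Ω → EuclideanSpace ℝ (Fin p))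
  (δ : ℕ → Ω → Bool)

/-- The one-step prediction `A x̂ˢ k + B u k` of the local filter. -/
def localPred (k : ℕ) (ω : Ω) : EuclideanSpace ℝ (Fin n) :=
  Matrix.toEuclideanLin sys.A (sys.localEst S x0 w v δ k ω) +
    Matrix.toEuclideanLin sys.B (sys.control S x0 w v δ k ω)

lemma plantState_succ (k : ℕ) (ω : Ω) : sys.plantState S x0 w v δ (k + 1) ω =
    Matrix.toEuclideanLin sys.A (sys.plantState S x0 w v δ k ω) +
      Matrix.toEuclideanLin sys.B (sys.control S x0 w v δ k ω) + w k ω := rfl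

lemma remoteEst_zero : sys.remoteEst S x0 w v δ 0 = fun _ => sys.xbar := rfl

lemma remoteEst_succ (k : ℕ) (ω : Ω) : sys.remoteEst S x0 w v δ (k + 1) ω =
    if δ k ω then sys.localPred S x0 w v δ k ω
    else Matrix.toEuclideanLin sys.A (sys.remoteEst S x0 w v δ k ω) +
      Matrix.toEuclideanLin sys.B (sys.control S x0 w v δ k ω) := rfl

/-- Plant and filter receive the same input, so it cancels in their difference, which obeys the
control-free recursion of `predErr` and `filtErr`. -/
lemma localEst_eq_and_plantState_eq (k : ℕ) (ω : Ω) :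
    (sys.localEst S x0 w v δ k ω = (if k = 0 then sys.xbar else
      sys.localPred S x0 w v δ (k - 1) ω) + sys.correction x0 w v k ω) ∧
    sys.plantState S x0 w v δ k ω = sys.localEst S x0 w v δ k ω + sys.filtErr x0 w v k ω := by
  have step : ∀ k (xp : EuclideanSpace ℝ (Fin n)),
      sys.plantState S x0 w v δ k ω = xp + sys.predErr x0 w v k ω →
      sys.localEst S x0 w v δ k ω = sys.kalmanUpdate k xp (sys.output S x0 w v δ k ω) →
      sys.localEst S x0 w v δ k ω = xp + sys.correction x0 w v k ω ∧
      sys.plantState S x0 w v δ k ω = sys.localEst S x0 w v δ k ω + sys.filtErr x0 w v k ω := by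
    intro k xp hx hxs
    have h1 : sys.localEst S x0 w v δ k ω = xp + sys.correction x0 w v k ω := by
      rw [hxs, kalmanUpdate, correction, innov, output, hx, map_add]
      congr 2
      abel
    refine ⟨h1, ?_⟩
    rw [h1, hx, filtErr]
    abel
  induction k with
  | zero =>
    refine step 0 sys.xbar ?_ rfl
    change x0 ω = sys.xbar + (x0 ω - sys.xbar)
    abel
  | succ k ih =>
    refine step (k + 1) (sys.localPred S x0 w v δ k ω) ?_ rfl
    rw [plantState_succ, predErr_succ, ih.2, map_add, localPred]
    abel

lemma plantState_eq (k : ℕ) (ω : Ω) :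
    sys.plantState S x0 w v δ k ω = sys.localEst S x0 w v δ k ω + sys.filtErr x0 w v k ω :=
  (sys.localEst_eq_and_plantState_eq S x0 w v δ k ω).2

lemma localEst_zero_eq (ω : Ω) :
    sys.localEst S x0 w v δ 0 ω = sys.xbar + sys.correction x0 w v 0 ω :=
  (sys.localEst_eq_and_plantState_eq S x0 w v δ 0 ω).1

lemma localEst_succ_eq (k : ℕ) (ω : Ω) : sys.localEst S x0 w v δ (k + 1) ω =
    sys.localPred S x0 w v δ k ω + sys.correction x0 w v (k + 1) ω :=
  (sys.localEst_eq_and_plantState_eq S x0 w v δ (k + 1) ω).1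

lemma output_zero_eq (ω : Ω) : sys.output S x0 w v δ 0 ω =
    Matrix.toEuclideanLin sys.C sys.xbar + sys.innov x0 w v 0 ω := by
  rw [output, plantState_eq, localEst_zero_eq, innov, filtErr, add_add_sub_cancel, map_add,
    add_assoc]

lemma output_succ_eq (k : ℕ) (ω : Ω) : sys.output S x0 w v δ (k + 1) ω =
    Matrix.toEuclideanLin sys.C (sys.localPred S x0 w v δ k ω) + sys.innov x0 w v (k + 1) ω := by
  rw [output, plantState_eq, localEst_succ_eq, innov, filtErr, add_add_sub_cancel, map_add,
    add_assoc]

lemma mismatch_zero (ω : Ω) :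
    sys.mismatch S x0 w v δ 0 ω = 0 + -sys.correction x0 w v 0 ω := by
  rw [mismatch, localEst_zero_eq, zero_add]
  change sys.xbar - _ = _
  abel

/-- The mean of the next mismatch, `(1 - δ) A e`. -/
def mismatchDrift (k : ℕ) (ω : Ω) : EuclideanSpace ℝ (Fin n) :=
  (1 - decisionValue (δ k ω)) • Matrix.toEuclideanLin sys.A (sys.mismatch S x0 w v δ k ω)

/-- After a transmission both sides predict from the same estimate and only the new correction
separates them; after silence the old mismatch is propagated by A. -/
lemma mismatch_succ (k : ℕ) (ω : Ω) : sys.mismatch S x0 w v δ (k + 1) ω =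
    sys.mismatchDrift S x0 w v δ k ω + -sys.correction x0 w v (k + 1) ω := by
  rw [mismatch, localEst_succ_eq, remoteEst_succ, mismatchDrift, mismatch, localPred]
  cases δ k ω
  · simp only [Bool.false_eq_true, if_false, decisionValue, sub_zero, one_smul, map_sub]
    abel
  · simp [decisionValue]

lemma plantState_sub_remoteEst (k : ℕ) (ω : Ω) :
    sys.plantState S x0 w v δ k ω - sys.remoteEst S x0 w v δ k ω =
      -sys.mismatch S x0 w v δ k ω + sys.filtErr x0 w v k ω := by
  rw [plantState_eq, mismatch]
  abel

end Recursion

/-! ### Who can compute what: scheduler, remote side, innovations. -/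

section Measurability

variable (sys : NCS n m p) {Ω : Type*} (S : Matrix (Fin n) (Fin n) ℝ)
  (x0 : Ω → EuclideanSpace ℝ (Fin n))
  (w : ℕ → Ω → EuclideanSpace ℝ (Fin n)) (v : ℕ → Ω → EuclideanSpace ℝ (Fin p))
  (δ : ℕ → Ω → Bool)

lemma measurable_remoteEst_zero {𝒜 : MeasurableSpace Ω} :
    Measurable[𝒜] (sys.remoteEst S x0 w v δ 0) := by
  rw [remoteEst_zero]
  exact measurable_const

lemma measurable_control {k : ℕ} {𝒜 : MeasurableSpace Ω}
    (h : Measurable[𝒜] (sys.remoteEst S x0 w v δ k)) :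
    Measurable[𝒜] (sys.control S x0 w v δ k) :=
  ((measurable_toEuclideanLin _).comp h).neg

lemma measurable_localPred {k : ℕ} {𝒜 : MeasurableSpace Ω}
    (h : Measurable[𝒜] (sys.localEst S x0 w v δ k))
    (h' : Measurable[𝒜] (sys.control S x0 w v δ k)) :
    Measurable[𝒜] (sys.localPred S x0 w v δ k) :=
  ((measurable_toEuclideanLin _).comp h).add ((measurable_toEuclideanLin _).comp h')

lemma measurable_remoteEst_succ {k : ℕ} {𝒜 : MeasurableSpace Ω}
    (hδ : Measurable[𝒜] (δ k))
    (hs : Measurable[𝒜] (sys.localEst S x0 w v δ k))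
    (hc : Measurable[𝒜] (sys.remoteEst S x0 w v δ k)) :
    Measurable[𝒜] (sys.remoteEst S x0 w v δ (k + 1)) := by
  have hu := sys.measurable_control S x0 w v δ hc
  exact Measurable.ite (hδ (measurableSet_singleton true))
    (sys.measurable_localPred S x0 w v δ hs hu)
    (((measurable_toEuclideanLin _).comp hc).add ((measurable_toEuclideanLin _).comp hu))

lemma measurable_kalmanUpdate (k : ℕ) {𝒜 : MeasurableSpace Ω}
    {X : Ω → EuclideanSpace ℝ (Fin n)} {Y : Ω → EuclideanSpace ℝ (Fin p)}
    (hX : Measurable[𝒜] X) (hY : Measurable[𝒜] Y) :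
    Measurable[𝒜] fun ω => sys.kalmanUpdate k (X ω) (Y ω) :=
  hX.add ((measurable_toEuclideanLin _).comp (hY.sub ((measurable_toEuclideanLin _).comp hX)))

lemma schedulerInfo_mono {k l : ℕ} (h : k ≤ l) :
    sys.schedulerInfo S x0 w v δ k ≤ sys.schedulerInfo S x0 w v δ l := by
  refine sup_le_sup (sup_le_sup ?_ ?_) ?_
  · exact iSup₂_le fun i hi => le_iSup₂_of_le i (hi.trans h) le_rfl
  · exact iSup₂_le fun i hi => le_iSup₂_of_le i (hi.trans_le h) le_rfl
  · exact iSup₂_le fun i hi => le_iSup₂_of_le i (hi.trans_le h) le_rfl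

/-- This is why a law that reads the mismatch is admissible. -/
lemma measurable_schedulerInfo (k : ℕ) :
    Measurable[sys.schedulerInfo S x0 w v δ k] (sys.localEst S x0 w v δ k) ∧
    Measurable[sys.schedulerInfo S x0 w v δ k] (sys.remoteEst S x0 w v δ k) := by
  have hy : ∀ k, Measurable[sys.schedulerInfo S x0 w v δ k] (sys.output S x0 w v δ k) := fun k =>
    Measurable.of_comap_le (le_sup_of_le_left (le_sup_of_le_left (le_iSup₂_of_le k le_rfl le_rfl)))
  induction k with
  | zero =>
    exact ⟨sys.measurable_kalmanUpdate 0 measurable_const (hy 0),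
      sys.measurable_remoteEst_zero S x0 w v δ⟩
  | succ k ih =>
    have hle := sys.schedulerInfo_mono S x0 w v δ k.le_succ
    have hs := ih.1.mono hle le_rfl
    have hc := ih.2.mono hle le_rfl
    have hδ : Measurable[sys.schedulerInfo S x0 w v δ (k + 1)] (δ k) :=
      Measurable.of_comap_le (le_sup_of_le_right (le_iSup₂_of_le k k.lt_succ_self le_rfl))
    exact ⟨sys.measurable_kalmanUpdate (k + 1) (sys.measurable_localPred S x0 w v δ hs
      (sys.measurable_control S x0 w v δ hc)) (hy (k + 1)),
      sys.measurable_remoteEst_succ S x0 w v δ hδ hs hc⟩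

lemma controllerInfo_mono {k l : ℕ} (h : k ≤ l) :
    sys.controllerInfo S x0 w v δ k ≤ sys.controllerInfo S x0 w v δ l := by
  refine sup_le_sup (sup_le_sup ?_ ?_) ?_ <;>
  exact iSup₂_le fun i hi => le_iSup₂_of_le i (hi.trans_le h) le_rfl

lemma measurable_decision_controllerInfo (k : ℕ) :
    Measurable[sys.controllerInfo S x0 w v δ (k + 1)] (δ k) :=
  Measurable.of_comap_le (le_sup_of_le_right (le_iSup₂_of_le k k.lt_succ_self le_rfl))

lemma measurable_received_controllerInfo (k : ℕ) :
    Measurable[sys.controllerInfo S x0 w v δ (k + 1)] (sys.received S x0 w v δ k) :=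
  Measurable.of_comap_le
    (le_sup_of_le_left (le_sup_of_le_left (le_iSup₂_of_le k k.lt_succ_self le_rfl)))

lemma measurable_control_controllerInfo (k : ℕ) :
    Measurable[sys.controllerInfo S x0 w v δ (k + 1)] (sys.control S x0 w v δ k) :=
  Measurable.of_comap_le
    (le_sup_of_le_left (le_sup_of_le_right (le_iSup₂_of_le k k.lt_succ_self le_rfl)))

/-- The local estimate is used only when it is sent, so the recursion can be written in terms of the
message. -/
lemma remoteEst_succ_eq_received (k : ℕ) : sys.remoteEst S x0 w v δ (k + 1) = fun ω =>
    if δ k ω = true then Matrix.toEuclideanLin sys.A (sys.received S x0 w v δ k ω) +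
      Matrix.toEuclideanLin sys.B (sys.control S x0 w v δ k ω)
    else Matrix.toEuclideanLin sys.A (sys.remoteEst S x0 w v δ k ω) +
      Matrix.toEuclideanLin sys.B (sys.control S x0 w v δ k ω) := by
  ext1 ω
  rw [remoteEst_succ, received, localPred]
  cases δ k ω <;> rfl

lemma measurable_remoteEst_controllerInfo (k : ℕ) :
    Measurable[sys.controllerInfo S x0 w v δ k] (sys.remoteEst S x0 w v δ k) := by
  induction k with
  | zero => exact sys.measurable_remoteEst_zero S x0 w v δ
  | succ k ih =>
    have hc := ih.mono (sys.controllerInfo_mono S x0 w v δ k.le_succ) le_rfl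
    have hBu := (measurable_toEuclideanLin sys.B).comp
      (sys.measurable_control_controllerInfo S x0 w v δ k)
    rw [remoteEst_succ_eq_received]
    exact Measurable.ite
      (sys.measurable_decision_controllerInfo S x0 w v δ k (measurableSet_singleton true))
      (((measurable_toEuclideanLin _).comp
        (sys.measurable_received_controllerInfo S x0 w v δ k)).add hBu)
      (((measurable_toEuclideanLin _).comp hc).add hBu)

variable {S x0 w v δ} {sys}

namespace IsAdmissible

variable (hδ : sys.IsAdmissible S x0 w v δ)

include hδ

/-- Each output is a prediction computed from the past plus the new innovation. By strong induction
the whole information of the scheduler, and with it the decision, is a function of the innovations: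
scheduling and control create no information. -/
lemma measurable_innovInfo (k : ℕ) :
    Measurable[sys.innovInfo x0 w v (k + 1)] (sys.localEst S x0 w v δ k) ∧
    Measurable[sys.innovInfo x0 w v (k + 1)] (sys.remoteEst S x0 w v δ k) ∧
    Measurable[sys.innovInfo x0 w v (k + 1)] (sys.output S x0 w v δ k) ∧
    Measurable[sys.innovInfo x0 w v (k + 1)] (δ k) := by
  induction k using Nat.strong_induction_on with
  | _ k ih =>
    have hmono : ∀ {i}, i < k → sys.innovInfo x0 w v (i + 1) ≤ sys.innovInfo x0 w v (k + 1) :=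
      fun h => sys.innovInfo_mono x0 w v (by omega)
    have hinn : Measurable[sys.innovInfo x0 w v (k + 1)] (sys.innov x0 w v k) :=
      sys.measurable_innov_innovInfo x0 w v k.lt_succ_self
    have h1 : Measurable[sys.innovInfo x0 w v (k + 1)] (sys.localEst S x0 w v δ k) ∧
        Measurable[sys.innovInfo x0 w v (k + 1)] (sys.remoteEst S x0 w v δ k) ∧
        Measurable[sys.innovInfo x0 w v (k + 1)] (sys.output S x0 w v δ k) := by
      cases k with
      | zero =>
        refine ⟨?_, sys.measurable_remoteEst_zero S x0 w v δ, ?_⟩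
        · rw [funext (sys.localEst_zero_eq S x0 w v δ)]
          exact ((measurable_toEuclideanLin _).comp hinn).const_add _
        · rw [funext (sys.output_zero_eq S x0 w v δ)]
          exact hinn.const_add _
      | succ k =>
        obtain ⟨hs, hc, -, hd⟩ := ih k k.lt_succ_self
        have hle := hmono k.lt_succ_self
        have hs := hs.mono hle le_rfl
        have hc := hc.mono hle le_rfl
        have hp := sys.measurable_localPred S x0 w v δ hs (sys.measurable_control S x0 w v δ hc)
        refine ⟨?_, sys.measurable_remoteEst_succ S x0 w v δ (hd.mono hle le_rfl) hs hc, ?_⟩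
        · rw [funext (sys.localEst_succ_eq S x0 w v δ k)]
          exact hp.add ((measurable_toEuclideanLin _).comp hinn)
        · rw [funext (sys.output_succ_eq S x0 w v δ k)]
          exact ((measurable_toEuclideanLin _).comp hp).add hinn
    refine ⟨h1.1, h1.2.1, h1.2.2, (hδ k).mono ?_ le_rfl⟩
    refine sup_le (sup_le ?_ ?_) ?_
    · refine iSup₂_le fun i hi => ?_
      rcases hi.lt_or_eq with h | rfl
      · exact ((ih i h).2.2.1.mono (hmono h) le_rfl).comap_le
      · exact h1.2.2.comap_le
    · exact iSup₂_le fun i hi => ((sys.measurable_control S x0 w v δ (ih i hi).2.1).mono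
        (hmono hi) le_rfl).comap_le
    · exact iSup₂_le fun i hi => ((ih i hi).2.2.2.mono (hmono hi) le_rfl).comap_le

lemma controllerInfo_succ_le (k : ℕ) :
    sys.controllerInfo S x0 w v δ (k + 1) ≤ sys.innovInfo x0 w v (k + 1) := by
  have hmono : ∀ {i}, i < k + 1 → sys.innovInfo x0 w v (i + 1) ≤ sys.innovInfo x0 w v (k + 1) :=
    fun h => sys.innovInfo_mono x0 w v (by omega)
  refine sup_le (sup_le ?_ ?_) ?_
  · refine iSup₂_le fun i hi => ?_
    obtain ⟨hs, -, -, hd⟩ := hδ.measurable_innovInfo i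
    have : Measurable[sys.innovInfo x0 w v (i + 1)] (sys.received S x0 w v δ i) :=
      Measurable.ite (hd (measurableSet_singleton true)) hs measurable_const
    exact (this.mono (hmono hi) le_rfl).comap_le
  · exact iSup₂_le fun i hi => ((sys.measurable_control S x0 w v δ
      (hδ.measurable_innovInfo i).2.1).mono (hmono hi) le_rfl).comap_le
  · exact iSup₂_le fun i hi => ((hδ.measurable_innovInfo i).2.2.2.mono (hmono hi) le_rfl).comap_le

lemma measurable_mismatch (k : ℕ) :
    Measurable[sys.innovInfo x0 w v (k + 1)] (sys.mismatch S x0 w v δ k) :=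
  (hδ.measurable_innovInfo k).2.1.sub (hδ.measurable_innovInfo k).1

lemma measurable_mismatchDrift (k : ℕ) :
    Measurable[sys.innovInfo x0 w v (k + 1)] (sys.mismatchDrift S x0 w v δ k) := by
  have h1 : Measurable[sys.innovInfo x0 w v (k + 1)] fun ω => decisionValue (δ k ω) :=
    (measurable_from_top (f := decisionValue)).comp (hδ.measurable_innovInfo k).2.2.2
  exact (h1.const_sub 1).smul ((measurable_toEuclideanLin _).comp (hδ.measurable_mismatch k))

end IsAdmissible

end Measurability

/-! ### Second moments and finiteness of the cost. -/

section SquareIntegrable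

variable {sys : NCS n m p} {Ω : Type*} [MeasurableSpace Ω] {μ : Measure Ω} [IsProbabilityMeasure μ]
  {S : Matrix (Fin n) (Fin n) ℝ} {x0 : Ω → EuclideanSpace ℝ (Fin n)}
  {w : ℕ → Ω → EuclideanSpace ℝ (Fin n)} {v : ℕ → Ω → EuclideanSpace ℝ (Fin p)}
  {δ : ℕ → Ω → Bool}

omit [IsProbabilityMeasure μ] in
lemma _root_.memLp_toEuclideanLin {a b : ℕ} {X : Ω → EuclideanSpace ℝ (Fin a)} (hX : MemLp X 2 μ)
    (M : Matrix (Fin b) (Fin a) ℝ) : MemLp (fun ω => Matrix.toEuclideanLin M (X ω)) 2 μ :=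
  (Matrix.toEuclideanLin M).toContinuousLinearMap.comp_memLp' hX

omit [IsProbabilityMeasure μ] in
lemma _root_.integrable_quadForm {a : ℕ} {X : Ω → EuclideanSpace ℝ (Fin a)} (hX : MemLp X 2 μ)
    (M : Matrix (Fin a) (Fin a) ℝ) : Integrable (fun ω => quadForm M (X ω)) μ := by
  obtain ⟨c, _, hc⟩ := abs_quadForm_le M
  refine (((memLp_two_iff_integrable_sq_norm hX.1).1 hX).const_mul c).mono'
    ((continuous_quadForm M).comp_aestronglyMeasurable hX.1) (.of_forall fun ω => ?_)
  exact hc _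

variable (hM : sys.NoiseModel μ x0 w v) (hδ : sys.IsAdmissible S x0 w v δ)

include hM

lemma NoiseModel.memLp_correction (k : ℕ) : MemLp (sys.correction x0 w v k) 2 μ :=
  memLp_two_of_gaussian (hM.measurable_correction k) (hM.filtFacts k).map_correction

lemma NoiseModel.memLp_filtErr (k : ℕ) : MemLp (sys.filtErr x0 w v k) 2 μ :=
  memLp_two_of_gaussian (hM.measurable_filtErr k) (hM.filtFacts k).map_eq

include hδ

lemma IsAdmissible.memLp_est (k : ℕ) : MemLp (sys.localEst S x0 w v δ k) 2 μ ∧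
    MemLp (sys.remoteEst S x0 w v δ k) 2 μ := by
  induction k with
  | zero =>
    rw [funext (sys.localEst_zero_eq S x0 w v δ), remoteEst_zero]
    exact ⟨(memLp_const sys.xbar).add (hM.memLp_correction 0), memLp_const sys.xbar⟩
  | succ k ih =>
    have hu : MemLp (fun ω => sys.control S x0 w v δ k ω) 2 μ :=
      (memLp_toEuclideanLin ih.2 (sys.controlGain S)).neg
    have hp : MemLp (fun ω => sys.localPred S x0 w v δ k ω) 2 μ :=
      (memLp_toEuclideanLin ih.1 sys.A).add (memLp_toEuclideanLin hu sys.B)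
    have hq : MemLp (fun ω => Matrix.toEuclideanLin sys.A (sys.remoteEst S x0 w v δ k ω) +
        Matrix.toEuclideanLin sys.B (sys.control S x0 w v δ k ω)) 2 μ :=
      (memLp_toEuclideanLin ih.2 sys.A).add (memLp_toEuclideanLin hu sys.B)
    constructor
    · rw [funext (sys.localEst_succ_eq S x0 w v δ k)]
      exact hp.add (hM.memLp_correction (k + 1))
    · have hmeas := ((hδ.measurable_innovInfo (k + 1)).2.1.mono
        (hM.innovInfo_le _) le_rfl).aestronglyMeasurable (μ := μ)
      -- Whichever branch is taken, the estimate is dominated by the sum of the norms of both.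
      refine (hp.norm.add hq.norm).mono hmeas (.of_forall fun ω => ?_)
      rw [remoteEst_succ, Pi.add_apply, Real.norm_eq_abs, abs_of_nonneg
        (add_nonneg (norm_nonneg _) (norm_nonneg _))]
      split_ifs
      · exact le_add_of_nonneg_right (norm_nonneg _)
      · exact le_add_of_nonneg_left (norm_nonneg _)

lemma IsAdmissible.memLp_plantState (k : ℕ) : MemLp (sys.plantState S x0 w v δ k) 2 μ := by
  rw [funext (sys.plantState_eq S x0 w v δ k)]
  exact (hδ.memLp_est hM k).1.add (hM.memLp_filtErr k)

lemma IsAdmissible.memLp_control (k : ℕ) : MemLp (sys.control S x0 w v δ k) 2 μ :=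
  (memLp_toEuclideanLin (hδ.memLp_est hM k).2 _).neg

lemma IsAdmissible.memLp_mismatch (k : ℕ) : MemLp (sys.mismatch S x0 w v δ k) 2 μ :=
  (hδ.memLp_est hM k).2.sub (hδ.memLp_est hM k).1

omit [IsProbabilityMeasure μ] in
lemma IsAdmissible.measurable_decision (k : ℕ) : Measurable (δ k) :=
  (hδ.measurable_innovInfo k).2.2.2.mono (hM.innovInfo_le _) le_rfl

lemma IsAdmissible.integrable_decisionValue (k : ℕ) :
    Integrable (fun ω => decisionValue (δ k ω)) μ := by
  refine Integrable.of_bound (((measurable_from_top (f := decisionValue)).comp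
    (hδ.measurable_decision hM k)).aestronglyMeasurable) 1 (.of_forall fun ω => ?_)
  cases δ k ω <;> simp [decisionValue]

theorem IsAdmissible.integrable_runningCost (k : ℕ) :
    Integrable (sys.runningCost S x0 w v δ k) μ :=
  ((integrable_quadForm (hδ.memLp_plantState hM k) _).add
    (integrable_quadForm (hδ.memLp_control hM k) _)).add
    ((hδ.integrable_decisionValue hM k).const_mul _)

end SquareIntegrable

end NCS

/-! ### Decomposition of the running cost -/

section QuadForm

variable {n : ℕ}

lemma quadForm_matrix_add (M N : Matrix (Fin n) (Fin n) ℝ) (x : EuclideanSpace ℝ (Fin n)) :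
    quadForm (M + N) x = quadForm M x + quadForm N x := by
  simp only [quadForm_eq_inner, toEuclideanLin_add, inner_add_right]

lemma quadForm_smul (M : Matrix (Fin n) (Fin n) ℝ) (c : ℝ) (x : EuclideanSpace ℝ (Fin n)) :
    quadForm M (c • x) = c ^ 2 * quadForm M x := by
  simp only [quadForm_eq_inner, map_smul, inner_smul_left, inner_smul_right]
  simp only [conj_trivial]
  ring

lemma quadForm_add (M : Matrix (Fin n) (Fin n) ℝ) (x y : EuclideanSpace ℝ (Fin n)) :
    quadForm M (x + y) = quadForm M x + quadForm M y +
      (⟪x, Matrix.toEuclideanLin M y⟫ + ⟪Matrix.toEuclideanLin M x, y⟫) := by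
  rw [quadForm_eq_inner, quadForm_eq_inner, quadForm_eq_inner, map_add, inner_add_left,
    inner_add_right, inner_add_right, real_inner_comm y (Matrix.toEuclideanLin M x)]
  ring

lemma quadForm_add_of_symm {M : Matrix (Fin n) (Fin n) ℝ} (hM : Mᵀ = M)
    (x y : EuclideanSpace ℝ (Fin n)) :
    quadForm M (x + y) = quadForm M x + quadForm M y + 2 * ⟪x, Matrix.toEuclideanLin M y⟫ := by
  rw [quadForm_add, inner_toEuclideanLin_left, hM]
  ring

variable {Ω : Type*} [MeasurableSpace Ω] {μ : Measure Ω} {X Y : Ω → EuclideanSpace ℝ (Fin n)}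

lemma integral_inner_of_indepFun [IsFiniteMeasure μ] (hX : MemLp X 2 μ) (hY : MemLp Y 2 μ)
    (hXY : IndepFun X Y μ) : ∫ ω, ⟪X ω, Y ω⟫ ∂μ = ⟪∫ ω, X ω ∂μ, ∫ ω, Y ω ∂μ⟫ :=
  hXY.integral_bilin (hX.integrable one_le_two) (hY.integrable one_le_two) (innerSL ℝ)

lemma integrable_inner_of_memLp_two (hX : MemLp X 2 μ) (hY : MemLp Y 2 μ) :
    Integrable (fun ω => ⟪X ω, Y ω⟫) μ :=
  (hX.norm.integrable_mul hY.norm).mono' (hX.1.inner hY.1)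
    (.of_forall fun _ => norm_inner_le_norm _ _)

/-- Both cross terms vanish because Y is centred and independent of X. M is not assumed symmetric,
so they are treated separately. -/
lemma integral_quadForm_add_of_indepFun [IsFiniteMeasure μ] (hX : MemLp X 2 μ)
    (hY : MemLp Y 2 μ) (hXY : IndepFun X Y μ) (hY0 : ∫ ω, Y ω ∂μ = 0)
    (M : Matrix (Fin n) (Fin n) ℝ) :
    ∫ ω, quadForm M (X ω + Y ω) ∂μ = ∫ ω, quadForm M (X ω) ∂μ + ∫ ω, quadForm M (Y ω) ∂μ := by
  have hMY := memLp_toEuclideanLin hY M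
  have hMX := memLp_toEuclideanLin hX M
  have h1 : ∫ ω, ⟪X ω, Matrix.toEuclideanLin M (Y ω)⟫ ∂μ = 0 := by
    rw [integral_inner_of_indepFun hX hMY
      (hXY.comp measurable_id (measurable_toEuclideanLin M))]
    have := (Matrix.toEuclideanLin M).toContinuousLinearMap.integral_comp_comm
      (hY.integrable one_le_two)
    simp only [LinearMap.coe_toContinuousLinearMap'] at this
    rw [this, hY0, map_zero, inner_zero_right]
  have h2 : ∫ ω, ⟪Matrix.toEuclideanLin M (X ω), Y ω⟫ ∂μ = 0 := by
    rw [integral_inner_of_indepFun hMX hY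
      (hXY.comp (measurable_toEuclideanLin M) measurable_id), hY0, inner_zero_right]
  have i1 : Integrable (fun ω => ⟪X ω, Matrix.toEuclideanLin M (Y ω)⟫) μ :=
    integrable_inner_of_memLp_two hX hMY
  have i2 : Integrable (fun ω => ⟪Matrix.toEuclideanLin M (X ω), Y ω⟫) μ :=
    integrable_inner_of_memLp_two hMX hY
  have i3 : Integrable (fun ω => quadForm M (X ω) + quadForm M (Y ω)) μ :=
    (integrable_quadForm hX M).add (integrable_quadForm hY M)
  have i4 : Integrable (fun ω => ⟪X ω, Matrix.toEuclideanLin M (Y ω)⟫ +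
      ⟪Matrix.toEuclideanLin M (X ω), Y ω⟫) μ := i1.add i2
  simp_rw [quadForm_add]
  rw [integral_add i3 i4,
    integral_add (integrable_quadForm hX M) (integrable_quadForm hY M), integral_add i1 i2, h1, h2]
  ring

lemma integral_comp_of_indepFun [IsProbabilityMeasure μ] {E F : Type*} [MeasurableSpace E] [MeasurableSpace F]
    {X : Ω → E} {Y : Ω → F} (hX : Measurable X) (hY : Measurable Y) (hXY : IndepFun X Y μ)
    {f : E × F → ℝ} (hf : Measurable f) {b : ℝ} (hb : ∀ z, |f z| ≤ b) :
    ∫ ω, f (X ω, Y ω) ∂μ = ∫ ω, ∫ y, f (X ω, y) ∂(μ.map Y) ∂μ := by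
  have h1 := (indepFun_iff_map_prod_eq_prod_map_map hX.aemeasurable hY.aemeasurable).1 hXY
  have := Measure.isProbabilityMeasure_map (μ := μ) hX.aemeasurable
  have := Measure.isProbabilityMeasure_map (μ := μ) hY.aemeasurable
  rw [← integral_map (hX.prodMk hY).aemeasurable hf.aestronglyMeasurable, h1, integral_prod]
  · exact integral_map hX.aemeasurable
      (StronglyMeasurable.integral_prod_right (f := fun x y => f (x, y)) (ν := μ.map Y)
        hf.stronglyMeasurable).aestronglyMeasurable
  · exact Integrable.of_bound hf.aestronglyMeasurable b (.of_forall hb)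

end QuadForm

namespace NCS

variable {n m p : ℕ} {sys : NCS n m p} {S : Matrix (Fin n) (Fin n) ℝ}

/-! ### The Riccati equation and completion of squares. -/

section Riccati

variable (hR : sys.R.PosDef) (hS : sys.IsControlRiccati S)

include hS

lemma IsControlRiccati.transpose_eq : Sᵀ = S := by simpa using hS.1.isHermitian.eq

include hR

lemma IsControlRiccati.posDef_inputWeight : (sys.R + sys.Bᵀ * S * sys.B).PosDef := by
  have := hS.1.conjTranspose_mul_mul_same sys.B
  exact hR.add_posSemidef (by simpa using this)

lemma IsControlRiccati.inputWeight_mul_controlGain :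
    (sys.R + sys.Bᵀ * S * sys.B) * sys.controlGain S = sys.Bᵀ * S * sys.A := by
  have hu : IsUnit (sys.R + sys.Bᵀ * S * sys.B).det :=
    (Matrix.isUnit_iff_isUnit_det _).1 (hS.posDef_inputWeight hR).isUnit
  obtain ⟨Λ, hΛ⟩ : ∃ Λ, Λ = sys.R + sys.Bᵀ * S * sys.B := ⟨_, rfl⟩
  rw [controlGain, ← hΛ, ← Matrix.mul_assoc, ← Matrix.mul_assoc, ← Matrix.mul_assoc,
    Matrix.mul_nonsing_inv _ (hΛ ▸ hu), Matrix.one_mul]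

/-- The form Lᵀ (R + Bᵀ S B) L exhibits Σ as positive semidefinite and as the price of applying L to
a wrong state. -/
lemma IsControlRiccati.errWeight_eq : sys.errWeight S =
    (sys.controlGain S)ᵀ * (sys.R + sys.Bᵀ * S * sys.B) * sys.controlGain S := by
  have h1 : (sys.Bᵀ * S * sys.A)ᵀ = sys.Aᵀ * S * sys.B := by
    rw [Matrix.transpose_mul, Matrix.transpose_mul, hS.transpose_eq, Matrix.transpose_transpose,
      Matrix.mul_assoc]
  have hsymm : (sys.R + sys.Bᵀ * S * sys.B)ᵀ = sys.R + sys.Bᵀ * S * sys.B := by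
    simpa using (hS.posDef_inputWeight hR).isHermitian.eq
  have h2 := congrArg Matrix.transpose (hS.inputWeight_mul_controlGain hR)
  rw [Matrix.transpose_mul, h1, hsymm] at h2
  rw [h2, errWeight, controlGain]
  simp only [Matrix.mul_assoc]

lemma IsControlRiccati.posSemidef_errWeight : (sys.errWeight S).PosSemidef := by
  rw [hS.errWeight_eq hR]
  simpa using (hS.posDef_inputWeight hR).posSemidef.conjTranspose_mul_mul_same (sys.controlGain S)

/-- Completion of squares: one step of the value iteration for the control problem. -/
lemma IsControlRiccati.complete_square (x xc : EuclideanSpace ℝ (Fin n)) :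
    quadForm sys.Q x + quadForm sys.R (-Matrix.toEuclideanLin (sys.controlGain S) xc) +
      quadForm S (Matrix.toEuclideanLin sys.A x +
        Matrix.toEuclideanLin sys.B (-Matrix.toEuclideanLin (sys.controlGain S) xc)) =
    quadForm S x + quadForm (sys.errWeight S) (x - xc) := by
  obtain ⟨L, hL⟩ : ∃ L, L = sys.controlGain S := ⟨_, rfl⟩
  obtain ⟨Λ, hΛ⟩ : ∃ Λ, Λ = sys.R + sys.Bᵀ * S * sys.B := ⟨_, rfl⟩
  obtain ⟨E, hE⟩ : ∃ E, E = sys.errWeight S := ⟨_, rfl⟩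
  have hΛL : Λ * L = sys.Bᵀ * S * sys.A := by
    rw [hΛ, hL, hS.inputWeight_mul_controlGain hR]
  have hEL : E = Lᵀ * Λ * L := by rw [hE, hS.errWeight_eq hR, hL, hΛ]
  have hEsymm : Eᵀ = E := by
    simpa [hE] using (hS.posSemidef_errWeight hR).isHermitian.eq
  have hric : sys.Q + sys.Aᵀ * S * sys.A = S + E := by
    have h := hS.2
    rw [Matrix.mul_sub, Matrix.sub_mul] at h
    have hE' : sys.Aᵀ * (S * sys.B * (sys.R + sys.Bᵀ * S * sys.B)⁻¹ * sys.Bᵀ * S) * sys.A = E := by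
      rw [hE, errWeight]
      simp only [Matrix.mul_assoc]
    rw [hE'] at h
    nth_rewrite 2 [h]
    abel
  -- The terms in the control alone, in the state alone and the mixed term are matched separately
  -- with the expansion of (x - xc)ᵀ Σ (x - xc).
  have h1 : quadForm sys.R (-Matrix.toEuclideanLin L xc) +
      quadForm S (Matrix.toEuclideanLin sys.B (-Matrix.toEuclideanLin L xc)) = quadForm E xc := by
    rw [quadForm_toEuclideanLin S, ← quadForm_matrix_add, ← hΛ, quadForm_neg,
      quadForm_toEuclideanLin, ← hEL]
  have h2 : quadForm sys.Q x + quadForm S (Matrix.toEuclideanLin sys.A x) =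
      quadForm S x + quadForm E x := by
    rw [quadForm_toEuclideanLin S, ← quadForm_matrix_add, hric, quadForm_matrix_add]
  have h3 : ⟪Matrix.toEuclideanLin sys.A x, Matrix.toEuclideanLin S
      (Matrix.toEuclideanLin sys.B (-Matrix.toEuclideanLin L xc))⟫ =
      -⟪x, Matrix.toEuclideanLin E xc⟫ := by
    rw [map_neg, map_neg, inner_neg_right, inner_toEuclideanLin_left]
    congr 2
    rw [← toEuclideanLin_mul, ← toEuclideanLin_mul, ← toEuclideanLin_mul, hE, errWeight, hL,
      controlGain]
    simp only [Matrix.mul_assoc]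
  have h4 : quadForm E (x - xc) =
      quadForm E x + quadForm E xc - 2 * ⟪x, Matrix.toEuclideanLin E xc⟫ := by
    rw [sub_eq_add_neg, quadForm_add_of_symm hEsymm, quadForm_neg, map_neg, inner_neg_right]
    ring
  rw [← hL, ← hE, quadForm_add_of_symm hS.transpose_eq, h3, h4]
  linarith

end Riccati

/-! ### Expected costs along the closed loop. -/

section Expectation

variable {Ω : Type*} [MeasurableSpace Ω] {μ : Measure Ω} [IsProbabilityMeasure μ]
  {x0 : Ω → EuclideanSpace ℝ (Fin n)}
  {w : ℕ → Ω → EuclideanSpace ℝ (Fin n)} {v : ℕ → Ω → EuclideanSpace ℝ (Fin p)}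
  {δ : ℕ → Ω → Bool}
  (hM : sys.NoiseModel μ x0 w v) (hδ : sys.IsAdmissible S x0 w v δ)

include hM

lemma NoiseModel.indepFun_filtErr {k : ℕ} {E : Type*} [MeasurableSpace E] {X : Ω → E}
    (hX : Measurable[sys.innovInfo x0 w v (k + 1)] X) :
    IndepFun X (sys.filtErr x0 w v k) μ :=
  ((IndepFun_iff_Indep _ _ _).2
    (indep_of_indep_of_le_right (hM.filtFacts k).indep hX.comap_le)).symm

lemma NoiseModel.indepFun_correction {k : ℕ} {E : Type*} [MeasurableSpace E] {X : Ω → E}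
    (hX : Measurable[sys.innovInfo x0 w v k] X) :
    IndepFun X (sys.correction x0 w v k) μ :=
  (((IndepFun_iff_Indep _ _ _).2
    (indep_of_indep_of_le_right (hM.filtFacts k).indep_innov hX.comap_le)).comp
    (measurable_toEuclideanLin (sys.gain (sys.predCov k))) measurable_id).symm

lemma NoiseModel.integral_correction (k : ℕ) : ∫ ω, sys.correction x0 w v k ω ∂μ = 0 :=
  integral_eq_of_gaussian (hM.measurable_correction k) (hM.filtFacts k).map_correction

lemma NoiseModel.integral_filtErr (k : ℕ) : ∫ ω, sys.filtErr x0 w v k ω ∂μ = 0 :=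
  integral_eq_of_gaussian (hM.measurable_filtErr k) (hM.filtFacts k).map_eq

omit [IsProbabilityMeasure μ] in
lemma NoiseModel.memLp_w (k : ℕ) : MemLp (w k) 2 μ :=
  memLp_two_of_gaussian (hM.measurable_w k) (hM.map_w k)

include hδ

lemma IsAdmissible.indepFun_controlled_w (k : ℕ) :
    IndepFun (fun ω => (sys.plantState S x0 w v δ k ω, sys.remoteEst S x0 w v δ k ω)) (w k) μ := by
  have hle := sys.innovInfo_succ_le_noiseInfo x0 w v k
  refine hM.indepFun_of_noiseInfo_w (Measurable.prodMk ?_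
    ((hδ.measurable_innovInfo k).2.1.mono hle le_rfl))
  rw [funext (sys.plantState_eq S x0 w v δ k)]
  exact ((hδ.measurable_innovInfo k).1.mono hle le_rfl).add
    (sys.measurable_filtErr_noiseInfo x0 w v k)

lemma IsAdmissible.integral_quadForm_plantState_succ (k : ℕ) (M : Matrix (Fin n) (Fin n) ℝ) :
    ∫ ω, quadForm M (sys.plantState S x0 w v δ (k + 1) ω) ∂μ =
      ∫ ω, quadForm M (Matrix.toEuclideanLin sys.A (sys.plantState S x0 w v δ k ω) +
        Matrix.toEuclideanLin sys.B (sys.control S x0 w v δ k ω)) ∂μ + (M * sys.W).trace := by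
  have hφ : Measurable fun z : EuclideanSpace ℝ (Fin n) × EuclideanSpace ℝ (Fin n) =>
      Matrix.toEuclideanLin sys.A z.1 +
        Matrix.toEuclideanLin sys.B (-Matrix.toEuclideanLin (sys.controlGain S) z.2) :=
    ((measurable_toEuclideanLin _).comp measurable_fst).add ((measurable_toEuclideanLin _).comp
      ((measurable_toEuclideanLin _).comp measurable_snd).neg)
  have hind : IndepFun (fun ω => Matrix.toEuclideanLin sys.A (sys.plantState S x0 w v δ k ω) +
      Matrix.toEuclideanLin sys.B (sys.control S x0 w v δ k ω)) (w k) μ :=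
    (hδ.indepFun_controlled_w hM k).comp hφ measurable_id
  have hz : MemLp (fun ω => Matrix.toEuclideanLin sys.A (sys.plantState S x0 w v δ k ω) +
      Matrix.toEuclideanLin sys.B (sys.control S x0 w v δ k ω)) 2 μ :=
    (memLp_toEuclideanLin (hδ.memLp_plantState hM k) sys.A).add
      (memLp_toEuclideanLin (hδ.memLp_control hM k) sys.B)
  simp_rw [plantState_succ]
  rw [integral_quadForm_add_of_indepFun hz (hM.memLp_w k) hind
    (integral_eq_of_gaussian (hM.measurable_w k) (hM.map_w k)),
    integral_quadForm_of_gaussian (hM.measurable_w k) hM.posSemidef_W (hM.map_w k)]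

lemma IsAdmissible.integral_quadForm_estError (k : ℕ) (M : Matrix (Fin n) (Fin n) ℝ) :
    ∫ ω, quadForm M (sys.plantState S x0 w v δ k ω - sys.remoteEst S x0 w v δ k ω) ∂μ =
      ∫ ω, quadForm M (sys.mismatch S x0 w v δ k ω) ∂μ + (M * sys.filtCov k).trace := by
  simp_rw [plantState_sub_remoteEst]
  have he := hδ.memLp_mismatch hM k
  have hem := hδ.measurable_mismatch k
  rw [integral_quadForm_add_of_indepFun (X := fun ω => -sys.mismatch S x0 w v δ k ω) he.neg
    (hM.memLp_filtErr k) (hM.indepFun_filtErr hem.neg) (hM.integral_filtErr k),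
    integral_quadForm_of_gaussian (hM.measurable_filtErr k) (hM.filtFacts k).posSemidef
      (hM.filtFacts k).map_eq]
  simp_rw [quadForm_neg]

/-- The expected running cost, up to a telescoping term, is a cost of the mismatch. -/
lemma IsAdmissible.integral_runningCost (hR : sys.R.PosDef) (hS : sys.IsControlRiccati S) (k : ℕ) :
    ∫ ω, sys.runningCost S x0 w v δ k ω ∂μ +
      ∫ ω, quadForm S (sys.plantState S x0 w v δ (k + 1) ω) ∂μ =
    ∫ ω, quadForm S (sys.plantState S x0 w v δ k ω) ∂μ + (S * sys.W).trace +
      ((sys.errWeight S * sys.filtCov k).trace +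
        ∫ ω, quadForm (sys.errWeight S) (sys.mismatch S x0 w v δ k ω) ∂μ) +
      sys.θ * ∫ ω, decisionValue (δ k ω) ∂μ := by
  have hx := hδ.memLp_plantState hM k
  have hu := hδ.memLp_control hM k
  have hc := (hδ.memLp_est hM k).2
  have hz : MemLp (fun ω => Matrix.toEuclideanLin sys.A (sys.plantState S x0 w v δ k ω) +
      Matrix.toEuclideanLin sys.B (sys.control S x0 w v δ k ω)) 2 μ :=
    (memLp_toEuclideanLin hx sys.A).add (memLp_toEuclideanLin hu sys.B)
  have iz := integrable_quadForm hz S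
  have ix := integrable_quadForm hx S
  have ie : Integrable (fun ω => quadForm (sys.errWeight S)
      (sys.plantState S x0 w v δ k ω - sys.remoteEst S x0 w v δ k ω)) μ :=
    integrable_quadForm (hx.sub hc) (sys.errWeight S)
  have id := (hδ.integrable_decisionValue hM k).const_mul sys.θ
  have h1 : ∀ ω, sys.runningCost S x0 w v δ k ω + quadForm S
      (Matrix.toEuclideanLin sys.A (sys.plantState S x0 w v δ k ω) +
        Matrix.toEuclideanLin sys.B (sys.control S x0 w v δ k ω)) =
      quadForm S (sys.plantState S x0 w v δ k ω) + quadForm (sys.errWeight S)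
        (sys.plantState S x0 w v δ k ω - sys.remoteEst S x0 w v δ k ω) +
        sys.θ * decisionValue (δ k ω) := fun ω => by
    have := hS.complete_square hR (sys.plantState S x0 w v δ k ω) (sys.remoteEst S x0 w v δ k ω)
    rw [runningCost, control, ← this]
    ring
  have h2 := integral_congr_ae (μ := μ) (.of_forall h1)
  have h5 : Integrable (fun ω => quadForm S (sys.plantState S x0 w v δ k ω) +
      quadForm (sys.errWeight S)
        (sys.plantState S x0 w v δ k ω - sys.remoteEst S x0 w v δ k ω)) μ := ix.add ie
  rw [integral_add (hδ.integrable_runningCost hM k) iz,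
    integral_add h5 id, integral_add ix ie, integral_const_mul] at h2
  have h3 := hδ.integral_quadForm_plantState_succ hM k S
  have h4 := hδ.integral_quadForm_estError hM k (sys.errWeight S)
  rw [h4] at h2
  rw [h3]
  linarith

omit [MeasurableSpace Ω] [IsProbabilityMeasure μ] hM hδ in
lemma quadForm_mismatchDrift (k : ℕ) (ω : Ω) (M : Matrix (Fin n) (Fin n) ℝ) :
    quadForm M (sys.mismatchDrift S x0 w v δ k ω) = (1 - decisionValue (δ k ω)) *
      quadForm (sys.Aᵀ * M * sys.A) (sys.mismatch S x0 w v δ k ω) := by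
  rw [mismatchDrift, quadForm_smul, quadForm_toEuclideanLin]
  cases δ k ω <;> simp [decisionValue]

lemma IsAdmissible.memLp_mismatchDrift (k : ℕ) :
    MemLp (sys.mismatchDrift S x0 w v δ k) 2 μ := by
  refine (memLp_toEuclideanLin (hδ.memLp_mismatch hM k) sys.A).mono
    ((hδ.measurable_mismatchDrift k).mono (hM.innovInfo_le _) le_rfl).aestronglyMeasurable
    (.of_forall fun ω => ?_)
  rw [mismatchDrift]
  cases δ k ω <;> simp [decisionValue]

/-- The drift is a function of the innovations up to k and the next correction is independent of
them. The cost of the mismatch at k + 1 is thereby charged to the decision at k. -/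
lemma IsAdmissible.integral_quadForm_mismatch_succ (k : ℕ) (M : Matrix (Fin n) (Fin n) ℝ) :
    ∫ ω, quadForm M (sys.mismatch S x0 w v δ (k + 1) ω) ∂μ =
      ∫ ω, (1 - decisionValue (δ k ω)) *
        quadForm (sys.Aᵀ * M * sys.A) (sys.mismatch S x0 w v δ k ω) ∂μ +
      (M * sys.correctionCov (k + 1)).trace := by
  simp_rw [mismatch_succ, ← quadForm_mismatchDrift]
  rw [integral_quadForm_add_of_indepFun (Y := fun ω => -sys.correction x0 w v (k + 1) ω)
    (hδ.memLp_mismatchDrift hM k) (hM.memLp_correction (k + 1)).neg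
    ((hM.indepFun_correction (hδ.measurable_mismatchDrift k)).comp measurable_id measurable_neg)
    (by rw [integral_neg, hM.integral_correction, neg_zero])]
  simp_rw [quadForm_neg]
  rw [integral_quadForm_of_gaussian (hM.measurable_correction _)
    (hM.filtFacts _).posSemidef_correction (hM.filtFacts _).map_correction]

omit hδ in
lemma NoiseModel.integral_quadForm_mismatch_zero (M : Matrix (Fin n) (Fin n) ℝ) :
    ∫ ω, quadForm M (sys.mismatch S x0 w v δ 0 ω) ∂μ = (M * sys.correctionCov 0).trace := by
  simp_rw [mismatch_zero, zero_add, quadForm_neg]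
  rw [integral_quadForm_of_gaussian (hM.measurable_correction _)
    (hM.filtFacts _).posSemidef_correction (hM.filtFacts _).map_correction]

omit hδ in
lemma NoiseModel.trace_filtCov_add (M : Matrix (Fin n) (Fin n) ℝ) (k : ℕ) :
    (M * sys.filtCov k).trace + (M * sys.correctionCov k).trace = (M * sys.predCov k).trace := by
  rw [← Matrix.trace_add, ← Matrix.mul_add,
    sys.filtCov_add_correctionCov (hM.predFacts k).posSemidef (hM.posDef_innov k)]

lemma IsAdmissible.integrable_mdpCost (k : ℕ) :
    Integrable (fun ω => sys.mdpCost S (sys.mismatch S x0 w v δ k ω) (δ k ω)) μ := by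
  have h := integrable_quadForm (hδ.memLp_mismatchDrift hM k) (sys.errWeight S)
  simp_rw [quadForm_mismatchDrift] at h
  exact ((hδ.integrable_decisionValue hM k).const_mul _).add h

lemma IsAdmissible.integral_mdpCost (k : ℕ) :
    ∫ ω, sys.mdpCost S (sys.mismatch S x0 w v δ k ω) (δ k ω) ∂μ =
      sys.θ * ∫ ω, decisionValue (δ k ω) ∂μ + ∫ ω, (1 - decisionValue (δ k ω)) *
        quadForm (sys.Aᵀ * sys.errWeight S * sys.A) (sys.mismatch S x0 w v δ k ω) ∂μ := by
  have h := integrable_quadForm (hδ.memLp_mismatchDrift hM k) (sys.errWeight S)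
  simp_rw [quadForm_mismatchDrift] at h
  simp_rw [mdpCost]
  rw [integral_add ((hδ.integrable_decisionValue hM k).const_mul _) h, integral_const_mul]

/-- The total expected cost in terms of the cost of the mismatch process. -/
theorem IsAdmissible.sum_integral_runningCost (hR : sys.R.PosDef) (hS : sys.IsControlRiccati S)
    (T : ℕ) :
    ∑ k ∈ Finset.range (T + 1), ∫ ω, sys.runningCost S x0 w v δ k ω ∂μ +
      ∫ ω, quadForm S (sys.plantState S x0 w v δ (T + 1) ω) ∂μ =
    ∫ ω, quadForm S (sys.plantState S x0 w v δ 0 ω) ∂μ +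
      ∑ k ∈ Finset.range (T + 1), (S * sys.W + sys.errWeight S * sys.predCov k).trace +
      ∑ k ∈ Finset.range T, ∫ ω, sys.mdpCost S (sys.mismatch S x0 w v δ k ω) (δ k ω) ∂μ +
      sys.θ * ∫ ω, decisionValue (δ T ω) ∂μ := by
  induction T with
  -- The first mismatch is minus the first correction, so its cost completes the filtering
  -- covariance to the prediction covariance.
  | zero =>
    have h1 := hδ.integral_runningCost hM hR hS 0
    have h2 := hM.trace_filtCov_add (sys.errWeight S) 0
    rw [hM.integral_quadForm_mismatch_zero] at h1
    simp only [zero_add, Finset.range_one, Finset.sum_singleton, Finset.range_zero,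
      Finset.sum_empty, Matrix.trace_add] at h1 ⊢
    linarith
  | succ T ih =>
    have h1 := hδ.integral_runningCost hM hR hS (T + 1)
    have h2 := hM.trace_filtCov_add (sys.errWeight S) (T + 1)
    have h3 := hδ.integral_mdpCost hM T
    rw [hδ.integral_quadForm_mismatch_succ hM] at h1
    -- The lone θ δ at time T of the induction hypothesis joins the shifted mismatch cost to form
    -- the stage cost at T; θ δ at time T + 1 takes its place.
    rw [Finset.sum_range_succ, Finset.sum_range_succ _ (T + 1), Finset.sum_range_succ (fun k => ∫ ω,
      sys.mdpCost S (sys.mismatch S x0 w v δ k ω) (δ k ω) ∂μ) T, h3,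
      Matrix.trace_add (S * sys.W)]
    linarith

end Expectation

end NCS

/-! ### Gaussian kernels: standardization and continuity in the covariance -/

section GaussianKernel

variable {n : ℕ}

local notation "𝔼" => EuclideanSpace ℝ (Fin n)
local notation "γ" => stdGaussian (EuclideanSpace ℝ (Fin n))

open scoped MatrixOrder in
/-- The square root of a positive semidefinite matrix. -/
def posSemidefSqrt (M : Matrix (Fin n) (Fin n) ℝ) : Matrix (Fin n) (Fin n) ℝ := CFC.sqrt M

lemma multivariateGaussian_zero_eq_map (M : Matrix (Fin n) (Fin n) ℝ) :
    multivariateGaussian 0 M = (γ).map (Matrix.toEuclideanLin (posSemidefSqrt M)) := by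
  rw [multivariateGaussian]
  congr 1
  ext1 x
  rw [zero_add]
  rfl

lemma integral_multivariateGaussian_zero {M : Matrix (Fin n) (Fin n) ℝ} {g : 𝔼 → ℝ}
    (hg : Continuous g) (a : 𝔼) : ∫ ξ, g (a + ξ) ∂(multivariateGaussian 0 M) =
      ∫ z, g (a + Matrix.toEuclideanLin (posSemidefSqrt M) z) ∂γ := by
  rw [multivariateGaussian_zero_eq_map, integral_map (measurable_toEuclideanLin _).aemeasurable]
  exact (hg.comp (continuous_const.add continuous_id)).aestronglyMeasurable

open scoped Matrix.Norms.L2Operator MatrixOrder ComplexOrder in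
lemma sqrt_mul_sqrt_of_posSemidef {M : Matrix (Fin n) (Fin n) ℝ} (hM : M.PosSemidef) :
    posSemidefSqrt M * posSemidefSqrt M = M :=
  CFC.sqrt_mul_sqrt_self M (Matrix.nonneg_iff_posSemidef.2 hM)

open scoped Matrix.Norms.L2Operator MatrixOrder ComplexOrder in
lemma tendsto_sqrt_of_posSemidef {M : ℕ → Matrix (Fin n) (Fin n) ℝ}
    {N : Matrix (Fin n) (Fin n) ℝ} (hM : ∀ k, (M k).PosSemidef) (hN : N.PosSemidef)
    (h : Tendsto M atTop (𝓝 N)) : Tendsto (fun k => posSemidefSqrt (M k)) atTop (𝓝 (posSemidefSqrt N)) := by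
  have h1 := CFC.continuousOn_sqrt (A := Matrix (Fin n) (Fin n) ℝ) N
    (Matrix.nonneg_iff_posSemidef.2 hN)
  exact h1.tendsto.comp (tendsto_nhdsWithin_iff.2
    ⟨h, .of_forall fun k => Matrix.nonneg_iff_posSemidef.2 (hM k)⟩)

open scoped Matrix.Norms.L2Operator MatrixOrder ComplexOrder in
lemma transpose_sqrt (M : Matrix (Fin n) (Fin n) ℝ) : (posSemidefSqrt M)ᵀ = posSemidefSqrt M := by
  have h := Matrix.nonneg_iff_posSemidef.1 (CFC.sqrt_nonneg M)
  simpa [posSemidefSqrt] using h.isHermitian.eq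

lemma norm_sq_toEuclideanLin_sqrt {M : Matrix (Fin n) (Fin n) ℝ} (hM : M.PosSemidef) (e : 𝔼) :
    ‖Matrix.toEuclideanLin (posSemidefSqrt M) e‖ ^ 2 = quadForm M e := by
  rw [← real_inner_self_eq_norm_sq, inner_toEuclideanLin_left, transpose_sqrt,
    ← toEuclideanLin_mul, sqrt_mul_sqrt_of_posSemidef hM, quadForm_eq_inner]

/-- The square root of a positive definite matrix as an equivalence. -/
lemma exists_equiv_toEuclideanLin_sqrt {M : Matrix (Fin n) (Fin n) ℝ} (hM : M.PosDef) :
    ∃ T : 𝔼 ≃L[ℝ] 𝔼, ∀ z, T z = Matrix.toEuclideanLin (posSemidefSqrt M) z := by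
  have hinj : Function.Injective (Matrix.toEuclideanLin (posSemidefSqrt M)) := by
    rw [injective_iff_map_eq_zero]
    intro z hz
    by_contra hne
    have h1 := norm_sq_toEuclideanLin_sqrt hM.posSemidef z
    rw [hz, norm_zero] at h1
    have h2 := hM.dotProduct_mulVec_pos (x := z.ofLp) (by
      intro h
      exact hne (by ext i; simp [h]))
    simp only [star_trivial] at h2
    rw [quadForm] at h1
    norm_num at h1
    linarith
  refine ⟨(LinearEquiv.ofInjectiveEndo _ hinj).toContinuousLinearEquiv, fun z => rfl⟩

lemma integrable_norm_stdGaussian : Integrable (fun z : 𝔼 => ‖z‖) γ :=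
  (IsGaussian.memLp_two_id.integrable one_le_two).norm

/-- Smoothing by Gaussian kernels is continuous in the covariance, uniformly in the base point. -/
lemma eventually_abs_integral_gaussian_sub_le {M : ℕ → Matrix (Fin n) (Fin n) ℝ}
    {N : Matrix (Fin n) (Fin n) ℝ} (hM : ∀ k, (M k).PosSemidef) (hN : N.PosSemidef)
    (hlim : Tendsto M atTop (𝓝 N)) {g : 𝔼 → ℝ} (hg : UniformContinuous g) {b : ℝ}
    (hb : ∀ e, |g e| ≤ b) {η : ℝ} (hη : 0 < η) :
    ∀ᶠ k in atTop, ∀ a, |∫ ξ, g (a + ξ) ∂(multivariateGaussian 0 (M k)) -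
      ∫ ξ, g (a + ξ) ∂(multivariateGaussian 0 N)| ≤ η := by
  obtain ⟨r, hr, hgr⟩ := Metric.uniformContinuous_iff.1 hg (η / 2) (half_pos hη)
  have hb0 : 0 ≤ b := (abs_nonneg _).trans (hb 0)
  obtain ⟨Φ, hΦ⟩ : ∃ Φ : Matrix (Fin n) (Fin n) ℝ →ₗ[ℝ] 𝔼 →L[ℝ] 𝔼, ∀ R z,
      Φ R z = Matrix.toEuclideanLin R z :=
    ⟨(LinearMap.toContinuousLinearMap.toLinearMap).comp
      (Matrix.toEuclideanLin (𝕜 := ℝ) (m := Fin n) (n := Fin n)).toLinearMap, fun R z => rfl⟩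
  have hΦc : Continuous Φ := LinearMap.continuous_of_finiteDimensional _
  obtain ⟨c, hc⟩ : ∃ c, c = ∫ z : 𝔼, ‖z‖ ∂γ := ⟨_, rfl⟩
  have h1 : Tendsto (fun k => 2 * b / r * (‖Φ (posSemidefSqrt (M k)) - Φ (posSemidefSqrt N)‖ * c)) atTop
      (𝓝 (2 * b / r * (‖Φ (posSemidefSqrt N) - Φ (posSemidefSqrt N)‖ * c))) :=
    ((((hΦc.tendsto _).comp (tendsto_sqrt_of_posSemidef hM hN hlim)).sub_const _).norm.mul_const
      c).const_mul _
  rw [sub_self, norm_zero, zero_mul, mul_zero] at h1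
  filter_upwards [h1.eventually (gt_mem_nhds (half_pos hη))] with k hk a
  rw [integral_multivariateGaussian_zero hg.continuous,
    integral_multivariateGaussian_zero hg.continuous]
  have hi : ∀ R : Matrix (Fin n) (Fin n) ℝ,
      Integrable (fun z : 𝔼 => g (a + Matrix.toEuclideanLin R z)) γ := fun R =>
    Integrable.of_bound (hg.continuous.comp
      (continuous_const.add (continuous_toEuclideanLin R))).aestronglyMeasurable b
      (.of_forall fun _ => hb _)
  rw [← integral_sub (hi _) (hi _)]
  -- Points closer than r are handled by uniform continuity; otherwise the trivial bound 2 b is at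
  -- most 2 b / r times the distance. Neither estimate involves the base point a.
  have hpt : ∀ z : 𝔼, |g (a + Matrix.toEuclideanLin (posSemidefSqrt (M k)) z) -
      g (a + Matrix.toEuclideanLin (posSemidefSqrt N) z)| ≤
      η / 2 + 2 * b / r * (‖Φ (posSemidefSqrt (M k)) - Φ (posSemidefSqrt N)‖ * ‖z‖) := by
    intro z
    have hle := (Φ (posSemidefSqrt (M k)) - Φ (posSemidefSqrt N)).le_opNorm z
    rw [_root_.sub_apply, hΦ, hΦ] at hle
    rcases lt_or_ge ‖Matrix.toEuclideanLin (posSemidefSqrt (M k)) z -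
      Matrix.toEuclideanLin (posSemidefSqrt N) z‖ r with h | h
    · have h2 := hgr (a := a + Matrix.toEuclideanLin (posSemidefSqrt (M k)) z)
        (b := a + Matrix.toEuclideanLin (posSemidefSqrt N) z) (by
          rwa [dist_eq_norm, add_sub_add_left_eq_sub])
      rw [Real.dist_eq] at h2
      have : 0 ≤ 2 * b / r * (‖Φ (posSemidefSqrt (M k)) - Φ (posSemidefSqrt N)‖ * ‖z‖) := by positivity
      linarith
    · have h2 := (abs_sub _ _).trans (add_le_add (hb (a + Matrix.toEuclideanLin (posSemidefSqrt (M k)) z))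
        (hb (a + Matrix.toEuclideanLin (posSemidefSqrt N) z)))
      have h3 : 2 * b / r * r ≤
          2 * b / r * (‖Φ (posSemidefSqrt (M k)) - Φ (posSemidefSqrt N)‖ * ‖z‖) :=
        mul_le_mul_of_nonneg_left (h.trans hle) (by positivity)
      rw [div_mul_cancel₀ _ hr.ne'] at h3
      linarith
  have hint : Integrable (fun z : 𝔼 =>
      η / 2 + 2 * b / r * (‖Φ (posSemidefSqrt (M k)) - Φ (posSemidefSqrt N)‖ * ‖z‖)) γ :=
    (integrable_const _).add ((integrable_norm_stdGaussian.const_mul _).const_mul _)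
  refine (abs_integral_le_integral_abs).trans ((integral_mono ((hi _).sub (hi _)).abs hint
    hpt).trans ?_)
  rw [integral_add (integrable_const _) ((integrable_norm_stdGaussian.const_mul _).const_mul _),
    integral_const_mul, integral_const_mul, ← hc, integral_const, probReal_univ, one_smul]
  linarith

end GaussianKernel

namespace NCS

variable {n m p : ℕ} {sys : NCS n m p} {S Ps : Matrix (Fin n) (Fin n) ℝ}

/-! ### Convergence of the filter covariances. -/

section SteadyState

lemma _root_.tendsto_matrix_inv {N : ℕ → Matrix (Fin p) (Fin p) ℝ} {N' : Matrix (Fin p) (Fin p) ℝ}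
    (hN : Tendsto N atTop (𝓝 N')) (hdet : N'.det ≠ 0) :
    Tendsto (fun k => (N k)⁻¹) atTop (𝓝 N'⁻¹) := by
  have hd : Continuous fun N : Matrix (Fin p) (Fin p) ℝ => N.det := continuous_id.matrix_det
  have ha : Continuous fun N : Matrix (Fin p) (Fin p) ℝ => N.adjugate :=
    continuous_id.matrix_adjugate
  have h1 := (hd.tendsto N').comp hN
  have h2 := (ha.tendsto N').comp hN
  have h3 := (h1.inv₀ hdet).smul h2
  simp_rw [Matrix.inv_def, Ring.inverse_eq_inv']
  exact h3

lemma _root_.tendsto_mul_transpose_mul_inv {M : ℕ → Matrix (Fin n) (Fin n) ℝ}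
    {M' : Matrix (Fin n) (Fin n) ℝ} {C : Matrix (Fin p) (Fin n) ℝ}
    {N : ℕ → Matrix (Fin p) (Fin p) ℝ} {N' : Matrix (Fin p) (Fin p) ℝ}
    (hM : Tendsto M atTop (𝓝 M')) (hN : Tendsto N atTop (𝓝 N')) (hdet : N'.det ≠ 0) :
    Tendsto (fun k => M k * Cᵀ * (N k)⁻¹) atTop (𝓝 (M' * Cᵀ * N'⁻¹)) := by
  have h1 : Continuous fun q : Matrix (Fin n) (Fin n) ℝ × Matrix (Fin p) (Fin p) ℝ =>
    q.1 * Cᵀ * q.2 := by fun_prop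
  have h2 := (h1.tendsto (M', N'⁻¹)).comp (hM.prodMk_nhds (tendsto_matrix_inv hN hdet))
  exact h2

lemma _root_.tendsto_mul_mul_transpose {G : ℕ → Matrix (Fin n) (Fin p) ℝ}
    {G' : Matrix (Fin n) (Fin p) ℝ}
    {N : ℕ → Matrix (Fin p) (Fin p) ℝ} {N' : Matrix (Fin p) (Fin p) ℝ}
    (hG : Tendsto G atTop (𝓝 G')) (hN : Tendsto N atTop (𝓝 N')) :
    Tendsto (fun k => G k * N k * (G k)ᵀ) atTop (𝓝 (G' * N' * G'ᵀ)) := by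
  have h1 : Continuous fun q : Matrix (Fin n) (Fin p) ℝ × Matrix (Fin p) (Fin p) ℝ =>
    q.1 * q.2 * q.1ᵀ := by fun_prop
  have h2 := (h1.tendsto (G', N')).comp (hG.prodMk_nhds hN)
  exact h2

lemma tendsto_predCov (hPs : Tendsto sys.filtCov atTop (𝓝 Ps)) :
    Tendsto sys.predCov atTop (𝓝 (sys.timeUpdate Ps)) := by
  rw [← tendsto_add_atTop_iff_nat 1]
  have hc : Continuous sys.timeUpdate := by
    unfold timeUpdate
    fun_prop
  exact (hc.tendsto Ps).comp hPs

/-- Invertibility of the limiting innovation covariance makes the gain continuous there, so the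
noise of the mismatch approaches Ξ. -/
lemma tendsto_correctionCov (hPs : Tendsto sys.filtCov atTop (𝓝 Ps))
    (hinn : (sys.C * sys.timeUpdate Ps * sys.Cᵀ + sys.V).PosDef) :
    Tendsto sys.correctionCov atTop (𝓝 (sys.mismatchCov Ps)) := by
  have hdet : (sys.C * sys.timeUpdate Ps * sys.Cᵀ + sys.V).det ≠ 0 := hinn.det_pos.ne'
  have hM := tendsto_predCov hPs
  have hc : Continuous fun M : Matrix (Fin n) (Fin n) ℝ => sys.C * M * sys.Cᵀ + sys.V := by
    fun_prop
  have hN := (hc.tendsto _).comp hM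
  have hg := tendsto_mul_transpose_mul_inv (C := sys.C) hM hN hdet
  exact tendsto_mul_mul_transpose hg hN

end SteadyState

/-! ### Translation between the matrix problem and the abstract Bellman equation. -/

section DifferentialCost

local notation "𝔼" => EuclideanSpace ℝ (Fin n)

lemma integral_transition {h : 𝔼 → ℝ} (hc : Continuous h) (e : 𝔼) (d : Bool) :
    ∫ y, h y ∂(sys.transition Ps e d) = ∫ ξ,
      h ((1 - decisionValue d) • Matrix.toEuclideanLin sys.A e + ξ) ∂(sys.mismatchNoise Ps) := by
  rw [transition, integral_map (by fun_prop) hc.aestronglyMeasurable]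

/-- The data of the mismatch process in standardized form. -/
lemma exists_standardization (hE : (sys.errWeight S).PosSemidef)
    (hXi : (sys.mismatchCov Ps).PosDef) :
    ∃ (A H : 𝔼 →L[ℝ] 𝔼) (T : 𝔼 ≃L[ℝ] 𝔼), (∀ e, A e = Matrix.toEuclideanLin sys.A e) ∧
      (∀ e, ‖H e‖ ^ 2 = quadForm (sys.Aᵀ * sys.errWeight S * sys.A) e) ∧
      ∀ g : 𝔼 → ℝ, Continuous g → ∀ a,
        gaussAvg T g a = ∫ ξ, g (a + ξ) ∂(sys.mismatchNoise Ps) := by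
  have hq : (sys.Aᵀ * sys.errWeight S * sys.A).PosSemidef := by
    simpa using hE.conjTranspose_mul_mul_same sys.A
  obtain ⟨T, hT⟩ := exists_equiv_toEuclideanLin_sqrt hXi
  refine ⟨(Matrix.toEuclideanLin sys.A).toContinuousLinearMap,
    (Matrix.toEuclideanLin (posSemidefSqrt (sys.Aᵀ * sys.errWeight S * sys.A))).toContinuousLinearMap,
    T, fun e => rfl, fun e => norm_sq_toEuclideanLin_sqrt hq e, fun g hg a => ?_⟩
  rw [mismatchNoise, integral_multivariateGaussian_zero hg, gaussAvg]
  simp_rw [hT]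

variable {A H : EuclideanSpace ℝ (Fin n) →L[ℝ] EuclideanSpace ℝ (Fin n)}
  {T : EuclideanSpace ℝ (Fin n) ≃L[ℝ] EuclideanSpace ℝ (Fin n)}
  (hA : ∀ e, A e = Matrix.toEuclideanLin sys.A e)
  (hH : ∀ e, ‖H e‖ ^ 2 = quadForm (sys.Aᵀ * sys.errWeight S * sys.A) e)
  (hT : ∀ g : EuclideanSpace ℝ (Fin n) → ℝ, Continuous g → ∀ a,
    gaussAvg T g a = ∫ ξ, g (a + ξ) ∂(sys.mismatchNoise Ps))

include hA hH hT

lemma bellman_iff {h : 𝔼 → ℝ} (hc : Continuous h) (j : ℝ) (e : 𝔼) :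
    (j + h e = min (sys.mdpCost S e false + ∫ y, h y ∂(sys.transition Ps e false))
      (sys.mdpCost S e true + ∫ y, h y ∂(sys.transition Ps e true))) ↔
    j + h e = min (‖H e‖ ^ 2 + gaussAvg T h (A e)) (sys.θ + gaussAvg T h 0) := by
  rw [integral_transition hc, integral_transition hc, ← hT h hc, ← hT h hc, hH, hA]
  simp [mdpCost, decisionValue]

lemma exists_isDifferentialCost_of_standardization (hθ : 0 ≤ sys.θ) :
    ∃ (h : 𝔼 → ℝ) (j : ℝ), sys.IsDifferentialCost S Ps h j := by
  obtain ⟨h, j, b, hc, hb, h0, heq⟩ := exists_average_cost_solution A H T hθ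
  exact ⟨h, j, hc, ⟨b, hb⟩, h0, fun e => (bellman_iff hA hH hT hc j e).2 (heq e)⟩

lemma IsDifferentialCost.solvesAverageCost {h : 𝔼 → ℝ} {j : ℝ}
    (hd : sys.IsDifferentialCost S Ps h j) : ∃ b, SolvesAverageCost A H T sys.θ j b h := by
  obtain ⟨b, hb⟩ := hd.bounded
  exact ⟨b, hd.continuous, hb, fun e => (bellman_iff hA hH hT hd.continuous j e).1 (hd.bellman e)⟩

end DifferentialCost

end NCS

/-! ### Stationary feedback scheduling and the conditional mean of the state -/

section Symmetry

variable {n : ℕ} {P : Matrix (Fin n) (Fin n) ℝ}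

open scoped ENNReal

lemma lintegral_neg_multivariateGaussian_zero {g : EuclideanSpace ℝ (Fin n) → ℝ≥0∞}
    (hg : Measurable g) :
    ∫⁻ y, g (-y) ∂(multivariateGaussian 0 P) = ∫⁻ y, g y ∂(multivariateGaussian 0 P) := by
  rw [multivariateGaussian_zero_eq_map, lintegral_map hg (measurable_toEuclideanLin _),
    lintegral_map (f := fun y => g (-y)) (hg.comp measurable_neg) (measurable_toEuclideanLin _)]
  have h := lintegral_map (μ := stdGaussian (EuclideanSpace ℝ (Fin n)))
    (hg.comp (measurable_toEuclideanLin (posSemidefSqrt P))) measurable_neg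
  rw [map_neg_stdGaussian] at h
  simpa only [Function.comp_apply, map_neg] using h.symm

/-- Fubini on an event of m: the indicator of F is carried as an extra coordinate alongside X, and
the pair is independent of Y. -/
lemma setLIntegral_add_of_indep {Ω : Type*} {m mΩ : MeasurableSpace Ω} {μ : Measure Ω}
    [IsProbabilityMeasure μ] (hm : m ≤ mΩ) {F : Set Ω}
    (hF : MeasurableSet[m] F) {X Y : Ω → EuclideanSpace ℝ (Fin n)} (hX : Measurable[m] X)
    (hY : Measurable Y) (hYm : Indep (MeasurableSpace.comap Y inferInstance) m μ)
    {g : EuclideanSpace ℝ (Fin n) → ℝ≥0∞} (hg : Measurable g) :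
    ∫⁻ ω in F, g (X ω + Y ω) ∂μ = ∫⁻ ω in F, ∫⁻ y, g (X ω + y) ∂(μ.map Y) ∂μ := by
  classical
  have hφ : Measurable[m] (F.indicator fun _ => (1 : ℝ≥0∞)) := measurable_const.indicator hF
  have hZ : Measurable[m] fun ω => (F.indicator (fun _ => (1 : ℝ≥0∞)) ω, X ω) := hφ.prodMk hX
  have hind : IndepFun (fun ω => (F.indicator (fun _ => (1 : ℝ≥0∞)) ω, X ω)) Y μ :=
    ((IndepFun_iff_Indep _ _ _).2 (indep_of_indep_of_le_right hYm hZ.comap_le)).symm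
  have hZ' := hZ.mono hm le_rfl
  have := Measure.isProbabilityMeasure_map (μ := μ) hY.aemeasurable
  have hf : Measurable fun z : (ℝ≥0∞ × EuclideanSpace ℝ (Fin n)) × EuclideanSpace ℝ (Fin n) =>
      z.1.1 * g (z.1.2 + z.2) := by fun_prop
  have h1 := (indepFun_iff_map_prod_eq_prod_map_map hZ'.aemeasurable hY.aemeasurable).1 hind
  have h2 := lintegral_map (μ := μ) hf (hZ'.prodMk hY)
  rw [h1, lintegral_prod _ hf.aemeasurable, lintegral_map hf.lintegral_prod_right' hZ'] at h2
  rw [← lintegral_indicator (hm _ hF), ← lintegral_indicator (hm _ hF)]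
  refine Eq.trans (lintegral_congr fun ω => ?_) (h2.symm.trans (lintegral_congr fun ω => ?_))
  · by_cases hω : ω ∈ F <;> simp [hω]
  · by_cases hω : ω ∈ F <;> simp [hω]

end Symmetry

namespace NCS

variable {n m p : ℕ} {sys : NCS n m p} {Ω : Type*}
  {S : Matrix (Fin n) (Fin n) ℝ} {x0 : Ω → EuclideanSpace ℝ (Fin n)}
  {w : ℕ → Ω → EuclideanSpace ℝ (Fin n)} {v : ℕ → Ω → EuclideanSpace ℝ (Fin p)}
  {δ : ℕ → Ω → Bool}

/-! ### Stationary laws that read the mismatch. -/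

section Feedback

variable (sys S x0 w v)

/-- The closed loop under the stationary scheduling law that decides by `π` from the mismatch. -/
def feedbackLoop (π : EuclideanSpace ℝ (Fin n) → Bool) (ω : Ω) : ℕ → LoopState n
  | 0 =>
    { x := x0 ω
      xs := sys.kalmanUpdate 0 sys.xbar (Matrix.toEuclideanLin sys.C (x0 ω) + v 0 ω)
      xc := sys.xbar }
  | k + 1 =>
    let s := feedbackLoop π ω k
    let Bu := Matrix.toEuclideanLin sys.B (-Matrix.toEuclideanLin (sys.controlGain S) s.xc)
    let x' := Matrix.toEuclideanLin sys.A s.x + Bu + w k ω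
    { x := x'
      xs := sys.kalmanUpdate (k + 1) (Matrix.toEuclideanLin sys.A s.xs + Bu)
        (Matrix.toEuclideanLin sys.C x' + v (k + 1) ω)
      xc := if π (s.xc - s.xs) then Matrix.toEuclideanLin sys.A s.xs + Bu
        else Matrix.toEuclideanLin sys.A s.xc + Bu }

/-- The condition is circular, since the mismatch depends on earlier decisions. Running the
recursion with π built in and reading off the decisions resolves it. -/
lemma exists_feedback_decisions (π : EuclideanSpace ℝ (Fin n) → Bool) :
    ∃ δ : ℕ → Ω → Bool, ∀ k ω, δ k ω = π (sys.mismatch S x0 w v δ k ω) := by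
  obtain ⟨δ, hδ⟩ : ∃ δ : ℕ → Ω → Bool, ∀ k ω, δ k ω =
      π ((sys.feedbackLoop S x0 w v π ω k).xc - (sys.feedbackLoop S x0 w v π ω k).xs) :=
    ⟨_, fun _ _ => rfl⟩
  have h : ∀ ω k, sys.loop S x0 w v δ ω k = sys.feedbackLoop S x0 w v π ω k := by
    intro ω k
    induction k with
    | zero => rfl
    | succ k ih => rw [loop, feedbackLoop, ih, hδ]
  refine ⟨δ, fun k ω => ?_⟩
  rw [hδ, mismatch, remoteEst, localEst, h]

variable {sys S x0 w v}

lemma isAdmissible_of_feedback {π : EuclideanSpace ℝ (Fin n) → Bool} (hπ : Measurable π)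
    (hδ : ∀ k ω, δ k ω = π (sys.mismatch S x0 w v δ k ω)) : sys.IsAdmissible S x0 w v δ := by
  intro k
  have h := sys.measurable_schedulerInfo S x0 w v δ k
  rw [funext (hδ k)]
  exact hπ.comp (h.2.sub h.1)

end Feedback

/-- On silence nothing new is learned: the message is the constant 0, the decision is constant, and
the control is a function of the old remote estimate. So the new information has the same trace on
the silent event as the old. -/
lemma exists_measurableSet_inter_silent {k : ℕ} {F : Set Ω}
    (hF : MeasurableSet[sys.controllerInfo S x0 w v δ (k + 1)] F) :
    ∃ F', MeasurableSet[sys.controllerInfo S x0 w v δ k] F' ∧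
      F ∩ {ω | δ k ω = false} = F' ∩ {ω | δ k ω = false} := by
  -- Pulling back along the inclusion of the silent event turns equality of traces into
  -- measurability of the generators after composition with V.
  obtain ⟨V, hV⟩ : ∃ V : {ω | δ k ω = false} → Ω, V = Subtype.val := ⟨_, rfl⟩
  have hVδ : ∀ a, δ k (V a) = false := fun a => by rw [hV]; exact a.2
  have hVm : ∀ {E : Type _} [MeasurableSpace E] {f : Ω → E},
      Measurable[sys.controllerInfo S x0 w v δ k] f →
      Measurable[(sys.controllerInfo S x0 w v δ k).comap V] (f ∘ V) := fun hf =>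
    hf.comp (comap_measurable V)
  have hle : sys.controllerInfo S x0 w v δ (k + 1) ≤
      ((sys.controllerInfo S x0 w v δ k).comap V).map V := by
    refine sup_le (sup_le ?_ ?_) ?_
    · refine iSup₂_le fun i hi => Measurable.comap_le (f := sys.received S x0 w v δ i) ?_
      rcases Nat.lt_succ_iff_lt_or_eq.1 hi with h | rfl
      · exact hVm ((sys.measurable_received_controllerInfo S x0 w v δ i).mono
          (sys.controllerInfo_mono S x0 w v δ h) le_rfl)
      · have h0 : sys.received S x0 w v δ i ∘ V = fun _ => 0 := by
          ext1 a
          simp [received, hVδ]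
        have h1 : Measurable[(sys.controllerInfo S x0 w v δ i).comap V]
            (sys.received S x0 w v δ i ∘ V) := by
          rw [h0]
          exact measurable_const
        exact h1
    · refine iSup₂_le fun i hi => Measurable.comap_le (f := sys.control S x0 w v δ i) ?_
      exact hVm (sys.measurable_control S x0 w v δ
        ((sys.measurable_remoteEst_controllerInfo S x0 w v δ i).mono
          (sys.controllerInfo_mono S x0 w v δ (Nat.lt_succ_iff.1 hi)) le_rfl))
    · refine iSup₂_le fun i hi => Measurable.comap_le (f := δ i) ?_
      rcases Nat.lt_succ_iff_lt_or_eq.1 hi with h | rfl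
      · exact hVm ((sys.measurable_decision_controllerInfo S x0 w v δ i).mono
          (sys.controllerInfo_mono S x0 w v δ h) le_rfl)
      · have h1 : Measurable[(sys.controllerInfo S x0 w v δ i).comap V] (δ i ∘ V) := by
          rw [show δ i ∘ V = fun _ => false from funext hVδ]
          exact measurable_const
        exact h1
  obtain ⟨F', hF', hFF'⟩ := hle F hF
  refine ⟨F', hF', ?_⟩
  ext ω
  simp only [Set.mem_inter_iff, Set.mem_ofPred_eq]
  refine and_congr_left fun hω => ?_
  have := Set.ext_iff.1 hFF' ⟨ω, hω⟩
  simpa [hV] using this.symm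

/-! ### Symmetry of the mismatch given the remote information. -/

section CondMean

variable [MeasurableSpace Ω] {μ : Measure Ω} [IsProbabilityMeasure μ]
  (hM : sys.NoiseModel μ x0 w v)

include hM

open scoped ENNReal

/-- The correction is symmetric and independent of both F and X. Integrating it out leaves a test
function of X alone, to which the symmetry of X on F applies. -/
lemma NoiseModel.setLIntegral_neg_of_symmetric {k : ℕ} {F : Set Ω}
    (hF : MeasurableSet[sys.innovInfo x0 w v k] F) {X : Ω → EuclideanSpace ℝ (Fin n)}
    (hX : Measurable[sys.innovInfo x0 w v k] X)
    (hsymm : ∀ g : EuclideanSpace ℝ (Fin n) → ℝ≥0∞, Measurable g →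
      ∫⁻ ω in F, g (-X ω) ∂μ = ∫⁻ ω in F, g (X ω) ∂μ)
    {g : EuclideanSpace ℝ (Fin n) → ℝ≥0∞} (hg : Measurable g) :
    ∫⁻ ω in F, g (-(X ω + -sys.correction x0 w v k ω)) ∂μ =
      ∫⁻ ω in F, g (X ω + -sys.correction x0 w v k ω) ∂μ := by
  have hn := hM.measurable_correction k
  have hl := (hM.filtFacts k).map_correction
  have hle := hM.innovInfo_le k
  have hind : Indep (MeasurableSpace.comap (sys.correction x0 w v k) inferInstance)
      (sys.innovInfo x0 w v k) μ := by
    refine indep_of_indep_of_le_left (hM.filtFacts k).indep_innov ?_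
    exact ((measurable_toEuclideanLin _).comp (comap_measurable (sys.innov x0 w v k))).comap_le
  obtain ⟨G, hG⟩ : ∃ G : EuclideanSpace ℝ (Fin n) → ℝ≥0∞, G = fun x =>
    ∫⁻ y, g (x + y) ∂(multivariateGaussian 0 (sys.correctionCov k)) := ⟨_, rfl⟩
  have hGm : Measurable G := by
    rw [hG]
    exact Measurable.lintegral_prod_right' (f := fun z : EuclideanSpace ℝ (Fin n) ×
      EuclideanSpace ℝ (Fin n) => g (z.1 + z.2)) (by fun_prop)
  have hneg : ∀ x, ∫⁻ y, g (x + -y) ∂(multivariateGaussian 0 (sys.correctionCov k)) = G x :=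
    fun x => by
      rw [hG]
      exact lintegral_neg_multivariateGaussian_zero (g := fun y => g (x + y)) (by fun_prop)
  have h2 : ∫⁻ ω in F, g (-(X ω + -sys.correction x0 w v k ω)) ∂μ =
      ∫⁻ ω in F, G (-X ω) ∂μ := by
    have h4 := setLIntegral_add_of_indep hle hF hX.neg hn hind hg
    rw [hl] at h4
    rw [hG]
    refine Eq.trans (lintegral_congr fun ω => ?_) h4
    simp [add_comm]
  have h5 : ∫⁻ ω in F, g (X ω + -sys.correction x0 w v k ω) ∂μ = ∫⁻ ω in F, G (X ω) ∂μ := by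
    have h4 := setLIntegral_add_of_indep hle hF hX.neg hn hind
      (g := fun x => g (-x)) (by fun_prop)
    rw [hl] at h4
    refine Eq.trans (lintegral_congr fun ω => ?_) (h4.trans (lintegral_congr fun ω => ?_))
    · simp [add_comm]
    · rw [← hneg]
      simp [add_comm]
  rw [h2, h5, hsymm G hGm]

/-- Under a symmetric stationary scheduling law the mismatch is symmetric given the information of
the controller. -/
lemma NoiseModel.setLIntegral_neg_mismatch {π : EuclideanSpace ℝ (Fin n) → Bool}
    (hπ : Measurable π) (hπs : ∀ e, π (-e) = π e)
    (hδ : ∀ k ω, δ k ω = π (sys.mismatch S x0 w v δ k ω)) (k : ℕ) :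
    ∀ F, MeasurableSet[sys.controllerInfo S x0 w v δ k] F →
    ∀ g : EuclideanSpace ℝ (Fin n) → ℝ≥0∞, Measurable g →
      ∫⁻ ω in F, g (-sys.mismatch S x0 w v δ k ω) ∂μ =
        ∫⁻ ω in F, g (sys.mismatch S x0 w v δ k ω) ∂μ := by
  have hadm := isAdmissible_of_feedback hπ hδ
  induction k with
  | zero =>
    intro F hF g hg
    have hle : sys.controllerInfo S x0 w v δ 0 ≤ sys.innovInfo x0 w v 0 := by
      simp [controllerInfo]
    simp_rw [mismatch_zero]
    exact hM.setLIntegral_neg_of_symmetric (X := fun _ => 0) (hle F hF) measurable_const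
      (fun g _ => by simp) hg
  | succ k ih =>
    intro F hF g hg
    simp_rw [mismatch_succ]
    have hF1 := hadm.controllerInfo_succ_le k F hF
    refine hM.setLIntegral_neg_of_symmetric hF1 (hadm.measurable_mismatchDrift k)
      (fun G hG => ?_) hg
    obtain ⟨F', hF', hFF'⟩ := exists_measurableSet_inter_silent hF
    have hD : MeasurableSet {ω | δ k ω = false} :=
      (((hadm.measurable_innovInfo k).2.2.2.mono (hM.innovInfo_le _) le_rfl)
        (measurableSet_singleton false))
    rw [← lintegral_inter_add_sdiff _ F hD, ← lintegral_inter_add_sdiff _ F hD]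
    congr 1
    · rw [hFF', Set.inter_comm F', ← Measure.restrict_restrict hD,
        ← lintegral_indicator hD, ← lintegral_indicator hD]
      -- The silent event is a function of e, so it is absorbed into the test function. This event
      -- is invariant under e ↦ -e because π is even, which is the only use of evenness. After a
      -- transmission the drift is 0 and nothing is to be shown.
      obtain ⟨f, hf⟩ : ∃ f : EuclideanSpace ℝ (Fin n) → ℝ≥0∞, f = fun e =>
        if π e = false then G (Matrix.toEuclideanLin sys.A e) else 0 := ⟨_, rfl⟩
      have hfm : Measurable f := by
        rw [hf]
        exact Measurable.ite (hπ (measurableSet_singleton false))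
          (hG.comp (measurable_toEuclideanLin _)) measurable_const
      have h := ih F' hF' f hfm
      have hdrift : ∀ ω, δ k ω = false → sys.mismatchDrift S x0 w v δ k ω =
          Matrix.toEuclideanLin sys.A (sys.mismatch S x0 w v δ k ω) := fun ω h0 => by
        simp [mismatchDrift, decisionValue, h0]
      refine Eq.trans (lintegral_congr fun ω => ?_) (h.trans (lintegral_congr fun ω => ?_))
      · by_cases h0 : δ k ω = false
        · rw [Set.indicator_of_mem (by exact h0), hdrift ω h0, hf]
          simp [hπs, ← hδ, h0]
        · rw [Set.indicator_of_notMem (by exact h0), hf]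
          simp [hπs, ← hδ, h0]
      · by_cases h0 : δ k ω = false
        · rw [Set.indicator_of_mem (by exact h0), hdrift ω h0, hf]
          simp [← hδ, h0]
        · rw [Set.indicator_of_notMem (by exact h0), hf]
          simp [← hδ, h0]
    · have hm : MeasurableSet (F \ {ω | δ k ω = false}) := (hM.innovInfo_le _ F hF1).diff hD
      refine setLIntegral_congr_fun hm fun ω hω => ?_
      have h1 : δ k ω = true := by simpa using hω.2
      simp [mismatchDrift, h1, decisionValue]

/-- A vector with the same law as its negative, here under the restricted measure, has integral
zero. -/
lemma NoiseModel.setIntegral_mismatch {π : EuclideanSpace ℝ (Fin n) → Bool}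
    (hπ : Measurable π) (hπs : ∀ e, π (-e) = π e)
    (hδ : ∀ k ω, δ k ω = π (sys.mismatch S x0 w v δ k ω)) (k : ℕ) {F : Set Ω}
    (hF : MeasurableSet[sys.controllerInfo S x0 w v δ k] F) :
    ∫ ω in F, sys.mismatch S x0 w v δ k ω ∂μ = 0 := by
  have hadm := isAdmissible_of_feedback hπ hδ
  have hm : Measurable (sys.mismatch S x0 w v δ k) :=
    (hadm.measurable_mismatch k).mono (hM.innovInfo_le _) le_rfl
  have hmap : (μ.restrict F).map (fun ω => -sys.mismatch S x0 w v δ k ω) =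
      (μ.restrict F).map (sys.mismatch S x0 w v δ k) := by
    refine Measure.ext_of_lintegral _ fun g hg => ?_
    rw [lintegral_map (g := fun ω => -sys.mismatch S x0 w v δ k ω) hg hm.neg,
      lintegral_map hg hm]
    exact hM.setLIntegral_neg_mismatch hπ hπs hδ k F hF g hg
  have h1 := integral_map (μ := μ.restrict F) (φ := fun ω => -sys.mismatch S x0 w v δ k ω)
    hm.neg.aemeasurable (f := fun x => x)
    aestronglyMeasurable_id
  have h2 := integral_map (μ := μ.restrict F) hm.aemeasurable (f := fun x => x)
    aestronglyMeasurable_id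
  rw [hmap, h2, integral_neg] at h1
  have h3 := add_eq_zero_iff_eq_neg.2 h1
  rw [← two_smul ℝ] at h3
  exact (smul_eq_zero.1 h3).resolve_left two_ne_zero

lemma NoiseModel.setIntegral_filtErr {k : ℕ} {F : Set Ω}
    (hF : MeasurableSet[sys.innovInfo x0 w v (k + 1)] F) :
    ∫ ω in F, sys.filtErr x0 w v k ω ∂μ = 0 := by
  have hi := (hM.memLp_filtErr k).integrable one_le_two
  have h1 := condExp_indep_eq (hM.measurable_filtErr k).comap_le (hM.innovInfo_le (k + 1))
    (comap_measurable (sys.filtErr x0 w v k)).stronglyMeasurable (hM.filtFacts k).indep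
  rw [← setIntegral_condExp (hM.innovInfo_le (k + 1)) hi hF,
    setIntegral_congr_ae (g := fun _ => 0) (hM.innovInfo_le _ F hF)]
  · simp
  · filter_upwards [h1] with ω hω _
    rw [hω, hM.integral_filtErr]

/-- Under a symmetric stationary scheduling law the remote estimate is the conditional mean of the
state. -/
theorem NoiseModel.condExp_plantState {π : EuclideanSpace ℝ (Fin n) → Bool}
    (hπ : Measurable π) (hπs : ∀ e, π (-e) = π e)
    (hδ : ∀ k ω, δ k ω = π (sys.mismatch S x0 w v δ k ω)) (k : ℕ) :
    μ[sys.plantState S x0 w v δ k | sys.controllerInfo S x0 w v δ k]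
      =ᵐ[μ] sys.remoteEst S x0 w v δ k := by
  have hadm := isAdmissible_of_feedback hπ hδ
  have hle : sys.controllerInfo S x0 w v δ k ≤ sys.innovInfo x0 w v (k + 1) :=
    (sys.controllerInfo_mono S x0 w v δ k.le_succ).trans (hadm.controllerInfo_succ_le k)
  have hx := (hadm.memLp_plantState hM k).integrable one_le_two
  have hc := (hadm.memLp_est hM k).2.integrable one_le_two
  have he := (hadm.memLp_mismatch hM k).integrable one_le_two
  have hf := (hM.memLp_filtErr k).integrable one_le_two
  -- The state is the remote estimate minus the mismatch plus the filtering error, and the last two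
  -- integrate to zero over every event known to the remote side.
  refine (ae_eq_condExp_of_forall_setIntegral_eq (hle.trans (hM.innovInfo_le _)) hx
    (fun F _ _ => hc.integrableOn) (fun F hF _ => ?_)
    (sys.measurable_remoteEst_controllerInfo S x0 w v δ k).aestronglyMeasurable).symm
  have h1 : ∀ ω, sys.plantState S x0 w v δ k ω = sys.remoteEst S x0 w v δ k ω +
      (-sys.mismatch S x0 w v δ k ω + sys.filtErr x0 w v k ω) := fun ω => by
    rw [← plantState_sub_remoteEst]
    abel
  have h2 : Integrable (fun ω => -sys.mismatch S x0 w v δ k ω + sys.filtErr x0 w v k ω) μ :=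
    he.neg.add hf
  have h3 : Integrable (fun ω => -sys.mismatch S x0 w v δ k ω) μ := he.neg
  simp_rw [h1]
  rw [integral_add hc.integrableOn h2.integrableOn, integral_add h3.integrableOn hf.integrableOn,
    integral_neg, hM.setIntegral_mismatch hπ hπs hδ k hF, hM.setIntegral_filtErr (hle F hF)]
  simp

end CondMean

end NCS

/-! ### Stability and detectability -/

section Stability

variable {n q : ℕ}

/-- By Gelfand's formula ‖a^k‖ is eventually below r^k for some r < 1. -/
lemma tendsto_pow_zero_of_spectralRadius_lt_one {A : Type*} [NormedRing A] [NormedAlgebra ℂ A]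
    [CompleteSpace A] {a : A} (ha : spectralRadius ℂ a < 1) :
    Tendsto (fun k => a ^ k) atTop (𝓝 0) := by
  obtain ⟨r, hr1, hr2⟩ := exists_between ha
  lift r to NNReal using hr2.ne_top
  have h1 := (spectrum.pow_nnnorm_pow_one_div_tendsto_nhds_spectralRadius a).eventually
    (gt_mem_nhds hr1)
  have hr : (r : ℝ) < 1 := by exact_mod_cast hr2
  refine squeeze_zero_norm' (a := fun k => (r : ℝ) ^ k) ?_
    (tendsto_pow_atTop_nhds_zero_of_lt_one r.2 hr)
  filter_upwards [h1, eventually_gt_atTop 0] with k hk hk0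
  have h2 := ENNReal.rpow_le_rpow (z := (k : ℝ)) hk.le k.cast_nonneg
  rw [← ENNReal.rpow_mul, one_div, inv_mul_cancel₀ (by positivity), ENNReal.rpow_one,
    ENNReal.rpow_natCast] at h2
  exact_mod_cast h2

open scoped Matrix.Norms.L2Operator in
lemma tendsto_pow_zero_of_spectrum {F : Matrix (Fin n) (Fin n) ℝ}
    (hF : ∀ z ∈ spectrum ℂ (F.map (algebraMap ℝ ℂ)), ‖z‖ < 1) :
    Tendsto (fun k => F ^ k) atTop (𝓝 0) := by
  -- In dimension zero the spectrum is empty, so this case stands apart. Otherwise Gelfand is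
  -- applied to the complexification and real parts are taken.
  rcases Nat.eq_zero_or_pos n with rfl | hn
  · rw [Subsingleton.elim (fun k => F ^ k) fun _ => 0]
    exact tendsto_const_nhds
  · have : Nonempty (Fin n) := ⟨⟨0, hn⟩⟩
    have h1 : spectralRadius ℂ (F.map (algebraMap ℝ ℂ)) < 1 := by
      have := spectrum.spectralRadius_lt_of_forall_lt (F.map (algebraMap ℝ ℂ)) (r := 1)
        fun z hz => by exact_mod_cast hF z hz
      simpa using this
    have h2 := tendsto_pow_zero_of_spectralRadius_lt_one h1
    have hre : Continuous fun M : Matrix (Fin n) (Fin n) ℂ => M.map Complex.re :=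
      continuous_id.matrix_map Complex.continuous_re
    have h3 := (hre.tendsto 0).comp h2
    have h4 : ((fun M : Matrix (Fin n) (Fin n) ℂ => M.map Complex.re) ∘
        fun k => F.map (algebraMap ℝ ℂ) ^ k) = fun k => F ^ k := by
      ext1 k
      have h5 : F.map (algebraMap ℝ ℂ) ^ k = (F ^ k).map (algebraMap ℝ ℂ) :=
        (map_pow (algebraMap ℝ ℂ).mapMatrix F k).symm
      ext i j
      simp only [Function.comp_apply, h5, Matrix.map_apply]
      simp
    rw [h4] at h3
    simpa using h3

lemma norm_add_sq_le_mul {E : Type*} [NormedAddCommGroup E] [InnerProductSpace ℝ E] {ε : ℝ}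
    (hε : 0 < ε) (a b : E) : ‖a + b‖ ^ 2 ≤ (1 + ε) * ‖a‖ ^ 2 + (1 + 1 / ε) * ‖b‖ ^ 2 := by
  have h1 := norm_add_sq_real a b
  have h2 := real_inner_le_norm a b
  have h3 : 0 ≤ (ε * ‖a‖ - ‖b‖) ^ 2 / ε := by positivity
  have h4 : (ε * ‖a‖ - ‖b‖) ^ 2 / ε = ε * ‖a‖ ^ 2 - 2 * (‖a‖ * ‖b‖) + 1 / ε * ‖b‖ ^ 2 := by
    field_simp
    ring
  linarith

/-- A quadratic Lyapunov function of a stable matrix, with its gain against disturbances. -/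
lemma exists_lyapunov {F : Matrix (Fin n) (Fin n) ℝ}
    (hF : Tendsto (fun k => F ^ k) atTop (𝓝 0)) :
    ∃ (V : EuclideanSpace ℝ (Fin n) → ℝ) (c : ℝ), 0 ≤ c ∧ (∀ x, 0 ≤ V x) ∧
      (∀ x, V x ≤ c * ‖x‖ ^ 2) ∧
      ∀ x r, V (Matrix.toEuclideanLin F x + r) ≤ V x - 1 / 2 * ‖x‖ ^ 2 + c * ‖r‖ ^ 2 := by
  obtain ⟨Φ, hΦ⟩ : ∃ Φ : Matrix (Fin n) (Fin n) ℝ →ₗ[ℝ]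
      EuclideanSpace ℝ (Fin n) →L[ℝ] EuclideanSpace ℝ (Fin n), ∀ R z,
      Φ R z = Matrix.toEuclideanLin R z :=
    ⟨(LinearMap.toContinuousLinearMap.toLinearMap).comp
      (Matrix.toEuclideanLin (𝕜 := ℝ) (m := Fin n) (n := Fin n)).toLinearMap, fun R z => rfl⟩
  have hΦc : Continuous Φ := LinearMap.continuous_of_finiteDimensional _
  have h1 : Tendsto (fun k => ‖Φ (F ^ k)‖) atTop (𝓝 0) := by
    have := ((hΦc.tendsto 0).comp hF).norm
    rwa [map_zero, norm_zero] at this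
  -- With ‖F^N‖ < 1/2 and V the sum of ‖F^i x‖² for i < N, telescoping gives V(F x) = V(x) - ‖x‖² +
  -- ‖F^N x‖² ≤ V(x) - (3/4) ‖x‖².
  obtain ⟨N, hN⟩ := (h1.eventually (gt_mem_nhds (by norm_num : (0 : ℝ) < 1 / 2))).exists
  obtain ⟨V, hV⟩ : ∃ V : EuclideanSpace ℝ (Fin n) → ℝ, ∀ x, V x =
      ∑ i ∈ Finset.range N, ‖Φ (F ^ i) x‖ ^ 2 := ⟨_, fun _ => rfl⟩
  obtain ⟨c₀, hc₀⟩ : ∃ c₀, c₀ = ∑ i ∈ Finset.range N, ‖Φ (F ^ i)‖ ^ 2 := ⟨_, rfl⟩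
  have hc₀0 : 0 ≤ c₀ := by
    rw [hc₀]
    exact Finset.sum_nonneg fun i _ => sq_nonneg _
  have hV0 : ∀ x, 0 ≤ V x := fun x => by
    rw [hV]
    exact Finset.sum_nonneg fun i _ => sq_nonneg _
  have hVle : ∀ x, V x ≤ c₀ * ‖x‖ ^ 2 := fun x => by
    rw [hV, hc₀, Finset.sum_mul]
    refine Finset.sum_le_sum fun i _ => ?_
    rw [← mul_pow]
    exact pow_le_pow_left₀ (norm_nonneg _) ((Φ (F ^ i)).le_opNorm x) 2
  have hVF : ∀ x, V (Matrix.toEuclideanLin F x) ≤ V x - 3 / 4 * ‖x‖ ^ 2 := fun x => by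
    have h2 : ∀ i, Φ (F ^ i) (Matrix.toEuclideanLin F x) = Φ (F ^ (i + 1)) x := fun i => by
      rw [hΦ, hΦ, pow_succ, toEuclideanLin_mul]
    have h3 := Finset.sum_range_succ (fun i => ‖Φ (F ^ i) x‖ ^ 2) N
    rw [Finset.sum_range_succ' (fun i => ‖Φ (F ^ i) x‖ ^ 2) N] at h3
    have h4 : ‖Φ (F ^ 0) x‖ = ‖x‖ := by rw [hΦ, pow_zero, toEuclideanLin_one]
    have h5 : ‖Φ (F ^ N) x‖ ≤ 1 / 2 * ‖x‖ := ((Φ (F ^ N)).le_opNorm x).trans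
      (mul_le_mul_of_nonneg_right hN.le (norm_nonneg _))
    have h6 := pow_le_pow_left₀ (norm_nonneg _) h5 2
    rw [hV, hV]
    simp_rw [h2]
    rw [h4] at h3
    linarith
  have hVadd : ∀ {ε : ℝ}, 0 < ε → ∀ x y, V (x + y) ≤ (1 + ε) * V x + (1 + 1 / ε) * V y := by
    intro ε hε x y
    rw [hV, hV, hV, Finset.mul_sum, Finset.mul_sum, ← Finset.sum_add_distrib]
    refine Finset.sum_le_sum fun i _ => ?_
    rw [map_add]
    exact norm_add_sq_le_mul hε _ _
  -- Young's inequality separates F x from r. This ε costs at most (1/4) ‖x‖² of the decrease,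
  -- leaving the 1/2.
  obtain ⟨ε, hε⟩ : ∃ ε : ℝ, ε = 1 / (4 * (c₀ + 1)) := ⟨_, rfl⟩
  have hε0 : 0 < ε := by rw [hε]; positivity
  have hεc : ε * c₀ ≤ 1 / 4 := by
    rw [hε, div_mul_eq_mul_div, div_le_iff₀ (by positivity)]
    linarith
  refine ⟨V, (1 + 1 / ε) * c₀, by positivity, hV0, fun x => (hVle x).trans ?_, fun x r => ?_⟩
  · refine mul_le_mul_of_nonneg_right (le_mul_of_one_le_left hc₀0 ?_) (sq_nonneg _)
    have : 0 < 1 / ε := by positivity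
    linarith
  · have h2 := hVadd hε0 (Matrix.toEuclideanLin F x) r
    have h3 := hVF x
    have h4 : (1 + 1 / ε) * V r ≤ (1 + 1 / ε) * c₀ * ‖r‖ ^ 2 := by
      rw [mul_assoc]
      exact mul_le_mul_of_nonneg_left (hVle r) (by positivity)
    have h5 : ε * V (Matrix.toEuclideanLin F x) ≤ 1 / 4 * ‖x‖ ^ 2 := by
      have h6 : V (Matrix.toEuclideanLin F x) ≤ c₀ * ‖x‖ ^ 2 := by
        have := hVle x
        have := sq_nonneg ‖x‖
        linarith
      calc ε * V (Matrix.toEuclideanLin F x) ≤ ε * (c₀ * ‖x‖ ^ 2) :=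
            mul_le_mul_of_nonneg_left h6 hε0.le
        _ = ε * c₀ * ‖x‖ ^ 2 := by ring
        _ ≤ _ := mul_le_mul_of_nonneg_right hεc (sq_nonneg _)
    linarith

/-- Trajectories of a detectable system are controlled by their outputs and disturbances. -/
lemma IsDetectablePair.exists_bound {A : Matrix (Fin n) (Fin n) ℝ} {H : Matrix (Fin q) (Fin n) ℝ}
    (hdet : IsDetectablePair A H) : ∃ c : ℝ, 0 ≤ c ∧
      ∀ x r : ℕ → EuclideanSpace ℝ (Fin n),
      (∀ k, x (k + 1) = Matrix.toEuclideanLin A (x k) + r k) → ∀ T,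
      ∑ k ∈ Finset.range T, ‖x k‖ ^ 2 ≤ c * (‖x 0‖ ^ 2 +
        ∑ k ∈ Finset.range T, (‖Matrix.toEuclideanLin H (x k)‖ ^ 2 + ‖r k‖ ^ 2)) := by
  obtain ⟨G, hG⟩ := hdet
  obtain ⟨V, c, hc, hV0, hVc, hV⟩ := exists_lyapunov (tendsto_pow_zero_of_spectrum hG)
  obtain ⟨g, hg⟩ : ∃ g, g = ‖(Matrix.toEuclideanLin G).toContinuousLinearMap‖ := ⟨_, rfl⟩
  have hgle : ∀ y, ‖Matrix.toEuclideanLin G y‖ ^ 2 ≤ g ^ 2 * ‖y‖ ^ 2 := fun y => by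
    rw [← mul_pow, hg]
    exact pow_le_pow_left₀ (norm_nonneg _)
      ((Matrix.toEuclideanLin G).toContinuousLinearMap.le_opNorm y) 2
  refine ⟨2 * c * (2 * g ^ 2 + 2), by positivity, fun x r hx T => ?_⟩
  -- Output injection: x (k + 1) = (A - G H) x k + (G H x k + r k), a stable system driven by the
  -- output and the disturbance.
  have key : 1 / 2 * ∑ k ∈ Finset.range T, ‖x k‖ ^ 2 + V (x T) ≤ V (x 0) +
      c * ∑ k ∈ Finset.range T,
        ‖Matrix.toEuclideanLin G (Matrix.toEuclideanLin H (x k)) + r k‖ ^ 2 := by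
    induction T with
    | zero => simp
    | succ T ih =>
      have h1 := hV (x T) (Matrix.toEuclideanLin G (Matrix.toEuclideanLin H (x T)) + r T)
      have h2 : Matrix.toEuclideanLin (A - G * H) (x T) +
          (Matrix.toEuclideanLin G (Matrix.toEuclideanLin H (x T)) + r T) = x (T + 1) := by
        rw [hx, toEuclideanLin_sub, toEuclideanLin_mul]
        abel
      rw [h2] at h1
      rw [Finset.sum_range_succ, Finset.sum_range_succ]
      linarith
  have h1 : ∑ k ∈ Finset.range T,
        ‖Matrix.toEuclideanLin G (Matrix.toEuclideanLin H (x k)) + r k‖ ^ 2 ≤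
      (2 * g ^ 2 + 2) * ∑ k ∈ Finset.range T,
        (‖Matrix.toEuclideanLin H (x k)‖ ^ 2 + ‖r k‖ ^ 2) := by
    rw [Finset.mul_sum]
    refine Finset.sum_le_sum fun k _ => ?_
    have h2 := norm_add_sq_le_mul one_pos
      (Matrix.toEuclideanLin G (Matrix.toEuclideanLin H (x k))) (r k)
    have h3 := hgle (Matrix.toEuclideanLin H (x k))
    have h4 : 0 ≤ g ^ 2 * ‖r k‖ ^ 2 := by positivity
    have h5 : 0 ≤ ‖Matrix.toEuclideanLin H (x k)‖ ^ 2 := by positivity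
    rw [div_one] at h2
    linarith
  have h2 := mul_le_mul_of_nonneg_left h1 hc
  have h3 := hVc (x 0)
  have h4 := hV0 (x T)
  have h5 : 0 ≤ c * ‖x 0‖ ^ 2 * (2 * g ^ 2 + 1) := by positivity
  calc ∑ k ∈ Finset.range T, ‖x k‖ ^ 2 ≤ 2 * (c * ‖x 0‖ ^ 2 + c * ((2 * g ^ 2 + 2) *
        ∑ k ∈ Finset.range T, (‖Matrix.toEuclideanLin H (x k)‖ ^ 2 + ‖r k‖ ^ 2))) := by linarith
    _ ≤ _ := by linarith

lemma exists_norm_sq_le_quadForm {R : Matrix (Fin n) (Fin n) ℝ} (hR : R.PosDef) :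
    ∃ c : ℝ, 0 ≤ c ∧ ∀ u, ‖u‖ ^ 2 ≤ c * quadForm R u := by
  obtain ⟨T, hT⟩ := exists_equiv_toEuclideanLin_sqrt hR
  refine ⟨‖(T.symm : EuclideanSpace ℝ (Fin n) →L[ℝ] EuclideanSpace ℝ (Fin n))‖ ^ 2, sq_nonneg _,
    fun u => ?_⟩
  rw [← norm_sq_toEuclideanLin_sqrt hR.posSemidef, ← hT, ← mul_pow]
  have := (T.symm : EuclideanSpace ℝ (Fin n) →L[ℝ] EuclideanSpace ℝ (Fin n)).le_opNorm (T u)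
  rw [ContinuousLinearEquiv.coe_coe, ContinuousLinearEquiv.symm_apply_apply] at this
  exact pow_le_pow_left₀ (norm_nonneg _) this 2

end Stability

namespace NCS

variable {n m p : ℕ} {sys : NCS n m p} {S : Matrix (Fin n) (Fin n) ℝ}
  {Qhalf : Matrix (Fin n) (Fin n) ℝ}

lemma quadForm_Q (hQ : sys.Q = Qhalfᵀ * Qhalf) (x : EuclideanSpace ℝ (Fin n)) :
    quadForm sys.Q x = ‖Matrix.toEuclideanLin Qhalf x‖ ^ 2 := by
  rw [hQ, quadForm_eq_inner, toEuclideanLin_mul, ← inner_toEuclideanLin_left,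
    real_inner_self_eq_norm_sq]

/-- States whose free evolution is never penalized decay under the free evolution. -/
lemma tendsto_of_unobservable (hQ : sys.Q = Qhalfᵀ * Qhalf) (hdet : IsDetectablePair sys.A Qhalf)
    (hR : sys.R.PosDef) (hS : sys.IsControlRiccati S)
    {A H : EuclideanSpace ℝ (Fin n) →L[ℝ] EuclideanSpace ℝ (Fin n)}
    (hA : ∀ e, A e = Matrix.toEuclideanLin sys.A e)
    (hH : ∀ e, ‖H e‖ ^ 2 = quadForm (sys.Aᵀ * sys.errWeight S * sys.A) e)
    {e : EuclideanSpace ℝ (Fin n)} (he : e ∈ unobservable A H) :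
    Tendsto (fun i => (A ^ i) e) atTop (𝓝 0) := by
  rw [mem_unobservable] at he
  -- H is a root of Aᵀ Σ A, so the states with zero Σ-penalty are the A^{i+1} e, one step later.
  -- Completing the square with zero remote estimate then makes the S-form telescope against Q, and
  -- detectability sums ‖z i‖².
  obtain ⟨z, hz⟩ : ∃ z : ℕ → EuclideanSpace ℝ (Fin n), ∀ i, z i = (A ^ (i + 1)) e :=
    ⟨_, fun _ => rfl⟩
  have hz' : ∀ i, z i = Matrix.toEuclideanLin sys.A ((A ^ i) e) := fun i => by
    rw [hz, pow_succ', mul_apply_eq_comp, hA]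
  have hzs : ∀ i, z (i + 1) = Matrix.toEuclideanLin sys.A (z i) := fun i => by rw [hz', ← hz]
  have hpen : ∀ i, quadForm (sys.errWeight S) (z i) = 0 := fun i => by
    rw [hz', quadForm_toEuclideanLin, ← hH, he i, norm_zero, zero_pow two_ne_zero]
  have hstep : ∀ i, quadForm sys.Q (z i) + quadForm S (z (i + 1)) = quadForm S (z i) := fun i => by
    have h0 : ∀ {k : ℕ} (M : Matrix (Fin k) (Fin k) ℝ), quadForm M 0 = 0 := fun M => by
      simp [quadForm]
    have h := hS.complete_square hR (z i) 0
    rw [map_zero, neg_zero, map_zero, h0, add_zero, add_zero, sub_zero, hpen, add_zero] at h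
    rw [hzs, h]
  have hsum : ∀ T, ∑ i ∈ Finset.range T, quadForm sys.Q (z i) + quadForm S (z T) =
      quadForm S (z 0) := fun T => by
    induction T with
    | zero => simp
    | succ T ih =>
      rw [Finset.sum_range_succ]
      linarith [hstep T]
  obtain ⟨c, hc, hbound⟩ := hdet.exists_bound
  have hb : ∀ T, ∑ i ∈ Finset.range T, ‖z i‖ ^ 2 ≤ c * (‖z 0‖ ^ 2 + quadForm S (z 0)) := fun T => by
    refine (hbound z (fun _ => 0) (fun k => by rw [hzs, add_zero]) T).trans
      (mul_le_mul_of_nonneg_left ?_ hc)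
    simp_rw [← quadForm_Q hQ, norm_zero]
    simp only [ne_eq, OfNat.ofNat_ne_zero, not_false_eq_true, zero_pow, add_zero]
    linarith [hsum T, quadForm_nonneg hS.1 (z T)]
  have hsq := (summable_of_sum_range_le (fun i => sq_nonneg ‖z i‖) hb).tendsto_atTop_zero
  have hn : Tendsto (fun i => ‖z i‖) atTop (𝓝 0) := by
    have := hsq.sqrt
    simpa using this
  rw [← tendsto_add_atTop_iff_nat 1]
  refine (tendsto_zero_iff_norm_tendsto_zero.2 hn).congr hz

/-! ### Second moments bounded by the cost. -/

section Bound

variable {Ω : Type*} [MeasurableSpace Ω] {μ : Measure Ω} [IsProbabilityMeasure μ]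
  {x0 : Ω → EuclideanSpace ℝ (Fin n)}
  {w : ℕ → Ω → EuclideanSpace ℝ (Fin n)} {v : ℕ → Ω → EuclideanSpace ℝ (Fin p)}
  {δ : ℕ → Ω → Bool}
  (hM : sys.NoiseModel μ x0 w v) (hδ : sys.IsAdmissible S x0 w v δ)

include hM hδ

/-- Second moments of the state are controlled by the accumulated cost. -/
lemma IsAdmissible.exists_sum_integral_norm_sq_le (hQ : sys.Q = Qhalfᵀ * Qhalf)
    (hdet : IsDetectablePair sys.A Qhalf) (hR : sys.R.PosDef) (hθ : 0 ≤ sys.θ) :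
    ∃ C : ℝ, 0 ≤ C ∧ ∀ T : ℕ,
      ∑ k ∈ Finset.range T, ∫ ω, ‖sys.plantState S x0 w v δ k ω‖ ^ 2 ∂μ ≤
        C * (1 + T + ∑ k ∈ Finset.range T, ∫ ω, sys.runningCost S x0 w v δ k ω ∂μ) := by
  obtain ⟨c, hc, hbound⟩ := hdet.exists_bound
  obtain ⟨ρ, hρ, hRu⟩ := exists_norm_sq_le_quadForm hR
  obtain ⟨b, hb⟩ : ∃ b, b = ‖(Matrix.toEuclideanLin sys.B).toContinuousLinearMap‖ := ⟨_, rfl⟩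
  have hble : ∀ y, ‖Matrix.toEuclideanLin sys.B y‖ ^ 2 ≤ b ^ 2 * ‖y‖ ^ 2 := fun y => by
    rw [← mul_pow, hb]
    exact pow_le_pow_left₀ (norm_nonneg _)
      ((Matrix.toEuclideanLin sys.B).toContinuousLinearMap.le_opNorm y) 2
  obtain ⟨a, ha⟩ : ∃ a, a = ∫ ω, ‖sys.plantState S x0 w v δ 0 ω‖ ^ 2 ∂μ := ⟨_, rfl⟩
  have ha0 : 0 ≤ a := by rw [ha]; exact integral_nonneg fun _ => sq_nonneg _
  obtain ⟨t, ht⟩ : ∃ t, t = ((1 : Matrix (Fin n) (Fin n) ℝ) * sys.W).trace := ⟨_, rfl⟩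
  have hnorm : ∀ x : EuclideanSpace ℝ (Fin n), ‖x‖ ^ 2 = quadForm 1 x := fun x => by
    rw [quadForm_eq_inner, toEuclideanLin_one, real_inner_self_eq_norm_sq]
  have hwt : ∀ k, ∫ ω, ‖w k ω‖ ^ 2 ∂μ = t := fun k => by
    simp_rw [hnorm]
    rw [integral_quadForm_of_gaussian (hM.measurable_w k) hM.posSemidef_W (hM.map_w k), ht]
  have ht0 : 0 ≤ t := by rw [← hwt 0]; exact integral_nonneg fun _ => sq_nonneg _
  -- The disturbance in the detectability bound is B u + w, so the control contributes at most 2 b²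
  -- ρ uᵀ R u; d absorbs this into the running cost.
  obtain ⟨d, hd⟩ : ∃ d, d = 1 + 2 * b ^ 2 * ρ := ⟨_, rfl⟩
  have hd1 : 1 ≤ d := by
    rw [hd]
    have : 0 ≤ 2 * b ^ 2 * ρ := by positivity
    linarith
  have hpath : ∀ T ω, ∑ k ∈ Finset.range T, ‖sys.plantState S x0 w v δ k ω‖ ^ 2 ≤
      c * (‖sys.plantState S x0 w v δ 0 ω‖ ^ 2 + ∑ k ∈ Finset.range T,
        (d * sys.runningCost S x0 w v δ k ω + 2 * ‖w k ω‖ ^ 2)) := by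
    intro T ω
    refine (hbound (fun k => sys.plantState S x0 w v δ k ω)
      (fun k => Matrix.toEuclideanLin sys.B (sys.control S x0 w v δ k ω) + w k ω)
      (fun k => by rw [plantState_succ, add_assoc]) T).trans
      (mul_le_mul_of_nonneg_left (add_le_add_right (Finset.sum_le_sum fun k _ => ?_) _) hc)
    have h1 := norm_add_sq_le_mul one_pos
      (Matrix.toEuclideanLin sys.B (sys.control S x0 w v δ k ω)) (w k ω)
    have h2 := hble (sys.control S x0 w v δ k ω)
    have h3 := mul_le_mul_of_nonneg_left (hRu (sys.control S x0 w v δ k ω)) (sq_nonneg b)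
    have h4 := quadForm_nonneg hR.posSemidef (sys.control S x0 w v δ k ω)
    have h5 : 0 ≤ sys.θ * decisionValue (δ k ω) := by
      refine mul_nonneg hθ ?_
      cases δ k ω <;> simp [decisionValue]
    have h6 : 0 ≤ quadForm sys.Q (sys.plantState S x0 w v δ k ω) := by
      rw [quadForm_Q hQ]
      positivity
    rw [← quadForm_Q hQ, runningCost]
    have h7 : d * (quadForm sys.Q (sys.plantState S x0 w v δ k ω) +
        quadForm sys.R (sys.control S x0 w v δ k ω) + sys.θ * decisionValue (δ k ω)) =
      d * (quadForm sys.Q (sys.plantState S x0 w v δ k ω)) +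
      d * (sys.θ * decisionValue (δ k ω)) + (quadForm sys.R (sys.control S x0 w v δ k ω) +
        2 * (b ^ 2 * (ρ * quadForm sys.R (sys.control S x0 w v δ k ω)))) := by
      rw [hd]
      ring
    have h8 := le_mul_of_one_le_left h6 hd1
    have h9 : 0 ≤ d * (sys.θ * decisionValue (δ k ω)) := mul_nonneg (by linarith) h5
    rw [h7]
    linarith
  have ix : ∀ k, Integrable (fun ω => ‖sys.plantState S x0 w v δ k ω‖ ^ 2) μ := fun k =>
    (memLp_two_iff_integrable_sq_norm (hδ.memLp_plantState hM k).1).1 (hδ.memLp_plantState hM k)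
  have iw : ∀ k, Integrable (fun ω => ‖w k ω‖ ^ 2) μ := fun k =>
    (memLp_two_iff_integrable_sq_norm (hM.memLp_w k).1).1 (hM.memLp_w k)
  have ir : ∀ k, Integrable (fun ω => d * sys.runningCost S x0 w v δ k ω + 2 * ‖w k ω‖ ^ 2) μ :=
    fun k => ((hδ.integrable_runningCost hM k).const_mul d).add ((iw k).const_mul 2)
  have is : ∀ T, Integrable (fun ω => ∑ k ∈ Finset.range T,
      (d * sys.runningCost S x0 w v δ k ω + 2 * ‖w k ω‖ ^ 2)) μ := fun T =>
    integrable_finsetSum _ fun k _ => ir k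
  have hexp : ∀ T : ℕ, ∑ k ∈ Finset.range T, ∫ ω, ‖sys.plantState S x0 w v δ k ω‖ ^ 2 ∂μ ≤
      c * (a + (d * ∑ k ∈ Finset.range T, ∫ ω, sys.runningCost S x0 w v δ k ω ∂μ +
        T * (2 * t))) := by
    intro T
    have h1 := integral_mono (integrable_finsetSum (Finset.range T) fun k _ => ix k)
      (((ix 0).add (is T)).const_mul c) (hpath T)
    rw [integral_finsetSum _ fun k _ => ix k, integral_const_mul] at h1
    refine h1.trans (le_of_eq ?_)
    congr 1
    refine (integral_add (ix 0) (is T)).trans ?_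
    rw [← ha, integral_finsetSum _ fun k _ => ir k]
    congr 1
    have h2 : ∀ k, ∫ ω, (d * sys.runningCost S x0 w v δ k ω + 2 * ‖w k ω‖ ^ 2) ∂μ =
        d * ∫ ω, sys.runningCost S x0 w v δ k ω ∂μ + 2 * t := fun k => by
      rw [integral_add ((hδ.integrable_runningCost hM k).const_mul d) ((iw k).const_mul 2),
        integral_const_mul, integral_const_mul, hwt]
    simp_rw [h2]
    rw [Finset.sum_add_distrib, ← Finset.mul_sum, Finset.sum_const, Finset.card_range,
      nsmul_eq_mul]
  have hcost : ∀ T, 0 ≤ ∑ k ∈ Finset.range T, ∫ ω, sys.runningCost S x0 w v δ k ω ∂μ := fun T => by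
    refine Finset.sum_nonneg fun k _ => integral_nonneg fun ω => ?_
    have h4 := quadForm_nonneg hR.posSemidef (sys.control S x0 w v δ k ω)
    have h5 : 0 ≤ sys.θ * decisionValue (δ k ω) := by
      refine mul_nonneg hθ ?_
      cases δ k ω <;> simp [decisionValue]
    have h6 : 0 ≤ quadForm sys.Q (sys.plantState S x0 w v δ k ω) := by
      rw [quadForm_Q hQ]
      positivity
    exact add_nonneg (add_nonneg h6 h4) h5
  refine ⟨c * (a + d + 2 * t), by positivity, fun T => (hexp T).trans ?_⟩
  rw [mul_assoc]
  refine mul_le_mul_of_nonneg_left ?_ hc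
  obtain ⟨J, hJ⟩ : ∃ J, J = ∑ k ∈ Finset.range T, ∫ ω, sys.runningCost S x0 w v δ k ω ∂μ :=
    ⟨_, rfl⟩
  have hJ0 : 0 ≤ J := hJ ▸ hcost T
  rw [← hJ]
  have hT0 : (0 : ℝ) ≤ T := T.cast_nonneg
  have h1 : 0 ≤ a * T + a * J + d + d * T + 2 * t + 2 * t * J := by positivity
  linarith

end Bound

end NCS

/-! ### Average cost: verification and optimality -/

/-! ### Cesàro means and the growth argument for the cost. -/

section RealSequences

lemma tendsto_cesaro_add {u r : ℕ → ℝ} {l r' : ℝ} (hu : Tendsto u atTop (𝓝 l))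
    (hr : Tendsto r atTop (𝓝 r')) :
    Tendsto (fun T : ℕ => (T : ℝ)⁻¹ * (∑ k ∈ Finset.range T, u k + r T)) atTop (𝓝 l) := by
  have h1 := hu.cesaro.add ((tendsto_inv_atTop_nhds_zero_nat (𝕜 := ℝ)).mul hr)
  rw [zero_mul, add_zero] at h1
  exact h1.congr fun T => by ring

/-- A monotone cost `J` that falls short of `s` only by a multiple of moments `m`, whose sums are in
turn controlled by `J`, grows at least as fast as `s`. -/
lemma eventually_mul_le_of_moment_bound {J s m : ℕ → ℝ} {Ψ b C : ℝ} (hJ : Monotone J)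
    (hJ0 : ∀ T, 0 ≤ J T) (hm : ∀ k, 0 ≤ m k) (hb : 0 < b) (hC : 0 ≤ C)
    (hs : Tendsto (fun T : ℕ => (T : ℝ)⁻¹ * s T) atTop (𝓝 Ψ))
    (h1 : ∀ T, s T ≤ J (T + 1) + b * m (T + 1))
    (h2 : ∀ T : ℕ, ∑ k ∈ Finset.range T, m k ≤ C * (1 + T + J T)) {c : ℝ} (hc : c < Ψ) :
    ∀ᶠ T : ℕ in atTop, c * T ≤ J (T + 1) := by
  rcases lt_or_ge c 0 with hc0 | hc0
  · exact .of_forall fun T => (mul_nonpos_of_nonpos_of_nonneg hc0.le T.cast_nonneg).trans (hJ0 _)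
  obtain ⟨d, hcd, hdΨ⟩ := exists_between hc
  have hd0 : 0 < d := hc0.trans_lt hcd
  have h3 : ∀ᶠ T : ℕ in atTop, d * T ≤ s T := by
    filter_upwards [hs.eventually (lt_mem_nhds hdΨ), eventually_gt_atTop 0] with T hT hT0
    have : (0 : ℝ) < T := by exact_mod_cast hT0
    rw [inv_mul_eq_div, lt_div_iff₀ this] at hT
    exact hT.le
  obtain ⟨T₀, hT₀⟩ := eventually_atTop.1 h3
  -- If J (T + 1) < c T, each of the last N moments satisfies b m ≥ (d - c) T - d N, while b times
  -- the sum of all of them is at most b C (2 + (1 + c) T). N makes the coefficient of T on the left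
  -- exceed the other by 1, and K beats the constants N² d + 2 b C.
  obtain ⟨N, hN⟩ := exists_nat_gt ((b * C * (1 + c) + 1) / (d - c))
  rw [div_lt_iff₀ (sub_pos.2 hcd)] at hN
  obtain ⟨K, hK⟩ := exists_nat_gt (N ^ 2 * d + 2 * b * C)
  filter_upwards [eventually_ge_atTop (T₀ + N + K)] with T hT
  by_contra hlt
  rw [not_le] at hlt
  have hTK : (K : ℝ) ≤ T := by exact_mod_cast (by omega : K ≤ T)
  have hterm : ∀ i ∈ Finset.range N, (d - c) * T - d * N ≤ b * m (T - i) := by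
    intro i hi
    rw [Finset.mem_range] at hi
    obtain ⟨k, hk⟩ : ∃ k, T = k + 1 + i := ⟨T - 1 - i, by omega⟩
    have h4 := h1 k
    have h5 := hT₀ k (by omega)
    have h6 : J (k + 1) ≤ J (T + 1) := hJ (by omega)
    have h7 : T - i = k + 1 := by omega
    have h8 : (T : ℝ) - N ≤ k := by
      have : (T : ℝ) ≤ k + N := by exact_mod_cast (by omega : T ≤ k + N)
      linarith
    have h9 := mul_le_mul_of_nonneg_left h8 hd0.le
    rw [h7]
    linarith
  have hsum := Finset.sum_le_sum hterm
  rw [Finset.sum_const, Finset.card_range, nsmul_eq_mul, ← Finset.mul_sum] at hsum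
  have h4 : ∑ i ∈ Finset.range N, m (T - i) ≤ ∑ k ∈ Finset.range (T + 1), m k := by
    rw [← Finset.sum_range_reflect m (T + 1)]
    refine Finset.sum_le_sum_of_subset_of_nonneg (Finset.range_mono (by omega)) fun i _ _ => hm _
  have h5 := h4.trans (h2 (T + 1))
  have h6 : C * (1 + ((T + 1 : ℕ) : ℝ) + J (T + 1)) ≤ C * (2 + T + c * T) := by
    refine mul_le_mul_of_nonneg_left ?_ hC
    push_cast
    linarith
  have h7 := mul_le_mul_of_nonneg_left (h5.trans h6) hb.le
  have hT0 : (0 : ℝ) ≤ T := T.cast_nonneg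
  have h8 : (T : ℝ) * 1 ≤ T * (N * (d - c) - b * C * (1 + c)) :=
    mul_le_mul_of_nonneg_left (by linarith) hT0
  nlinarith

end RealSequences

/-! ### Uniform convergence of the Gaussian kernels. -/

section Kernel

variable {n : ℕ}

lemma map_neg_multivariateGaussian_zero (P : Matrix (Fin n) (Fin n) ℝ) :
    (multivariateGaussian 0 P).map (fun x => -x) = multivariateGaussian 0 P := by
  refine Measure.ext_of_lintegral _ fun g hg => ?_
  rw [lintegral_map hg measurable_neg, lintegral_neg_multivariateGaussian_zero hg]

lemma exists_gaussian_rate {M : ℕ → Matrix (Fin n) (Fin n) ℝ}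
    {N : Matrix (Fin n) (Fin n) ℝ} (hM : ∀ k, (M k).PosSemidef) (hN : N.PosSemidef)
    (hlim : Tendsto M atTop (𝓝 N)) {g : EuclideanSpace ℝ (Fin n) → ℝ} (hg : UniformContinuous g)
    {b : ℝ} (hb : ∀ e, |g e| ≤ b) :
    ∃ ε : ℕ → ℝ, Tendsto ε atTop (𝓝 0) ∧ ∀ k a, |∫ ξ, g (a + ξ) ∂(multivariateGaussian 0 (M k)) -
      ∫ ξ, g (a + ξ) ∂(multivariateGaussian 0 N)| ≤ ε k := by
  have hle : ∀ (P : Matrix (Fin n) (Fin n) ℝ) a,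
      |∫ ξ, g (a + ξ) ∂(multivariateGaussian 0 P)| ≤ b := fun P a => by
    have h := norm_integral_le_of_norm_le_const (μ := multivariateGaussian 0 P)
      (f := fun ξ => g (a + ξ)) (.of_forall fun ξ => hb (a + ξ))
    simpa using h
  have hbdd : ∀ k, BddAbove (Set.range fun a => |∫ ξ, g (a + ξ) ∂(multivariateGaussian 0 (M k)) -
      ∫ ξ, g (a + ξ) ∂(multivariateGaussian 0 N)|) := fun k => by
    refine ⟨b + b, ?_⟩
    rintro _ ⟨a, rfl⟩
    exact (abs_sub _ _).trans (add_le_add (hle _ a) (hle _ a))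
  -- The rate is the supremum over base points, hence independent of the random drift and of the
  -- scheduling law.
  refine ⟨fun k => ⨆ a, |∫ ξ, g (a + ξ) ∂(multivariateGaussian 0 (M k)) -
      ∫ ξ, g (a + ξ) ∂(multivariateGaussian 0 N)|, ?_, fun k a => le_ciSup (hbdd k) a⟩
  rw [Metric.tendsto_atTop]
  intro η hη
  obtain ⟨K, hK⟩ := eventually_atTop.1
    (eventually_abs_integral_gaussian_sub_le hM hN hlim hg hb (half_pos hη))
  refine ⟨K, fun k hk => ?_⟩
  rw [Real.dist_eq, sub_zero, abs_of_nonneg (Real.iSup_nonneg fun _ => abs_nonneg _)]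
  exact (ciSup_le (hK k hk)).trans_lt (half_lt_self hη)

end Kernel

namespace NCS

variable {n m p : ℕ} {sys : NCS n m p} {S Ps Qhalf : Matrix (Fin n) (Fin n) ℝ}

/-! ### The Bellman equation along the closed loop. -/

section Verification

variable {Ω : Type*} [MeasurableSpace Ω] {μ : Measure Ω} [IsProbabilityMeasure μ]
  {x0 : Ω → EuclideanSpace ℝ (Fin n)}
  {w : ℕ → Ω → EuclideanSpace ℝ (Fin n)} {v : ℕ → Ω → EuclideanSpace ℝ (Fin p)}
  {h : EuclideanSpace ℝ (Fin n) → ℝ} {j : ℝ}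

omit [MeasurableSpace Ω] in
/-- The two sides of the Bellman equation along the closed loop. -/
lemma IsDifferentialCost.le_mdpCost_add (hd : sys.IsDifferentialCost S Ps h j)
    (δ : ℕ → Ω → Bool) (k : ℕ) (ω : Ω) :
    j + h (sys.mismatch S x0 w v δ k ω) ≤
      sys.mdpCost S (sys.mismatch S x0 w v δ k ω) (δ k ω) +
        ∫ ξ, h (sys.mismatchDrift S x0 w v δ k ω + ξ) ∂(sys.mismatchNoise Ps) := by
  rw [mismatchDrift, ← integral_transition hd.continuous, hd.bellman]
  cases δ k ω
  · exact min_le_left _ _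
  · exact min_le_right _ _

/-- VoI is silence minus transmission in the Bellman minimum, so its sign selects the minimizing
branch. -/
lemma mdpCost_add_sub_eq_VoI (hc : Continuous h) (e : EuclideanSpace ℝ (Fin n)) :
    sys.VoI S Ps h e = (sys.mdpCost S e false + ∫ y, h y ∂(sys.transition Ps e false)) -
      (sys.mdpCost S e true + ∫ y, h y ∂(sys.transition Ps e true)) := by
  rw [integral_transition hc, integral_transition hc, VoI]
  simp only [mdpCost, decisionValue, Bool.false_eq_true, if_false, if_true, sub_zero, sub_self,
    zero_smul, one_smul, zero_add, one_mul, zero_mul, mul_zero, mul_one, add_zero]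
  ring

omit [MeasurableSpace Ω] in
lemma IsDifferentialCost.eq_mdpCost_add (hd : sys.IsDifferentialCost S Ps h j)
    {δ : ℕ → Ω → Bool}
    (hδ : ∀ k ω, δ k ω = true ↔ 0 ≤ sys.VoI S Ps h (sys.mismatch S x0 w v δ k ω))
    (k : ℕ) (ω : Ω) :
    j + h (sys.mismatch S x0 w v δ k ω) =
      sys.mdpCost S (sys.mismatch S x0 w v δ k ω) (δ k ω) +
        ∫ ξ, h (sys.mismatchDrift S x0 w v δ k ω + ξ) ∂(sys.mismatchNoise Ps) := by
  rw [mismatchDrift, ← integral_transition hd.continuous, hd.bellman]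
  have h1 := hδ k ω
  rw [mdpCost_add_sub_eq_VoI hd.continuous] at h1
  cases h2 : δ k ω
  · rw [h2] at h1
    simp only [Bool.false_eq_true, false_iff, not_le] at h1
    exact min_eq_left (by linarith)
  · rw [h2] at h1
    simp only [true_iff] at h1
    exact min_eq_right (by linarith)

variable (hM : sys.NoiseModel μ x0 w v)

include hM

/-- Up to an error that vanishes as the filter reaches its steady state, the expected cost of the
mismatch is the average cost plus a telescoping term. -/
lemma NoiseModel.exists_verification_rate (hPs : Tendsto sys.filtCov atTop (𝓝 Ps))
    (hinnPs : (sys.C * sys.timeUpdate Ps * sys.Cᵀ + sys.V).PosDef)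
    (hXi : (sys.mismatchCov Ps).PosDef) (hd : sys.IsDifferentialCost S Ps h j)
    (hu : UniformContinuous h) :
    ∃ ε : ℕ → ℝ, Tendsto ε atTop (𝓝 0) ∧
      ∀ δ : ℕ → Ω → Bool, sys.IsAdmissible S x0 w v δ → ∀ k,
      j + ∫ ω, h (sys.mismatch S x0 w v δ k ω) ∂μ ≤
        ∫ ω, sys.mdpCost S (sys.mismatch S x0 w v δ k ω) (δ k ω) ∂μ +
          ∫ ω, h (sys.mismatch S x0 w v δ (k + 1) ω) ∂μ + ε k ∧
      ((∀ k ω, δ k ω = true ↔ 0 ≤ sys.VoI S Ps h (sys.mismatch S x0 w v δ k ω)) →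
        ∫ ω, sys.mdpCost S (sys.mismatch S x0 w v δ k ω) (δ k ω) ∂μ +
          ∫ ω, h (sys.mismatch S x0 w v δ (k + 1) ω) ∂μ ≤
        j + ∫ ω, h (sys.mismatch S x0 w v δ k ω) ∂μ + ε k) := by
  -- The next mismatch is drift minus correction, with the correction at k + 1 independent of the
  -- drift. Fubini gives a Gaussian average with covariance `correctionCov (k + 1)`, within ε k of
  -- the stationary one in the Bellman equation.
  obtain ⟨b, hb⟩ := hd.bounded
  obtain ⟨ε, hε, hεle⟩ := exists_gaussian_rate
    (fun k => (hM.filtFacts (k + 1)).posSemidef_correction) hXi.posSemidef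
    ((tendsto_add_atTop_iff_nat 1).2 (tendsto_correctionCov hPs hinnPs)) hu hb
  refine ⟨ε, hε, fun δ hδ k => ?_⟩
  obtain ⟨X, hX⟩ : ∃ X, X = sys.mismatchDrift S x0 w v δ k := ⟨_, rfl⟩
  have hXm : Measurable[sys.innovInfo x0 w v (k + 1)] X := by
    rw [hX]
    exact hδ.measurable_mismatchDrift k
  have hXm' : Measurable X := hXm.mono (hM.innovInfo_le _) le_rfl
  have hnm : Measurable fun ω => -sys.correction x0 w v (k + 1) ω :=
    (hM.measurable_correction (k + 1)).neg
  have hlaw : μ.map (fun ω => -sys.correction x0 w v (k + 1) ω) =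
      multivariateGaussian 0 (sys.correctionCov (k + 1)) := by
    rw [← map_neg_multivariateGaussian_zero, ← (hM.filtFacts (k + 1)).map_correction,
      Measure.map_map measurable_neg (hM.measurable_correction (k + 1))]
    rfl
  have hind : IndepFun X (fun ω => -sys.correction x0 w v (k + 1) ω) μ :=
    (hM.indepFun_correction hXm).comp measurable_id measurable_neg
  have hnext : ∫ ω, h (sys.mismatch S x0 w v δ (k + 1) ω) ∂μ =
      ∫ ω, ∫ ξ, h (X ω + ξ) ∂(multivariateGaussian 0 (sys.correctionCov (k + 1))) ∂μ := by
    have h1 := integral_comp_of_indepFun hXm' hnm hind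
      (f := fun z => h (z.1 + z.2)) (hd.continuous.measurable.comp (by fun_prop)) fun z => hb _
    rw [hlaw] at h1
    simp_rw [mismatch_succ, ← hX]
    exact h1
  have hGi : ∀ P : Matrix (Fin n) (Fin n) ℝ,
      Integrable (fun ω => ∫ ξ, h (X ω + ξ) ∂(multivariateGaussian 0 P)) μ := fun P => by
    have hsm : StronglyMeasurable fun x => ∫ ξ, h (x + ξ) ∂(multivariateGaussian 0 P) :=
      StronglyMeasurable.integral_prod_right (f := fun x ξ => h (x + ξ))
        (hd.continuous.comp (continuous_fst.add continuous_snd)).stronglyMeasurable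
    refine Integrable.of_bound (hsm.comp_measurable hXm').aestronglyMeasurable b
      (.of_forall fun ω => ?_)
    have h := norm_integral_le_of_norm_le_const (μ := multivariateGaussian 0 P)
      (f := fun ξ => h (X ω + ξ)) (.of_forall fun ξ => hb (X ω + ξ))
    simpa using h
  have hlim : |∫ ω, h (sys.mismatch S x0 w v δ (k + 1) ω) ∂μ -
      ∫ ω, ∫ ξ, h (X ω + ξ) ∂(sys.mismatchNoise Ps) ∂μ| ≤ ε k := by
    have hGs : Integrable (fun ω => ∫ ξ, h (X ω + ξ) ∂(sys.mismatchNoise Ps)) μ := hGi _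
    rw [hnext, ← integral_sub (hGi _) hGs]
    have h1 := norm_integral_le_of_norm_le_const (μ := μ)
      (f := fun ω => ∫ ξ, h (X ω + ξ) ∂(multivariateGaussian 0 (sys.correctionCov (k + 1))) -
        ∫ ξ, h (X ω + ξ) ∂(sys.mismatchNoise Ps)) (.of_forall fun ω => hεle k (X ω))
    simpa using h1
  have hem : Measurable (sys.mismatch S x0 w v δ k) :=
    (hδ.measurable_mismatch k).mono (hM.innovInfo_le _) le_rfl
  have hhi : Integrable (fun ω => h (sys.mismatch S x0 w v δ k ω)) μ :=
    Integrable.of_bound (hd.continuous.measurable.comp hem).aestronglyMeasurable b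
      (.of_forall fun ω => hb _)
  have hci := hδ.integrable_mdpCost hM k
  have hl : ∫ ω, (j + h (sys.mismatch S x0 w v δ k ω)) ∂μ =
      j + ∫ ω, h (sys.mismatch S x0 w v δ k ω) ∂μ := by
    rw [integral_add (integrable_const _) hhi]
    simp
  have hr := integral_add hci (hGi (sys.mismatchCov Ps))
  rw [abs_le] at hlim
  constructor
  · have h1 : ∫ ω, (j + h (sys.mismatch S x0 w v δ k ω)) ∂μ ≤
        ∫ ω, (sys.mdpCost S (sys.mismatch S x0 w v δ k ω) (δ k ω) +
          ∫ ξ, h (X ω + ξ) ∂(sys.mismatchNoise Ps)) ∂μ :=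
      integral_mono ((integrable_const _).add hhi) (hci.add (hGi _)) fun ω => by
        rw [hX]
        exact hd.le_mdpCost_add δ k ω
    rw [hl] at h1
    have h2 := h1.trans_eq hr
    change _ ≤ _ + ∫ ω, ∫ ξ, h (X ω + ξ) ∂(sys.mismatchNoise Ps) ∂μ at h2
    linarith [hlim.1]
  · intro hopt
    have h1 : ∫ ω, (j + h (sys.mismatch S x0 w v δ k ω)) ∂μ =
        ∫ ω, (sys.mdpCost S (sys.mismatch S x0 w v δ k ω) (δ k ω) +
          ∫ ξ, h (X ω + ξ) ∂(sys.mismatchNoise Ps)) ∂μ :=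
      integral_congr_ae (.of_forall fun ω => by
        simp only [hX]
        exact hd.eq_mdpCost_add hopt k ω)
    rw [hl] at h1
    have h2 := h1.trans hr
    change _ = _ + ∫ ω, ∫ ξ, h (X ω + ξ) ∂(sys.mismatchNoise Ps) ∂μ at h2
    linarith [hlim.2]

end Verification

/-! ### Lower bound, limit and optimality of the average cost. -/

section AverageCost

variable {Ω : Type*} [MeasurableSpace Ω] {μ : Measure Ω} [IsProbabilityMeasure μ]
  {x0 : Ω → EuclideanSpace ℝ (Fin n)}
  {w : ℕ → Ω → EuclideanSpace ℝ (Fin n)} {v : ℕ → Ω → EuclideanSpace ℝ (Fin p)}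
  {h : EuclideanSpace ℝ (Fin n) → ℝ} {j : ℝ}
  (hM : sys.NoiseModel μ x0 w v)

include hM

lemma IsAdmissible.avgCost_eq {δ : ℕ → Ω → Bool} (hδ : sys.IsAdmissible S x0 w v δ) (T : ℕ) :
    sys.avgCost S x0 w v δ μ T =
      (T : ℝ)⁻¹ * ∑ k ∈ Finset.range (T + 1), ∫ ω, sys.runningCost S x0 w v δ k ω ∂μ := by
  rw [avgCost, integral_finsetSum _ fun k _ => hδ.integrable_runningCost hM k, one_div]

omit [IsProbabilityMeasure μ] hM in
lemma integral_decisionValue_nonneg (δ : ℕ → Ω → Bool) (k : ℕ) :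
    0 ≤ ∫ ω, decisionValue (δ k ω) ∂μ :=
  integral_nonneg fun ω => by cases δ k ω <;> simp [decisionValue]

lemma IsAdmissible.integral_decisionValue_le_one {δ : ℕ → Ω → Bool}
    (hδ : sys.IsAdmissible S x0 w v δ) (k : ℕ) : ∫ ω, decisionValue (δ k ω) ∂μ ≤ 1 := by
  have h := integral_mono (hδ.integrable_decisionValue hM k) (integrable_const (1 : ℝ))
    fun ω => by cases δ k ω <;> simp [decisionValue]
  simpa using h

omit hM in
lemma tendsto_stageConst (hPs : Tendsto sys.filtCov atTop (𝓝 Ps)) :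
    Tendsto (fun k => (S * sys.W + sys.errWeight S * sys.predCov k).trace) atTop
      (𝓝 (S * sys.W + sys.errWeight S * sys.timeUpdate Ps).trace) := by
  have hc : Continuous fun M : Matrix (Fin n) (Fin n) ℝ =>
      (S * sys.W + sys.errWeight S * M).trace := by fun_prop
  have h1 := (hc.tendsto _).comp (tendsto_predCov hPs)
  exact h1

omit hM in
-- Cyclicity of the trace, with the steady prediction covariance written as A Pˢ Aᵀ + W.
lemma trace_stageConst : (S * sys.W + sys.errWeight S * sys.timeUpdate Ps).trace =
    (S * sys.W + sys.Aᵀ * sys.errWeight S * sys.A * Ps + sys.errWeight S * sys.W).trace := by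
  rw [timeUpdate, Matrix.mul_add, Matrix.trace_add, Matrix.trace_add, Matrix.trace_add,
    Matrix.trace_add, ← add_assoc]
  congr 2
  rw [← Matrix.mul_assoc, Matrix.trace_mul_comm, ← Matrix.mul_assoc, ← Matrix.mul_assoc]

section Bounds

variable (hPs : Tendsto sys.filtCov atTop (𝓝 Ps))
  (hinnPs : (sys.C * sys.timeUpdate Ps * sys.Cᵀ + sys.V).PosDef)
  (hXi : (sys.mismatchCov Ps).PosDef) (hd : sys.IsDifferentialCost S Ps h j)
  (hu : UniformContinuous h) (hR : sys.R.PosDef) (hS : sys.IsControlRiccati S) (hθ : 0 ≤ sys.θ)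

include hPs hinnPs hXi hd hu hR hS hθ

/-- The summed Bellman inequality bounds the cost below up to the terminal term E[xᵀ S x]. No
stability of the law is assumed, so this term is handled by the moment argument of
`eventually_mul_le_of_moment_bound`. -/
theorem IsAdmissible.eventually_lt_avgCost (hQ : sys.Q = Qhalfᵀ * Qhalf)
    (hdet : IsDetectablePair sys.A Qhalf) {δ : ℕ → Ω → Bool}
    (hδ : sys.IsAdmissible S x0 w v δ) {c : ℝ}
    (hc : c < (S * sys.W + sys.errWeight S * sys.timeUpdate Ps).trace + j) :
    ∀ᶠ T in atTop, c ≤ sys.avgCost S x0 w v δ μ T := by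
  obtain ⟨b, hb⟩ := hd.bounded
  obtain ⟨ε, hε, hver⟩ := hM.exists_verification_rate hPs hinnPs hXi hd hu
  obtain ⟨C, hC, hmom⟩ := hδ.exists_sum_integral_norm_sq_le hM hQ hdet hR hθ
  obtain ⟨β, hβ0, hβ⟩ := abs_quadForm_le S
  obtain ⟨τ, hτ⟩ : ∃ τ : ℕ → ℝ, ∀ k,
    τ k = (S * sys.W + sys.errWeight S * sys.predCov k).trace := ⟨_, fun _ => rfl⟩
  have hτlim := tendsto_stageConst (S := S) hPs
  simp_rw [← hτ] at hτlim
  have hh : ∀ k, |∫ ω, h (sys.mismatch S x0 w v δ k ω) ∂μ| ≤ b := fun k => by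
    have h1 := norm_integral_le_of_norm_le_const (μ := μ)
      (f := fun ω => h (sys.mismatch S x0 w v δ k ω)) (.of_forall fun ω => hb _)
    simpa using h1
  have htele : ∀ T : ℕ, ∑ k ∈ Finset.range T, (j - ε k) +
      ∫ ω, h (sys.mismatch S x0 w v δ 0 ω) ∂μ - ∫ ω, h (sys.mismatch S x0 w v δ T ω) ∂μ ≤
      ∑ k ∈ Finset.range T,
        ∫ ω, sys.mdpCost S (sys.mismatch S x0 w v δ k ω) (δ k ω) ∂μ := fun T => by
    induction T with
    | zero => simp
    | succ T ih =>
      rw [Finset.sum_range_succ, Finset.sum_range_succ]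
      linarith [(hver δ hδ T).1]
  have hnn : ∀ k, 0 ≤ ∫ ω, sys.runningCost S x0 w v δ k ω ∂μ := fun k => by
    refine integral_nonneg fun ω => add_nonneg (add_nonneg ?_
      (quadForm_nonneg hR.posSemidef _)) (mul_nonneg hθ ?_)
    · rw [quadForm_Q hQ]
      positivity
    · cases δ k ω <;> simp [decisionValue]
  have hev := eventually_mul_le_of_moment_bound
    (J := fun T => ∑ k ∈ Finset.range T, ∫ ω, sys.runningCost S x0 w v δ k ω ∂μ)
    -- The cost runs over T + 1 times but only T mismatch transitions, which leaves τ T alone; 2 b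
    -- absorbs the two boundary values of h. The weight β + 1 rather than β ensures positivity.
    (s := fun T => ∑ k ∈ Finset.range T, (τ k + (j - ε k)) + (τ T - 2 * b))
    (m := fun k => ∫ ω, ‖sys.plantState S x0 w v δ k ω‖ ^ 2 ∂μ) (b := β + 1)
    (fun T T' hT => Finset.sum_le_sum_of_subset_of_nonneg (Finset.range_mono hT)
      fun k _ _ => hnn k)
    (fun T => Finset.sum_nonneg fun k _ => hnn k)
    (fun k => integral_nonneg fun ω => sq_nonneg _) (by linarith) hC
    (Ψ := (S * sys.W + sys.errWeight S * sys.timeUpdate Ps).trace + j)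
    (tendsto_cesaro_add (by simpa using hτlim.add ((tendsto_const_nhds (x := j)).sub hε))
      (hτlim.sub_const (2 * b))) ?_ hmom hc
  · filter_upwards [hev, eventually_gt_atTop 0] with T hT hT0
    have hT0' : (0 : ℝ) < T := by exact_mod_cast hT0
    rw [hδ.avgCost_eq hM, inv_mul_eq_div, le_div_iff₀ hT0']
    exact hT
  · intro T
    have hdec := hδ.sum_integral_runningCost hM hR hS T
    have ix : ∀ k, Integrable (fun ω => ‖sys.plantState S x0 w v δ k ω‖ ^ 2) μ := fun k =>
      (memLp_two_iff_integrable_sq_norm (hδ.memLp_plantState hM k).1).1 (hδ.memLp_plantState hM k)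
    have h1 : ∫ ω, quadForm S (sys.plantState S x0 w v δ (T + 1) ω) ∂μ ≤
        β * ∫ ω, ‖sys.plantState S x0 w v δ (T + 1) ω‖ ^ 2 ∂μ := by
      rw [← integral_const_mul]
      exact integral_mono (integrable_quadForm (hδ.memLp_plantState hM (T + 1)) S)
        ((ix (T + 1)).const_mul β) fun ω => (le_abs_self _).trans (hβ _)
    have h2 : 0 ≤ ∫ ω, ‖sys.plantState S x0 w v δ (T + 1) ω‖ ^ 2 ∂μ :=
      integral_nonneg fun ω => sq_nonneg _
    have h3 : 0 ≤ ∫ ω, quadForm S (sys.plantState S x0 w v δ 0 ω) ∂μ :=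
      integral_nonneg fun ω => quadForm_nonneg hS.1 _
    have h4 := mul_nonneg hθ (integral_decisionValue_nonneg (μ := μ) δ T)
    have h5 := (abs_le.1 (hh 0)).1
    have h6 := (abs_le.1 (hh T)).2
    have h7 := htele T
    simp_rw [← hτ] at hdec
    rw [Finset.sum_range_succ τ] at hdec
    simp only [Finset.sum_add_distrib]
    linarith

/-- Half of the limit is the general lower bound. For the other half the Bellman relation is an
equality up to ε, and the nonnegative terminal term is dropped. -/
theorem IsAdmissible.tendsto_avgCost (hQ : sys.Q = Qhalfᵀ * Qhalf)
    (hdet : IsDetectablePair sys.A Qhalf) {δ : ℕ → Ω → Bool}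
    (hδ : sys.IsAdmissible S x0 w v δ)
    (hopt : ∀ k ω, δ k ω = true ↔ 0 ≤ sys.VoI S Ps h (sys.mismatch S x0 w v δ k ω)) :
    Tendsto (sys.avgCost S x0 w v δ μ) atTop
      (𝓝 ((S * sys.W + sys.errWeight S * sys.timeUpdate Ps).trace + j)) := by
  refine tendsto_order.2 ⟨fun c hc => ?_, fun c hc => ?_⟩
  · obtain ⟨c', hcc', hc'⟩ := exists_between hc
    filter_upwards [hδ.eventually_lt_avgCost hM hPs hinnPs hXi hd hu hR hS hθ hQ hdet hc'] with T hT
    exact hcc'.trans_le hT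
  obtain ⟨b, hb⟩ := hd.bounded
  obtain ⟨ε, hε, hver⟩ := hM.exists_verification_rate hPs hinnPs hXi hd hu
  obtain ⟨τ, hτ⟩ : ∃ τ : ℕ → ℝ, ∀ k,
    τ k = (S * sys.W + sys.errWeight S * sys.predCov k).trace := ⟨_, fun _ => rfl⟩
  have hτlim := tendsto_stageConst (S := S) hPs
  simp_rw [← hτ] at hτlim
  have hh : ∀ k, |∫ ω, h (sys.mismatch S x0 w v δ k ω) ∂μ| ≤ b := fun k => by
    have h1 := norm_integral_le_of_norm_le_const (μ := μ)
      (f := fun ω => h (sys.mismatch S x0 w v δ k ω)) (.of_forall fun ω => hb _)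
    simpa using h1
  have htele : ∀ T : ℕ, ∑ k ∈ Finset.range T,
        ∫ ω, sys.mdpCost S (sys.mismatch S x0 w v δ k ω) (δ k ω) ∂μ ≤
      ∑ k ∈ Finset.range T, (j + ε k) +
      ∫ ω, h (sys.mismatch S x0 w v δ 0 ω) ∂μ - ∫ ω, h (sys.mismatch S x0 w v δ T ω) ∂μ :=
    fun T => by
    induction T with
    | zero => simp
    | succ T ih =>
      rw [Finset.sum_range_succ, Finset.sum_range_succ]
      linarith [(hver δ hδ T).2 hopt]
  obtain ⟨a, ha⟩ : ∃ a, a = ∫ ω, quadForm S (sys.plantState S x0 w v δ 0 ω) ∂μ := ⟨_, rfl⟩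
  -- The bounded extras are the boundary values of h (2 b), the initial term E[xᵀ S x] (a) and the
  -- last possible transmission (θ).
  have hlim : Tendsto (fun T : ℕ => (T : ℝ)⁻¹ * (∑ k ∈ Finset.range T, (τ k + (j + ε k)) +
      (τ T + (2 * b + a + sys.θ)))) atTop
      (𝓝 ((S * sys.W + sys.errWeight S * sys.timeUpdate Ps).trace + j)) :=
    tendsto_cesaro_add (by simpa using hτlim.add ((tendsto_const_nhds (x := j)).add hε))
      (hτlim.add_const (2 * b + a + sys.θ))
  filter_upwards [hlim.eventually (gt_mem_nhds hc)] with T hT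
  refine lt_of_le_of_lt ?_ hT
  rw [hδ.avgCost_eq hM]
  refine mul_le_mul_of_nonneg_left ?_ (inv_nonneg.2 T.cast_nonneg)
  have hdec := hδ.sum_integral_runningCost hM hR hS T
  have h3 : 0 ≤ ∫ ω, quadForm S (sys.plantState S x0 w v δ (T + 1) ω) ∂μ :=
    integral_nonneg fun ω => quadForm_nonneg hS.1 _
  have h4 := mul_le_mul_of_nonneg_left (hδ.integral_decisionValue_le_one hM T) hθ
  have h5 := (abs_le.1 (hh 0)).2
  have h6 := (abs_le.1 (hh T)).1
  have h7 := htele T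
  simp_rw [← hτ] at hdec
  rw [Finset.sum_range_succ τ, ← ha] at hdec
  simp only [Finset.sum_add_distrib] at h7 ⊢
  linarith

/-- The inferior limit is taken in the extended reals because the average cost of an admissible law
may tend to infinity. -/
theorem IsAdmissible.le_liminf_avgCost (hQ : sys.Q = Qhalfᵀ * Qhalf)
    (hdet : IsDetectablePair sys.A Qhalf) {δ : ℕ → Ω → Bool}
    (hδ : sys.IsAdmissible S x0 w v δ) :
    (((S * sys.W + sys.errWeight S * sys.timeUpdate Ps).trace + j : ℝ) : EReal) ≤
      liminf (fun T => ((sys.avgCost S x0 w v δ μ T : ℝ) : EReal)) atTop := by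
  refine EReal.ge_of_forall_gt_iff_ge.1 fun c hc => ?_
  refine le_liminf_of_le (by isBoundedDefault) ?_
  filter_upwards [hδ.eventually_lt_avgCost hM hPs hinnPs hXi hd hu hR hS hθ hQ hdet
    (EReal.coe_lt_coe_iff.1 hc)] with T hT
  exact EReal.coe_le_coe_iff.2 hT

end Bounds

end AverageCost

end NCS

end

/-! ### The theorem. -/

theorem mainTheorem2 {n m p : ℕ} (sys : NCS n m p)
    -- the plant
    (hctrl : IsControllablePair sys.A sys.B) (hobs : IsObservablePair sys.A sys.C)
    (hW : sys.W.PosSemidef) (hV : sys.V.PosSemidef) (hR0 : sys.R0.PosSemidef)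
    -- the cost
    (Qhalf : Matrix (Fin n) (Fin n) ℝ) (hQ : sys.Q = Qhalfᵀ * Qhalf)
    (hdet : IsDetectablePair sys.A Qhalf) (hR : sys.R.PosDef) (hθ : 0 ≤ sys.θ)
    (S : Matrix (Fin n) (Fin n) ℝ) (hS : sys.IsControlRiccati S)
    -- the Kalman filter and its steady state
    (hinn : ∀ k, (sys.C * sys.predCov k * sys.Cᵀ + sys.V).PosDef)
    (Ps : Matrix (Fin n) (Fin n) ℝ) (hPs : Tendsto sys.filtCov atTop (𝓝 Ps))
    (hinnPs : (sys.C * sys.timeUpdate Ps * sys.Cᵀ + sys.V).PosDef)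
    (hXi : (sys.mismatchCov Ps).PosDef)
    -- the random initial state and noises
    {Ω : Type*} [MeasurableSpace Ω] (μ : Measure Ω) [IsProbabilityMeasure μ]
    (x0 : Ω → EuclideanSpace ℝ (Fin n)) (w : ℕ → Ω → EuclideanSpace ℝ (Fin n))
    (v : ℕ → Ω → EuclideanSpace ℝ (Fin p))
    (hx0m : Measurable x0) (hwm : ∀ k, Measurable (w k)) (hvm : ∀ k, Measurable (v k))
    (hx0 : μ.map x0 = multivariateGaussian sys.xbar sys.R0)
    (hw : ∀ k, μ.map (w k) = multivariateGaussian 0 sys.W)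
    (hv : ∀ k, μ.map (v k) = multivariateGaussian 0 sys.V)
    (hwi : iIndepFun w μ) (hvi : iIndepFun v μ)
    (hwv : IndepFun (fun ω k => w k ω) (fun ω k => v k ω) μ)
    (hx0wv : IndepFun x0 (fun ω => ((fun k => w k ω), (fun k => v k ω))) μ) :
    -- a differential cost exists
    (∃ (h : EuclideanSpace ℝ (Fin n) → ℝ) (j : ℝ), sys.IsDifferentialCost S Ps h j) ∧
    -- all costs are finite
    (∀ δ : ℕ → Ω → Bool, sys.IsAdmissible S x0 w v δ →
      ∀ k, Integrable (sys.runningCost S x0 w v δ k) μ) ∧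
    -- every differential cost gives an optimal deterministic stationary scheduling law
    ∀ (h : EuclideanSpace ℝ (Fin n) → ℝ) (j : ℝ), sys.IsDifferentialCost S Ps h j →
      ∃ δ : ℕ → Ω → Bool,
        sys.IsAdmissible S x0 w v δ ∧
        (∀ k ω, δ k ω = true ↔ 0 ≤ sys.VoI S Ps h (sys.mismatch S x0 w v δ k ω)) ∧
        -- the remote estimate is the conditional mean of the state
        (∀ k, Integrable (sys.plantState S x0 w v δ k) μ ∧
          μ[sys.plantState S x0 w v δ k | sys.controllerInfo S x0 w v δ k]
            =ᵐ[μ] sys.remoteEst S x0 w v δ k) ∧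
        -- the optimal average cost
        Tendsto (sys.avgCost S x0 w v δ μ) atTop
          (𝓝 ((S * sys.W + sys.Aᵀ * sys.errWeight S * sys.A * Ps + sys.errWeight S * sys.W).trace
            + ∫ ξ, h ξ ∂(sys.mismatchNoise Ps))) ∧
        -- optimality among all admissible scheduling laws
        ∀ δ' : ℕ → Ω → Bool, sys.IsAdmissible S x0 w v δ' →
          (((S * sys.W + sys.Aᵀ * sys.errWeight S * sys.A * Ps + sys.errWeight S * sys.W).trace
            + ∫ ξ, h ξ ∂(sys.mismatchNoise Ps) : ℝ) : EReal)
            ≤ liminf (fun T => ((sys.avgCost S x0 w v δ' μ T : ℝ) : EReal)) atTop := by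
  have hM : sys.NoiseModel μ x0 w v :=
    ⟨hW, hV, hR0, hinn, hx0m, hwm, hvm, hx0, hw, hv, hwi, hvi, hwv, hx0wv⟩
  obtain ⟨A, H, T, hA, hH, hT⟩ :=
    NCS.exists_standardization (hS.posSemidef_errWeight hR) hXi
  refine ⟨NCS.exists_isDifferentialCost_of_standardization hA hH hT hθ,
    fun δ hδ k => hδ.integrable_runningCost hM k, fun h j hd => ?_⟩
  obtain ⟨b, hs⟩ := hd.solvesAverageCost hA hH hT
  -- Uniform continuity and evenness hold for every differential cost, not only the one constructed
  -- by vanishing discount.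
  have hu := hs.uniformContinuous hθ
  have heven := hs.even hθ fun k hk => NCS.tendsto_of_unobservable hQ hdet hR hS hA hH hk
  have hj : j = ∫ ξ, h ξ ∂(sys.mismatchNoise Ps) := by
    rw [hs.level_eq hθ hd.normalized, hT h hd.continuous]
    simp_rw [zero_add]
  have hVoIc : Continuous (sys.VoI S Ps h) := by
    have h1 : sys.VoI S Ps h = fun e => ‖H e‖ ^ 2 + gaussAvg T h (A e) - sys.θ -
        ∫ ξ, h ξ ∂(sys.mismatchNoise Ps) := by
      ext1 e
      rw [NCS.VoI, ← hH, hT h hd.continuous, hA]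
    rw [h1]
    have h2 := continuous_gaussAvg T hd.continuous hs.bounded
    fun_prop
  -- The average at -A e is that of the reflected h at A e, by symmetry of the noise, and h is even.
  have hVoIe : ∀ e, sys.VoI S Ps h (-e) = sys.VoI S Ps h e := fun e => by
    have h2 : gaussAvg T h (-A e) = gaussAvg T h (A e) := by
      rw [← gaussAvg_comp_neg]
      simp_rw [heven]
    rw [NCS.VoI, NCS.VoI, quadForm_neg, ← hT h hd.continuous, ← hT h hd.continuous, ← hA, ← hA,
      map_neg, h2]
  obtain ⟨π, hπ⟩ : ∃ π : EuclideanSpace ℝ (Fin n) → Bool,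
      π = fun e => decide (0 ≤ sys.VoI S Ps h e) := ⟨_, rfl⟩
  have hπm : Measurable π := by
    rw [hπ]
    refine measurable_to_bool ?_
    have h1 : (fun e => decide (0 ≤ sys.VoI S Ps h e)) ⁻¹' {true} = {e | 0 ≤ sys.VoI S Ps h e} := by
      ext e
      simp
    rw [h1]
    exact measurableSet_le measurable_const hVoIc.measurable
  have hπs : ∀ e, π (-e) = π e := fun e => by simp [hπ, hVoIe]
  obtain ⟨δ, hδ⟩ := sys.exists_feedback_decisions S x0 w v π
  have hadm := NCS.isAdmissible_of_feedback hπm hδ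
  have hopt : ∀ k ω, δ k ω = true ↔ 0 ≤ sys.VoI S Ps h (sys.mismatch S x0 w v δ k ω) :=
    fun k ω => by simp [hδ k ω, hπ]
  -- The claimed value is rewritten as the limiting stage constant plus the Bellman level j, the
  -- form in which the bounds were proved.
  rw [← NCS.trace_stageConst, ← hj]
  exact ⟨δ, hadm, hopt, fun k => ⟨(hadm.memLp_plantState hM k).integrable one_le_two,
    hM.condExp_plantState hπm hπs hδ k⟩,
    hadm.tendsto_avgCost hM hPs hinnPs hXi hd hu hR hS hθ hQ hdet hopt,
    fun δ' hδ' => hδ'.le_liminf_avgCost hM hPs hinnPs hXi hd hu hR hS hθ hQ hdet⟩
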